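/- **Setting.** Let $X,A$ be finite, $L\ge 1$, $m\ge 1$, and let $X$ be partitioned into layers $X_0,\dots,X_L$ with $X_0=\{x_0\}$ and $X_L=\{x_L\}$. Let $P(\cdot\mid x,a)$ be a transition function which from every $x\in X_k$, $k<L$, leads to $X_{k+1}$. For a policy $\pi$, let $q^{P,\pi}\in[0,1]^{X\times A}$ be its occupancy vector, $q^{P,\pi}(x,a)=\Pr[x_k=x,a_k=a\mid P,\pi]$ for $x\in X_k$, $k<L$ (and $0$ for $x=x_L$). For a set $\mathcal P$ of transition functions let $\Delta(\mathcal P)=\{q^{P',\pi}: P'\in\mathcal P,\ \pi \text{ a policy}\}$, and $\Delta(M)=\Delta(\{P\})$. For $r\in\mathbb R^{X\times A}$, $G\in\mathbb R^{(X\times A)\times m}$ let $\mathrm{OPT}_{r,G}=\max\{r^\top q: q\in\Delta(M),\ G^\top q\le 0\}$. There are $T\ge1$ episodes. In episode $t$ there are a reward vector $r_t\in[0,1]^{X\times A}$ and a constraint matrix $G_t\in[-1,1]^{(X\times A)\times m}$; the learner, who does not know $P$, plays a policy $\pi_t$, observes the trajectory $(x_k,a_k)_k$ and then $r_t,G_t$.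 *Stochastic constraints*: $G_t\sim\mathcal G$ for every $t$. The rewards are either *stochastic*, $r_t\sim\mathcal R$ for every $t$, or *adversarial*, an arbitrary sequence fixed in advance. The pair $(r_t,G_t)$ (which may be correlated within an episode) is independent of the history before episode $t$ and, given this history, of the trajectory of episode $t$. Put $\overline G=\mathbb E_{\mathcal G}[G]$, and $\overline r=\mathbb E_{\mathcal R}[r]$ for stochastic, $\overline r=\frac1T\sum_{t}r_t$ for adversarial rewards. With $q_t=q^{P,\pi_t}$, let $$R_T=T\,\mathrm{OPT}_{\overline r,\overline G}-\sum_{t=1}^T r_t^\top q_t,\qquad V_T=\max_{i\in[m]}\sum_{t=1}^T[G_t^\top q_t]_i,\qquad \rho=\max_{q\in\Delta(M)}\min_{i\in[m]}-[\overline G^\top q]_i .$$ **Algorithm (PDGD-OPS), with confidence parameter $\delta\in(0,1)$.** Put $C=5|X||A|/L$, $\eta=\big(100\,m|X||A|\sqrt{T\ln(T^2/\delta)}\big)^{-1}$. Start with $\widehat q_1(x,a)=1/(|X_k||A|)$ for $x\in X_k$, $k<L$ (and $0$ for $x=x_L$), $\lambda_1=0\in\mathbb R^m$, and the confidence set $\mathcal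 P_1$ of all transition functions. In episode $t$ play $\pi_t(a\mid x)=\widehat q_t(x,a)/\sum_b\widehat q_t(x,b)$ (a fixed arbitrary policy where this is $0/0$); let $\ell_t=G_t\lambda_t-r_t$, $\overline\ell_t=\max_{\tau\le t}\|\ell_\tau\|_\infty$, $\eta_t=1/(\overline\ell_t C\sqrt T)$; count the visits $N(x,a)$ and $M(x'\mid x,a)$. If for some pair visited in this episode the count has reached $\max\{1,2N_i(x,a)\}$, where $N_i$ is the count at the beginning of the current epoch $i$, a new epoch begins: $i$ increases by one, $N_i,M_i$ are the current counts, and, with $\overline P_i=M_i/\max\{1,N_i\}$, $\mathcal P_i$ is the set of transition functions $P'$ with $$\|P'(\cdot\mid x,a)-\overline P_i(\cdot\mid x,a)\|_1\le\sqrt{\frac{2|X_{k(x)+1}|\ln(T|X||A|/\delta)}{\max\{1,N_i(x,a)\}}}\qquad\forall (x,a),$$ where $k(x)$ is the layer of $x$ and $|X_{L+1}|=0$. Finally, with Euclidean projections $\Pi$, $$\widehat q_{t+1}=\Pi_{\Delta(\mathcal P_i)}(\widehat q_t-\eta_t\ell_t),\qquad \lambda_{t+1}=\Pi_{[0,T^{1/4}]^m}(\lambda_t+\eta\,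 G_t^\top\widehat q_t).$$ Let $R^{\mathsf P}_T(q)=\sum_{t=1}^T\ell_t^\top(q_t-q)$, $R^{\mathsf D}_T(\lambda)=\sum_{t=1}^T(\lambda-\lambda_t)^\top G_t^\top\widehat q_t$, and $$\mathcal E^G_\delta=2L\sqrt{2T\ln\tfrac{T^2}{\delta}},\quad \mathcal E^r_\delta=\tfrac{L}{\sqrt2}\sqrt{T\ln\tfrac2\delta},\quad \mathcal E^q_\delta=4L|X|\sqrt{2T\ln\tfrac1\delta}+6L|X|\sqrt{2T|A|\ln\tfrac{T|X||A|}{\delta}} .$$ **Theorem.** There is a constant $c>0$ depending only on $m,L,|X|,|A|$ such that the following holds for all $T\ge1$ and $\delta\in(0,1)$ in the stochastic constraint setting. Suppose that the offline problem is feasible, i.e. $\rho\ge0$, and that $\rho<T^{-1/8}L\sqrt{20m}$. Let $q^*$ be any maximizer in $\mathrm{OPT}_{\overline r,\overline G}$. * If the rewards are adversarial, then with probability at least $1-4\delta$ all of the following hold: $$R_T\le mT^{1/4}\mathcal E^G_\delta+mT^{1/4}\mathcal E^q_\delta+R^{\mathsf D}_T(0)+R^{\mathsf P}_T(q^*),\qquad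 V_T\le(2+2L)\tfrac1\eta T^{1/4}+\mathcal E^q_\delta,$$ $$R_T\le c\,\sqrt{\ln(T^2/\delta)}\;T^{3/4},\qquad V_T\le c\,\sqrt{\ln(T^2/\delta)}\;T^{3/4}.$$ * If the rewards are stochastic, then with probability at least $1-5\delta$ all of the following hold: $$R_T\le\mathcal E^r_\delta+mT^{1/4}\mathcal E^G_\delta+mT^{1/4}\mathcal E^q_\delta+R^{\mathsf D}_T(0)+R^{\mathsf P}_T(q^*),\qquad V_T\le(2+2L)\tfrac1\eta T^{1/4}+\mathcal E^q_\delta,$$ $$R_T\le c\,\sqrt{\ln(T^2/\delta)}\;T^{3/4},\qquad V_T\le c\,\sqrt{\ln(T^2/\delta)}\;T^{3/4}.$$ In particular $R_T=\tilde{\mathcal O}(T^{3/4})$ and $V_T=\tilde{\mathcal O}(T^{3/4})$ in both cases. -/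

import Mathlib

open MeasureTheory

noncomputable section

/-! ### Loop-free state spaces, transition functions, policies -/

/-- A loop-free (layered) state space `X`, partitioned into layers `X_0, …, X_L`, the layer `X_k`
being `{x | layer x = k}`; the first and the last layer are singletons. -/
structure LayeredSpace (X : Type*) (L : ℕ) where
  layer : X → ℕ
  start : X
  final : X
  layer_le : ∀ x, layer x ≤ L
  layer_eq_zero_iff : ∀ x, layer x = 0 ↔ x = start
  layer_eq_last_iff : ∀ x, layer x = L ↔ x = final

/-- `|X_k|`. -/
def LayeredSpace.layerCard {X : Type*} {L : ℕ} (S : LayeredSpace X L) (k : ℕ) : ℕ :=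
  Nat.card {x : X // S.layer x = k}

/-- `P x a x'` is the probability `P(x' | x, a)`: each step leads to the next layer, and
`P(· | x, a)` is a probability vector for every state `x` outside the last layer. -/
structure IsTransition {X A : Type*} [Fintype X] {L : ℕ} (S : LayeredSpace X L)
    (P : X → A → X → ℝ) : Prop where
  nonneg : ∀ x a x', 0 ≤ P x a x'
  next_layer : ∀ x a x', P x a x' ≠ 0 → S.layer x' = S.layer x + 1
  sum_eq_one : ∀ x a, S.layer x < L → ∑ x', P x a x' = 1

/-- `π x a` is the probability `π(a | x)`. -/
structure IsPolicy {X A : Type*} [Fintype A] (π : X → A → ℝ) : Prop where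
  nonneg : ∀ x a, 0 ≤ π x a
  sum_eq_one : ∀ x, ∑ a, π x a = 1

/-! ### Trajectories and occupancy measures -/

/-- The states `x_0, …, x_L` and the actions `a_0, …, a_{L-1}` of one episode. -/
abbrev Trajectory (X A : Type*) (L : ℕ) : Type _ := (Fin (L + 1) → X) × (Fin L → A)

open Classical in
/-- The probability of a trajectory that starts in `x_0` and follows `a_k ∼ π(· | x_k)`,
`x_{k+1} ∼ P(· | x_k, a_k)`. -/
def trajProb {X A : Type*} {L : ℕ} (S : LayeredSpace X L) (P : X → A → X → ℝ) (π : X → A → ℝ)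
    (τ : Trajectory X A L) : ℝ :=
  (if τ.1 0 = S.start then 1 else 0) *
    ∏ k : Fin L, (π (τ.1 k.castSucc) (τ.2 k) * P (τ.1 k.castSucc) (τ.2 k) (τ.1 k.succ))

open Classical in
/-- `q^{P,π}(x, a, x') = Pr[x_k = x, a_k = a, x_{k+1} = x']`, where `k < L` is the layer of `x`
(and `0` for `x` in the last layer, where no action is taken). -/
def occTriple {X A : Type*} [Fintype X] [Fintype A] {L : ℕ} (S : LayeredSpace X L)
    (P : X → A → X → ℝ) (π : X → A → ℝ) (x : X) (a : A) (x' : X) : ℝ :=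
  ∑ τ : Trajectory X A L,
    if ∃ k : Fin L, (k : ℕ) = S.layer x ∧ τ.1 k.castSucc = x ∧ τ.2 k = a ∧ τ.1 k.succ = x'
    then trajProb S P π τ else 0

/-- The occupancy vector `q^{P,π}(x, a) = ∑_{x'} q^{P,π}(x, a, x')`. -/
def occ {X A : Type*} [Fintype X] [Fintype A] {L : ℕ} (S : LayeredSpace X L)
    (P : X → A → X → ℝ) (π : X → A → ℝ) : X × A → ℝ :=
  fun p => ∑ x', occTriple S P π p.1 p.2 x'

/-- `Δ(Q)`: the occupancy vectors that some transition function in `Q` and some policy induce.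
The set `Δ(M)` of valid occupancy vectors of a CMDP with transition function `P` is `Δ({P})`. -/
def occSet {X A : Type*} [Fintype X] [Fintype A] {L : ℕ} (S : LayeredSpace X L)
    (Q : Set (X → A → X → ℝ)) : Set (X × A → ℝ) :=
  {q | ∃ P ∈ Q, ∃ π : X → A → ℝ, IsPolicy π ∧ q = occ S P π}

open Classical in
/-- The policy `π^q(a | x) = q(x, a) / q(x)`; in states with `q(x) = 0` the quotient is undefined
and the fallback policy `π₀` is used. -/
def inducedPolicy {X A : Type*} [Fintype A] (π₀ : X → A → ℝ) (q : X × A → ℝ) : X → A → ℝ :=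
  fun x a => if ∑ b, q (x, b) = 0 then π₀ x a else q (x, a) / ∑ b, q (x, b)

/-! ### The offline problem and the feasibility parameter -/

/-- The feasible occupancy vectors: `q ∈ Δ(M)` with `Gᵀ q ≤ 0`. -/
def feasibleSet {X A : Type*} [Fintype X] [Fintype A] {L m : ℕ} (S : LayeredSpace X L)
    (P : X → A → X → ℝ) (G : Matrix (X × A) (Fin m) ℝ) : Set (X × A → ℝ) :=
  {q | q ∈ occSet S {P} ∧ ∀ i, (G.transpose.mulVec q) i ≤ 0}

/-- `OPT_{r,G}`, the value of: maximize `rᵀ q` over `q ∈ Δ(M)` with `Gᵀ q ≤ 0`. -/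
def optValue {X A : Type*} [Fintype X] [Fintype A] {L m : ℕ} (S : LayeredSpace X L)
    (P : X → A → X → ℝ) (r : X × A → ℝ) (G : Matrix (X × A) (Fin m) ℝ) : ℝ :=
  sSup ((fun q => r ⬝ᵥ q) '' feasibleSet S P G)

/-- `q` is an optimal solution of that problem. -/
def IsOptimal {X A : Type*} [Fintype X] [Fintype A] {L m : ℕ} (S : LayeredSpace X L)
    (P : X → A → X → ℝ) (r : X × A → ℝ) (G : Matrix (X × A) (Fin m) ℝ) (q : X × A → ℝ) : Prop :=
  q ∈ feasibleSet S P G ∧ ∀ q' ∈ feasibleSet S P G, r ⬝ᵥ q' ≤ r ⬝ᵥ q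

/-- The feasibility parameter `ρ = max_{q ∈ Δ(M)} min_i -[Gᵀ q]_i` (for stochastic constraints,
`G` is the mean constraint matrix). -/
def feasParam {X A : Type*} [Fintype X] [Fintype A] {L m : ℕ} (S : LayeredSpace X L)
    (P : X → A → X → ℝ) (G : Matrix (X × A) (Fin m) ℝ) : ℝ :=
  sSup ((fun q => ⨅ i, -(G.transpose.mulVec q) i) '' occSet S {P})

/-! ### The algorithm PDGD-OPS -/

/-- `p` is a Euclidean projection of `y` on `K`. -/
def IsEuclProj {ι : Type*} [Fintype ι] (K : Set (ι → ℝ)) (y p : ι → ℝ) : Prop :=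
  p ∈ K ∧ ∀ z ∈ K, ∑ i, (p i - y i) ^ 2 ≤ ∑ i, (z i - y i) ^ 2

open Classical in
/-- The Euclidean projection `Π_K(y)`. -/
def euclProj {ι : Type*} [Fintype ι] (K : Set (ι → ℝ)) (y : ι → ℝ) : ι → ℝ :=
  if h : ∃ p, IsEuclProj K y p then h.choose else y

/-- What the learner observes in one episode: the trajectory, the reward vector and the
constraint matrix. -/
structure Feedback (X A : Type*) (L m : ℕ) where
  path : Trajectory X A L
  reward : X × A → ℝ
  cons : Matrix (X × A) (Fin m) ℝ

/-- The memory of the algorithm at the beginning of episode `t`. -/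
structure AlgState (X A : Type*) (m : ℕ) where
  /-- the primal iterate `q̂_t` -/
  primal : X × A → ℝ
  /-- the dual iterate `λ_t` -/
  dual : Fin m → ℝ
  /-- the largest sup-norm of the losses of the previous episodes -/
  lossMax : ℝ
  /-- the current number of visits of `(x, a)` -/
  cnt : X → A → ℕ
  /-- the current number of visits of `(x, a, x')` -/
  cntNext : X → A → X → ℕ
  /-- the number of visits of `(x, a)` before the current epoch -/
  epochCnt : X → A → ℕ
  /-- the confidence set `𝒫_i` of the current epoch -/
  conf : Set (X → A → X → ℝ)

/-- The confidence set given by the counters `N(x, a)`, `M(x' | x, a)`: the transition functions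
`P'` with `‖P'(· | x, a) - P̄(· | x, a)‖₁ ≤ ε(x, a)` for all `(x, a)`, where
`P̄ = M / max {1, N}` and `ε = √(2 |X_{k(x)+1}| ln(T |X| |A| / δ) / max {1, N})`. -/
def confSet {X A : Type*} [Fintype X] [Fintype A] {L : ℕ} (S : LayeredSpace X L) (T : ℕ) (δ : ℝ)
    (N : X → A → ℕ) (M : X → A → X → ℕ) : Set (X → A → X → ℝ) :=
  {P' | IsTransition S P' ∧ ∀ x a,
    ∑ x', |P' x a x' - (M x a x' : ℝ) / max 1 (N x a : ℝ)| ≤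
      Real.sqrt (2 * (S.layerCard (S.layer x + 1) : ℝ) *
        Real.log ((T : ℝ) * Fintype.card X * Fintype.card A / δ) / max 1 (N x a : ℝ))}

open Classical in
/-- The initial occupancy vector: `q̂_1(x, a, x') = 1 / (|X_k| |A| |X_{k+1}|)` for `x ∈ X_k`,
`x' ∈ X_{k+1}`, summed over `x'`. -/
def initOcc {X A : Type*} [Fintype X] [Fintype A] {L : ℕ} (S : LayeredSpace X L) : X × A → ℝ :=
  fun p => ∑ x' : X, if S.layer x' = S.layer p.1 + 1 then
    1 / ((S.layerCard (S.layer p.1) : ℝ) * Fintype.card A * S.layerCard (S.layer p.1 + 1)) else 0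

/-- The memory before the first episode; the first confidence set consists of all transition
functions. -/
def initState {X A : Type*} [Fintype X] [Fintype A] {L : ℕ} (S : LayeredSpace X L) (m : ℕ) :
    AlgState X A m where
  primal := initOcc S
  dual := 0
  lossMax := 0
  cnt := fun _ _ => 0
  cntNext := fun _ _ _ => 0
  epochCnt := fun _ _ => 0
  conf := {P' | IsTransition S P'}

/-- The constant `C = 5 |X| |A| / L` of the primal learning rate. -/
def constC (X A : Type*) [Fintype X] [Fintype A] (L : ℕ) : ℝ :=
  5 * (Fintype.card X * Fintype.card A) / L

/-- The dual learning rate `η = 1 / (100 m |X| |A| √(T ln(T² / δ)))`. -/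
def dualRate (X A : Type*) [Fintype X] [Fintype A] (m T : ℕ) (δ : ℝ) : ℝ :=
  1 / (100 * m * Fintype.card X * Fintype.card A * Real.sqrt (T * Real.log ((T : ℝ) ^ 2 / δ)))

/-- The Lagrangian loss `ℓ_t = G_t λ_t - r_t`. -/
def AlgState.loss {X A : Type*} {L m : ℕ} (s : AlgState X A m) (f : Feedback X A L m) :
    X × A → ℝ :=
  f.cons.mulVec s.dual - f.reward

open Classical in
/-- One episode of PDGD-OPS. The norm `‖s.loss f‖` is the sup-norm. -/
def algStep {X A : Type*} [Fintype X] [Fintype A] {L m : ℕ} (S : LayeredSpace X L) (T : ℕ) (δ : ℝ)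
    (s : AlgState X A m) (f : Feedback X A L m) : AlgState X A m :=
  let lossMax' : ℝ := max s.lossMax ‖s.loss f‖
  let rate : ℝ := 1 / (lossMax' * constC X A L * Real.sqrt T)
  let N' : X → A → ℕ := fun x a =>
    s.cnt x a + (Finset.univ.filter fun k : Fin L =>
      f.path.1 k.castSucc = x ∧ f.path.2 k = a).card
  let M' : X → A → X → ℕ := fun x a x' =>
    s.cntNext x a x' + (Finset.univ.filter fun k : Fin L =>
      f.path.1 k.castSucc = x ∧ f.path.2 k = a ∧ f.path.1 k.succ = x').card
  let newEpoch : Prop := ∃ k : Fin L,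
    max 1 (2 * s.epochCnt (f.path.1 k.castSucc) (f.path.2 k)) ≤
      N' (f.path.1 k.castSucc) (f.path.2 k)
  let conf' : Set (X → A → X → ℝ) := if newEpoch then confSet S T δ N' M' else s.conf
  { primal := euclProj (occSet S conf') (s.primal - rate • s.loss f)
    dual := euclProj (Set.Icc 0 fun _ => (T : ℝ) ^ (1 / 4 : ℝ))
      (s.dual + dualRate X A m T δ • f.cons.transpose.mulVec s.primal)
    lossMax := lossMax'
    cnt := N'
    cntNext := M'
    epochCnt := if newEpoch then N' else s.epochCnt
    conf := conf' }

/-- The memory of PDGD-OPS after the first `t` episodes, i.e. at the beginning of the episode with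
index `t` (episodes are indexed from `0`), as a function of the feedback. -/
def algRun {X A : Type*} [Fintype X] [Fintype A] {L m : ℕ} (S : LayeredSpace X L) (T : ℕ) (δ : ℝ)
    (f : ℕ → Feedback X A L m) : ℕ → AlgState X A m
  | 0 => initState S m
  | t + 1 => algStep S T δ (algRun S T δ f t) (f t)

/-- The policy `π_t = π^{q̂_t}` played in the episode with index `t`. -/
def playedPolicy {X A : Type*} [Fintype X] [Fintype A] {L m : ℕ} (S : LayeredSpace X L) (T : ℕ)
    (δ : ℝ) (π₀ : X → A → ℝ) (f : ℕ → Feedback X A L m) (t : ℕ) : X → A → ℝ :=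
  inducedPolicy π₀ (algRun S T δ f t).primal

/-! ### The interaction of PDGD-OPS with a random environment -/

/-- The measurable structure on constraint matrices, entry by entry. -/
instance instMeasurableSpaceConsMatrix {ι κ : Type*} : MeasurableSpace (Matrix ι κ ℝ) :=
  inferInstanceAs (MeasurableSpace (ι → κ → ℝ))

/-- The σ-algebra generated by the feedback of the episodes before `t`. -/
abbrev historyBefore {X A Ω : Type*} {L m : ℕ} (F : ℕ → Ω → Feedback X A L m) (t : ℕ) :
    MeasurableSpace Ω :=
  ⨆ (s : ℕ) (_ : s < t),
    MeasurableSpace.comap (fun ω => (F s ω).path) ⊤ ⊔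
    MeasurableSpace.comap (fun ω => (F s ω).reward) inferInstance ⊔
    MeasurableSpace.comap (fun ω => (F s ω).cons) inferInstance

/-- `F` is the feedback process of `T` episodes of PDGD-OPS in a CMDP with transition function `P`,
where the pair `(r_t, G_t)` has law `D t`: given the history before episode `t`,
the pair `(r_t, G_t)` is drawn from `D t` and, independently of it, the trajectory is drawn by
following `π_t` in the environment `P`. -/
structure IsInteraction {X A Ω : Type*} [Fintype X] [Fintype A] [MeasurableSpace Ω] {L m : ℕ}
    (S : LayeredSpace X L) (P : X → A → X → ℝ) (T : ℕ) (δ : ℝ) (π₀ : X → A → ℝ)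
    (D : ℕ → Measure ((X × A → ℝ) × Matrix (X × A) (Fin m) ℝ))
    (F : ℕ → Ω → Feedback X A L m) (μ : Measure Ω) : Prop where
  measurable_path : ∀ t < T, ∀ τ, MeasurableSet {ω | (F t ω).path = τ}
  measurable_reward : ∀ t < T, Measurable fun ω => (F t ω).reward
  measurable_cons : ∀ t < T, Measurable fun ω => (F t ω).cons
  law : ∀ t < T, ∀ H : Set Ω, MeasurableSet[historyBefore F t] H →
    ∀ B : Set ((X × A → ℝ) × Matrix (X × A) (Fin m) ℝ), MeasurableSet B →
    ∀ τ : Trajectory X A L,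
      μ (H ∩ {ω | ((F t ω).reward, (F t ω).cons) ∈ B ∧ (F t ω).path = τ}) =
        ∫⁻ ω in H, D t B *
          ENNReal.ofReal (trajProb S P (playedPolicy S T δ π₀ (fun s => F s ω) t) τ) ∂μ

/-! ### Performance measures -/

/-- The occupancy vector `q_t = q^{P,π_t}` of the policy played in the episode with index `t`. -/
def playedOcc {X A : Type*} [Fintype X] [Fintype A] {L m : ℕ} (S : LayeredSpace X L)
    (P : X → A → X → ℝ) (T : ℕ) (δ : ℝ) (π₀ : X → A → ℝ) (f : ℕ → Feedback X A L m) (t : ℕ) :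
    X × A → ℝ :=
  occ S P (playedPolicy S T δ π₀ f t)

/-- The cumulative regret `R_T = T · OPT_{r̄,Ḡ} - ∑_t r_tᵀ q_t`. -/
def cumRegret {X A : Type*} [Fintype X] [Fintype A] {L m : ℕ} (S : LayeredSpace X L)
    (P : X → A → X → ℝ) (T : ℕ) (δ : ℝ) (π₀ : X → A → ℝ) (rbar : X × A → ℝ)
    (Gbar : Matrix (X × A) (Fin m) ℝ) (f : ℕ → Feedback X A L m) : ℝ :=
  T * optValue S P rbar Gbar -
    ∑ t ∈ Finset.range T, (f t).reward ⬝ᵥ playedOcc S P T δ π₀ f t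

/-- The cumulative constraint violation `V_T = max_i ∑_t [G_tᵀ q_t]_i`. -/
def cumViolation {X A : Type*} [Fintype X] [Fintype A] {L m : ℕ} (S : LayeredSpace X L)
    (P : X → A → X → ℝ) (T : ℕ) (δ : ℝ) (π₀ : X → A → ℝ) (f : ℕ → Feedback X A L m) : ℝ :=
  ⨆ i : Fin m, ∑ t ∈ Finset.range T, ((f t).cons.transpose.mulVec (playedOcc S P T δ π₀ f t)) i

/-- The regret of the primal player `R^P_T(q) = ∑_t ℓ_tᵀ (q_t - q)`. -/
def primalRegret {X A : Type*} [Fintype X] [Fintype A] {L m : ℕ} (S : LayeredSpace X L)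
    (P : X → A → X → ℝ) (T : ℕ) (δ : ℝ) (π₀ : X → A → ℝ) (f : ℕ → Feedback X A L m)
    (q : X × A → ℝ) : ℝ :=
  ∑ t ∈ Finset.range T, (algRun S T δ f t).loss (f t) ⬝ᵥ (playedOcc S P T δ π₀ f t - q)

/-- The regret of the dual player `R^D_T(ν) = ∑_t (ν - λ_t)ᵀ G_tᵀ q̂_t`. -/
def dualRegret {X A : Type*} [Fintype X] [Fintype A] {L m : ℕ} (S : LayeredSpace X L)
    (T : ℕ) (δ : ℝ) (f : ℕ → Feedback X A L m) (ν : Fin m → ℝ) : ℝ :=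
  ∑ t ∈ Finset.range T,
    (ν - (algRun S T δ f t).dual) ⬝ᵥ ((f t).cons.transpose.mulVec (algRun S T δ f t).primal)

/-- `ℰ^G_δ = 2 L √(2 T ln(T² / δ))`. -/
def errG (L T : ℕ) (δ : ℝ) : ℝ :=
  2 * L * Real.sqrt (2 * T * Real.log ((T : ℝ) ^ 2 / δ))

/-- `ℰ^r_δ = (L / √2) √(T ln(2 / δ))`. -/
def errR (L T : ℕ) (δ : ℝ) : ℝ :=
  L / Real.sqrt 2 * Real.sqrt (T * Real.log (2 / δ))

/-- `ℰ^q_δ = 4 L |X| √(2 T ln(1 / δ)) + 6 L |X| √(2 T |A| ln(T |X| |A| / δ))`. -/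
def errQ (X A : Type*) [Fintype X] [Fintype A] (L T : ℕ) (δ : ℝ) : ℝ :=
  4 * L * Fintype.card X * Real.sqrt (2 * T * Real.log (1 / δ)) +
    6 * L * Fintype.card X * Real.sqrt (2 * T * Fintype.card A *
      Real.log ((T : ℝ) * Fintype.card X * Fintype.card A / δ))

/-- The mean reward vector of a law of reward vectors. -/
def meanReward {X A : Type*} (ℛ : Measure (X × A → ℝ)) : X × A → ℝ :=
  fun p => ∫ r, r p ∂ℛ

/-- The mean constraint matrix of a law of constraint matrices. -/
def meanCons {X A : Type*} {m : ℕ} (𝒢 : Measure (Matrix (X × A) (Fin m) ℝ)) :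
    Matrix (X × A) (Fin m) ℝ :=
  fun p i => ∫ G, G p i ∂𝒢

/-- The average of the first `T` reward vectors of a sequence. -/
def averageReward {X A : Type*} (T : ℕ) (r : ℕ → X × A → ℝ) : X × A → ℝ :=
  fun p => 1 / (T : ℝ) * ∑ t ∈ Finset.range T, r t p

end

/-! The algorithm is a game between a primal player, who runs projected gradient descent on the
Lagrangian losses ℓ_t over occupancy vectors, and a dual player, who runs projected gradient ascent
on multipliers in [0, T^{1/4}]^m. The proof is a deterministic inequality on a good event plus
concentration bounds for that event. The cap T^{1/4} takes the place of a bound on multipliers by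
strong duality: it limits the losses to 1 + m T^{1/4}, and it is still large enough for a constraint
violation to be punished.

Deterministic part. As long as P lies in every confidence set, q* is an admissible comparator, and
gradient descent has regret of order T^{1/4} √T = T^{3/4} on the computed vectors q̂_t
(`primal_ogd`). For the regret, expanding ℓ_t = G_t λ_t - r_t splits r̄ᵀq* - r_tᵀq_t into the primal
regret, the dual regret at 0, the cost of replacing q_t by q̂_t, the reward deviation at q*, and
λ_tᵀG_tᵀq*. The last is at most λ_tᵀ(G_t - Ḡ)ᵀq*, because λ_t ≥ 0 and Ḡᵀq* ≤ 0
(`regret_decomposition`). For the violation, the dual regret is taken against T^{1/4} e_i: then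
T^{1/4} ∑ [G_tᵀq̂_t]_i is at most that regret plus ∑ λ_tᵀG_tᵀq̂_t, and the latter sum is at most the
primal regret at q̂_t, the constraint deviation and T L. Everything is of order T √ln(T²/δ), and
division by T^{1/4} gives the rate (`sum_cons_primal_le`).

Distance of q_t and q̂_t. Both are occupancy vectors of the played policy, under P and under some P'
in the confidence set (`exists_primal_eq_occ`). The error of P' propagates through the layers
(`sum_occ_diff`), which bounds the distance by L times the expected sum of the confidence widths
along a trajectory. Expected visits are replaced by observed ones at the price of a martingale, and
the observed widths add up to order √T because epochs end when a count doubles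
(`sum_playedOcc_sub_primal_le_errQ`).

Probabilistic part. All deviations are handled by exponential supermartingales (`SuperStep`,
`IsInteraction.measure_le_exp`) fed by Hoeffding's lemma. The failure probabilities are 2δ for the
empirical transitions, δ for the visit martingale, δ for the constraints, and δ more for stochastic
rewards. The transition bound writes the ℓ₁ norm as a maximum over sign vectors and takes a union
bound over pairs, signs and visit counts (`IsInteraction.measure_not_concentrated_le`). These
arguments need the iterates to be measurable with respect to the history, which follows from the
continuity of projections onto compact convex sets (`RowConvex.convex_occSet`,
`measurable_iterates`). -/

noncomputable section

set_option linter.unusedSectionVars false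

/-! ### The Markov chain of a policy -/

/-- The transition matrix of the state process when the policy `π` is followed. -/
def stepKernel {X A : Type*} [Fintype A] (P : X → A → X → ℝ) (π : X → A → ℝ) : Matrix X X ℝ :=
  fun x x' => ∑ a, π x a * P x a x'

open Classical in
/-- The probability that the state `x` is reached. -/
def stateOcc {X A : Type*} [Fintype X] [Fintype A] {L : ℕ} (S : LayeredSpace X L)
    (P : X → A → X → ℝ) (π : X → A → ℝ) (x : X) : ℝ :=
  (stepKernel P π ^ S.layer x) S.start x

open Classical in
/-- The expectation of `g` along `n` steps of the chain that starts in `x`. -/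
def pathSum {X A : Type*} [Fintype X] [Fintype A] (P : X → A → X → ℝ) (π : X → A → ℝ) (n : ℕ)
    (g : (Fin (n + 1) → X) → (Fin n → A) → ℝ) (x : X) : ℝ :=
  ∑ s : Fin (n + 1) → X, ∑ α : Fin n → A,
    (if s 0 = x then 1 else 0) *
      (∏ k : Fin n, (π (s k.castSucc) (α k) * P (s k.castSucc) (α k) (s k.succ))) * g s α

lemma sum_fin_cons {Y : Type*} [Fintype Y] {n : ℕ} (f : (Fin (n + 1) → Y) → ℝ) :
    ∑ s, f s = ∑ y : Y, ∑ s : Fin n → Y, f (Fin.cons y s) := by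
  rw [← (Fin.consEquiv (fun _ : Fin (n + 1) => Y)).sum_comp, Fintype.sum_prod_type]
  rfl

/-- Markov property: conditioning on the first action and the next state leaves a chain with one
step less. The path identities below are inductions on this recursion. -/
lemma pathSum_succ {X A : Type*} [Fintype X] [Fintype A] (P : X → A → X → ℝ) (π : X → A → ℝ)
    (n : ℕ) (g : (Fin (n + 2) → X) → (Fin (n + 1) → A) → ℝ) (x : X) :
    pathSum P π (n + 1) g x = ∑ a, ∑ x', π x a * P x a x' *
      pathSum P π n (fun s α => g (Fin.cons x s) (Fin.cons a α)) x' := by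
  classical
  unfold pathSum
  rw [sum_fin_cons]
  have h1 : ∀ y : X, (∑ s : Fin (n + 1) → X, ∑ α : Fin (n + 1) → A,
      (if (Fin.cons y s : Fin (n + 2) → X) 0 = x then (1 : ℝ) else 0) *
      (∏ k : Fin (n + 1), (π ((Fin.cons y s : Fin (n + 2) → X) k.castSucc) (α k) *
        P ((Fin.cons y s : Fin (n + 2) → X) k.castSucc) (α k)
          ((Fin.cons y s : Fin (n + 2) → X) k.succ))) * g (Fin.cons y s) α) =
      if y = x then (∑ s : Fin (n + 1) → X, ∑ a, ∑ α : Fin n → A, π x a * P x a (s 0) *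
        ((∏ k : Fin n, (π (s k.castSucc) (α k) * P (s k.castSucc) (α k) (s k.succ))) *
          g (Fin.cons x s) (Fin.cons a α))) else 0 := by
    intro y
    split_ifs with h
    · subst h
      refine Finset.sum_congr rfl fun s _ => ?_
      rw [sum_fin_cons]
      refine Finset.sum_congr rfl fun a _ => Finset.sum_congr rfl fun α _ => ?_
      rw [Fin.prod_univ_succ]
      simp only [Fin.cons_zero, if_true, Fin.castSucc_zero, Fin.cons_succ, ← Fin.succ_castSucc]
      ring
    · simp [h]
  simp only [h1, Finset.sum_ite_eq', Finset.mem_univ, if_true]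
  rw [Finset.sum_comm]
  refine Finset.sum_congr rfl fun a _ => ?_
  simp only [Finset.mul_sum]
  rw [Finset.sum_comm]
  symm
  rw [Finset.sum_comm]
  rw [Finset.sum_comm]
  have h2 : ∀ s : Fin (n + 1) → X, ∀ α : Fin n → A, (∑ x', π x a * P x a x' *
      ((if s 0 = x' then (1 : ℝ) else 0) *
        (∏ k : Fin n, (π (s k.castSucc) (α k) * P (s k.castSucc) (α k) (s k.succ))) *
          g (Fin.cons x s) (Fin.cons a α))) =
      π x a * P x a (s 0) *
        ((∏ k : Fin n, (π (s k.castSucc) (α k) * P (s k.castSucc) (α k) (s k.succ))) *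
          g (Fin.cons x s) (Fin.cons a α)) := by
    intro s α
    rw [Finset.sum_eq_single (s 0)]
    · simp
    · intro b _ hb; simp [hb.symm]
    · simp
  rw [Finset.sum_comm]
  rw [Finset.sum_comm (s := (Finset.univ : Finset (Fin n → A)))]
  refine Finset.sum_congr rfl fun s _ => ?_
  rw [Finset.sum_comm]
  exact Finset.sum_congr rfl fun α _ => h2 s α

lemma pathSum_mul_start {X A : Type*} [Fintype X] [Fintype A] (P : X → A → X → ℝ)
    (π : X → A → ℝ) (n : ℕ) (h : X → ℝ) (x : X) :
    pathSum P π n (fun s _ => h (s 0)) x = h x * pathSum P π n (fun _ _ => 1) x := by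
  classical
  unfold pathSum
  simp only [Finset.mul_sum]
  refine Finset.sum_congr rfl fun s _ => Finset.sum_congr rfl fun α _ => ?_
  split_ifs with h0
  · rw [h0]; ring
  · ring

/-! ### Trajectories, visit counts and occupancy vectors. -/

section
variable {X A : Type*} [Fintype X] [Fintype A] {L : ℕ} {S : LayeredSpace X L}
  {P : X → A → X → ℝ} {π : X → A → ℝ}

lemma IsTransition.eq_zero (hP : IsTransition S P) {x x' : X} (a : A)
    (h : S.layer x' ≠ S.layer x + 1) : P x a x' = 0 := by
  by_contra h0
  exact h (hP.next_layer x a x' h0)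

/-- There is no layer beyond L, so the rows of the last layer vanish, although the row-sum condition
does not mention them. -/
lemma IsTransition.last (hP : IsTransition S P) {x : X} (a : A) (x' : X)
    (h : ¬ S.layer x < L) : P x a x' = 0 :=
  hP.eq_zero a (by have := S.layer_le x'; omega)

lemma IsTransition.sum_le_one (hP : IsTransition S P) (x : X) (a : A) : ∑ x', P x a x' ≤ 1 := by
  by_cases h : S.layer x < L
  · exact (hP.sum_eq_one x a h).le
  · simp [hP.last a _ h]

/-- The condition on `n` keeps all steps before the last layer, where the rows of `P` sum to one. -/
lemma pathSum_one (hP : IsTransition S P) (hπ : IsPolicy π) (n : ℕ) (x : X)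
    (hx : S.layer x + n ≤ L) : pathSum P π n (fun _ _ => 1) x = 1 := by
  classical
  induction n generalizing x with
  | zero =>
    unfold pathSum
    rw [sum_fin_cons]
    simp
  | succ n ih =>
    rw [pathSum_succ]
    have : ∀ a x', π x a * P x a x' * pathSum P π n (fun _ _ => 1) x' = π x a * P x a x' := by
      intro a x'
      by_cases h : S.layer x' = S.layer x + 1
      · rw [ih x' (by omega), mul_one]
      · rw [hP.eq_zero a h]; simp
    simp only [this, ← Finset.mul_sum, hP.sum_eq_one x _ (show S.layer x < L by omega), mul_one,
      hπ.sum_eq_one]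

open Classical in
lemma pathSum_step (hP : IsTransition S P) (hπ : IsPolicy π) (n : ℕ) (k : Fin n) (x : X)
    (hx : S.layer x + n ≤ L) (y : X) (a : A) (y' : X) :
    pathSum P π n (fun s α => if s k.castSucc = y ∧ α k = a ∧ s k.succ = y' then 1 else 0) x =
      (stepKernel P π ^ (k : ℕ)) x y * π y a * P y a y' := by
  induction n generalizing x with
  | zero => exact k.elim0
  | succ n ih =>
    rw [pathSum_succ]
    refine Fin.cases ?_ (fun k => ?_) k
    -- For the first step the event concerns only the first action and the next state; the rest of
    -- the path contributes its total mass, which is one.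
    · have : ∀ b x', π x b * P x b x' * pathSum P π n (fun s α =>
          if (Fin.cons x s : Fin (n + 2) → X) (Fin.castSucc 0) = y ∧
            (Fin.cons b α : Fin (n + 1) → A) 0 = a ∧
            (Fin.cons x s : Fin (n + 2) → X) (Fin.succ 0) = y' then 1 else 0) x' =
          if x' = y' then (if b = a then (if x = y then π x b * P x b x' else 0) else 0)
            else 0 := by
        intro b x'
        have h3 := pathSum_mul_start P π n (fun z => if x = y ∧ b = a ∧ z = y' then 1 else 0) x'
        simp only [Fin.castSucc_zero, Fin.cons_zero, Fin.cons_succ]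
        rw [h3]
        by_cases h : S.layer x' = S.layer x + 1
        · rw [pathSum_one hP hπ n x' (by omega)]
          split_ifs <;> simp_all
        · rw [hP.eq_zero b h]; simp
      simp only [this, Finset.sum_ite_eq', Finset.mem_univ, if_true]
      simp only [Fin.val_zero, pow_zero, Matrix.one_apply]
      split_ifs with h
      · rw [h]; ring
      · ring
    · simp only [Fin.val_succ, pow_succ', Matrix.mul_apply, stepKernel, Finset.sum_mul]
      rw [Finset.sum_comm]
      refine Finset.sum_congr rfl fun x' _ => Finset.sum_congr rfl fun b _ => ?_
      by_cases h : S.layer x' = S.layer x + 1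
      · have := ih k x' (by omega)
        simp only [← Fin.succ_castSucc, Fin.cons_succ]
        rw [this]
        ring
      · rw [hP.eq_zero b h]; simp

lemma trajProb_sum_mul (g : (Fin (L + 1) → X) → (Fin L → A) → ℝ) :
    ∑ τ : Trajectory X A L, trajProb S P π τ * g τ.1 τ.2 = pathSum P π L g S.start := by
  classical
  rw [Fintype.sum_prod_type]
  unfold pathSum trajProb
  exact Finset.sum_congr rfl fun s _ => Finset.sum_congr rfl fun α _ => by
    congr 2

lemma layer_start (S : LayeredSpace X L) : S.layer S.start = 0 := (S.layer_eq_zero_iff _).2 rfl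

lemma trajProb_sum (hP : IsTransition S P) (hπ : IsPolicy π) :
    ∑ τ : Trajectory X A L, trajProb S P π τ = 1 := by
  have := trajProb_sum_mul (S := S) (P := P) (π := π) (fun _ _ => 1)
  rw [pathSum_one hP hπ L S.start (by rw [layer_start]; omega)] at this
  simpa using this

lemma trajProb_nonneg (hP : IsTransition S P) (hπ : IsPolicy π) (τ : Trajectory X A L) :
    0 ≤ trajProb S P π τ := by
  unfold trajProb
  refine mul_nonneg (by split_ifs <;> norm_num) (Finset.prod_nonneg fun k _ => ?_)
  exact mul_nonneg (hπ.nonneg _ _) (hP.nonneg _ _ _)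

/-- The trajectories which start in `x_0` and pass through the layers one after the other. -/
def LayeredPath (S : LayeredSpace X L) (τ : Trajectory X A L) : Prop :=
  ∀ k : Fin (L + 1), S.layer (τ.1 k) = k

/-- Consequently, inequalities between visit counts need to be checked on layered trajectories only,
where each pair is visited at most once. -/
lemma trajProb_eq_zero (hP : IsTransition S P) (π : X → A → ℝ) {τ : Trajectory X A L}
    (hτ : ¬ LayeredPath S τ) : trajProb S P π τ = 0 := by
  by_contra h
  apply hτ
  unfold trajProb at h
  have h1 := left_ne_zero_of_mul h
  have h2 := Finset.prod_ne_zero_iff.1 (right_ne_zero_of_mul h)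
  have h0 : τ.1 0 = S.start := by
    by_contra h3; simp [h3] at h1
  intro k
  induction k using Fin.induction with
  | zero => rw [h0, layer_start]; rfl
  | succ k ih =>
    have := hP.next_layer _ _ _ (right_ne_zero_of_mul (h2 k (Finset.mem_univ _)))
    rw [this, ih]; simp

open Classical in
/-- The number of visits of `(x, a)`. -/
def visits (τ : Trajectory X A L) (x : X) (a : A) : ℕ :=
  (Finset.univ.filter fun k : Fin L => τ.1 k.castSucc = x ∧ τ.2 k = a).card

open Classical in
/-- The number of visits of `(x, a, x')`. -/
def visitsNext (τ : Trajectory X A L) (x : X) (a : A) (x' : X) : ℕ :=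
  (Finset.univ.filter fun k : Fin L =>
    τ.1 k.castSucc = x ∧ τ.2 k = a ∧ τ.1 k.succ = x').card

lemma sum_visitsNext (τ : Trajectory X A L) (x : X) (a : A) :
    ∑ x', visitsNext τ x a x' = visits τ x a := by
  classical
  unfold visitsNext visits
  rw [Finset.card_eq_sum_card_fiberwise (f := fun k : Fin L => τ.1 k.succ) (t := Finset.univ)
    (by simp)]
  refine Finset.sum_congr rfl fun x' _ => ?_
  congr 1
  ext k
  simp [and_assoc]

lemma sum_visits (τ : Trajectory X A L) : ∑ x, ∑ a, visits τ x a = L := by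
  classical
  have := Finset.card_eq_sum_card_fiberwise (s := (Finset.univ : Finset (Fin L)))
    (f := fun k : Fin L => (τ.1 k.castSucc, τ.2 k)) (t := Finset.univ) (by simp)
  rw [Finset.card_univ, Fintype.card_fin, Fintype.sum_prod_type] at this
  refine Eq.trans ?_ this.symm
  unfold visits
  simp only [Prod.mk.injEq]

/-- On a layered trajectory `x` can occur only at time `layer x`, so the visit count is the
indicator of the event in `occTriple`; other trajectories carry no mass. Occupancy is thereby an
expected number of visits. -/
lemma trajProb_mul_visitsNext (hP : IsTransition S P) (τ : Trajectory X A L) (x : X) (a : A)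
    (x' : X) : trajProb S P π τ * visitsNext τ x a x' =
      open Classical in
      if ∃ k : Fin L, (k : ℕ) = S.layer x ∧ τ.1 k.castSucc = x ∧ τ.2 k = a ∧ τ.1 k.succ = x'
      then trajProb S P π τ else 0 := by
  classical
  by_cases hτ : LayeredPath S τ
  · unfold visitsNext
    split_ifs with h
    · obtain ⟨k, hk, h⟩ := h
      have : (Finset.univ.filter fun k : Fin L =>
          τ.1 k.castSucc = x ∧ τ.2 k = a ∧ τ.1 k.succ = x') = {k} := by
        ext j
        simp only [Finset.mem_filter, Finset.mem_univ, true_and, Finset.mem_singleton]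
        constructor
        · rintro ⟨h1, -⟩
          have := hτ j.castSucc
          rw [h1, ← hk] at this
          exact Fin.ext this.symm
        · rintro rfl; exact h
      rw [this]; simp
    · rw [Finset.filter_false_of_mem]
      · simp
      · intro k _ hk
        refine h ⟨k, ?_, hk⟩
        have := hτ k.castSucc
        rw [hk.1] at this
        simpa using this.symm
  · rw [trajProb_eq_zero hP π hτ]; simp

lemma sum_trajProb_visitsNext (hP : IsTransition S P) (x : X) (a : A) (x' : X) :
    ∑ τ : Trajectory X A L, trajProb S P π τ * visitsNext τ x a x' = occTriple S P π x a x' := by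
  unfold occTriple
  exact Finset.sum_congr rfl fun τ _ => trajProb_mul_visitsNext hP τ x a x'

lemma sum_trajProb_visits (hP : IsTransition S P) (x : X) (a : A) :
    ∑ τ : Trajectory X A L, trajProb S P π τ * visits τ x a = occ S P π (x, a) := by
  unfold occ
  simp only [← sum_trajProb_visitsNext hP]
  rw [Finset.sum_comm]
  refine Finset.sum_congr rfl fun τ _ => ?_
  rw [← sum_visitsNext]
  push_cast
  rw [Finset.mul_sum]

lemma occTriple_eq (hP : IsTransition S P) (hπ : IsPolicy π) (x : X) (a : A) (x' : X) :
    occTriple S P π x a x' = stateOcc S P π x * π x a * P x a x' := by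
  classical
  by_cases hx : S.layer x < L
  · have := pathSum_step hP hπ L ⟨S.layer x, hx⟩ S.start (by rw [layer_start]; omega) x a x'
    rw [← trajProb_sum_mul] at this
    unfold stateOcc
    rw [occTriple]
    convert this using 1
    refine Finset.sum_congr rfl fun τ _ => ?_
    rw [mul_ite, mul_one, mul_zero]
    refine if_congr ⟨?_, fun h => ⟨⟨S.layer x, hx⟩, rfl, h⟩⟩ rfl rfl
    rintro ⟨k, hk, h⟩
    obtain rfl : k = ⟨S.layer x, hx⟩ := Fin.ext hk
    exact h
  · rw [hP.last a x' hx, mul_zero, occTriple]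
    refine Finset.sum_eq_zero fun τ _ => if_neg ?_
    rintro ⟨k, hk, -⟩
    exact hx (hk ▸ k.2)

lemma occ_eq (hP : IsTransition S P) (hπ : IsPolicy π) {x : X} (a : A) (hx : S.layer x < L) :
    occ S P π (x, a) = stateOcc S P π x * π x a := by
  simp only [occ, occTriple_eq hP hπ, ← Finset.mul_sum, hP.sum_eq_one x a hx, mul_one]

lemma occ_last (hP : IsTransition S P) (hπ : IsPolicy π) {x : X} (a : A) (hx : ¬ S.layer x < L) :
    occ S P π (x, a) = 0 := by
  simp [occ, occTriple_eq hP hπ, hP.last a _ hx]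

lemma occTriple_eq_occ_mul (hP : IsTransition S P) (hπ : IsPolicy π) (x : X) (a : A) (x' : X) :
    occTriple S P π x a x' = occ S P π (x, a) * P x a x' := by
  by_cases hx : S.layer x < L
  · rw [occTriple_eq hP hπ, occ_eq hP hπ a hx]
  · rw [occTriple_eq hP hπ, hP.last a x' hx]; simp

lemma stateOcc_start (S : LayeredSpace X L) (P : X → A → X → ℝ) (π : X → A → ℝ) :
    stateOcc S P π S.start = 1 := by
  unfold stateOcc
  rw [layer_start]; simp

lemma stateOcc_flow (hP : IsTransition S P) {x' : X} (hx' : S.layer x' ≠ 0) :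
    stateOcc S P π x' = ∑ x, ∑ a, stateOcc S P π x * π x a * P x a x' := by
  classical
  obtain ⟨k, hk⟩ := Nat.exists_eq_succ_of_ne_zero hx'
  rw [stateOcc, hk, Nat.succ_eq_add_one, pow_succ, Matrix.mul_apply]
  refine Finset.sum_congr rfl fun x _ => ?_
  rw [stepKernel, Finset.mul_sum]
  refine Finset.sum_congr rfl fun a _ => ?_
  by_cases h : S.layer x' = S.layer x + 1
  · have : S.layer x = k := by omega
    rw [stateOcc, this]
    ring
  · rw [hP.eq_zero a h]; simp

/-- The flow equations determine the state occupancies layer by layer. This identifies the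
occupancies of mixtures, of induced policies and of the initial iterate without any path
computation. -/
lemma stateOcc_unique (hP : IsTransition S P) {u : X → ℝ} (h0 : u S.start = 1)
    (hu : ∀ x', S.layer x' ≠ 0 → u x' = ∑ x, ∑ a, u x * π x a * P x a x') :
    u = stateOcc S P π := by
  have : ∀ k x, S.layer x = k → u x = stateOcc S P π x := by
    intro k
    induction k with
    | zero =>
      intro x hx
      rw [(S.layer_eq_zero_iff x).1 hx, h0, stateOcc_start]
    | succ k ih =>
      intro x' hx'
      rw [hu x' (by omega), stateOcc_flow hP (by omega)]
      refine Finset.sum_congr rfl fun x _ => Finset.sum_congr rfl fun a _ => ?_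
      by_cases h : S.layer x' = S.layer x + 1
      · rw [ih x (by omega)]
      · rw [hP.eq_zero a h]; simp
  exact funext fun x => this _ x rfl

lemma stateOcc_nonneg (hP : IsTransition S P) (hπ : IsPolicy π) (x : X) :
    0 ≤ stateOcc S P π x := by
  have : ∀ k x, S.layer x = k → 0 ≤ stateOcc S P π x := by
    intro k
    induction k with
    | zero =>
      intro x hx
      rw [(S.layer_eq_zero_iff x).1 hx, stateOcc_start]; norm_num
    | succ k ih =>
      intro x' hx'
      rw [stateOcc_flow hP (by omega)]
      refine Finset.sum_nonneg fun x _ => Finset.sum_nonneg fun a _ => ?_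
      by_cases h : S.layer x' = S.layer x + 1
      · exact mul_nonneg (mul_nonneg (ih x (by omega)) (hπ.nonneg _ _)) (hP.nonneg _ _ _)
      · rw [hP.eq_zero a h]; simp
  exact this _ x rfl

lemma occ_nonneg (hP : IsTransition S P) (hπ : IsPolicy π) (p : X × A) : 0 ≤ occ S P π p := by
  obtain ⟨x, a⟩ := p
  by_cases hx : S.layer x < L
  · rw [occ_eq hP hπ a hx]
    exact mul_nonneg (stateOcc_nonneg hP hπ x) (hπ.nonneg _ _)
  · rw [occ_last hP hπ a hx]

lemma occ_sum (hP : IsTransition S P) (hπ : IsPolicy π) : ∑ p, occ S P π p = L := by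
  rw [Fintype.sum_prod_type]
  simp only [← sum_trajProb_visits hP]
  have : ∀ x : X, ∑ a : A, ∑ τ : Trajectory X A L, trajProb S P π τ * (visits τ x a : ℝ) =
      ∑ τ : Trajectory X A L, ∑ a : A, trajProb S P π τ * (visits τ x a : ℝ) :=
    fun x => Finset.sum_comm
  simp only [this]
  rw [Finset.sum_comm]
  have h2 : ∀ τ : Trajectory X A L, ∑ x, ∑ a, trajProb S P π τ * (visits τ x a : ℝ) =
      trajProb S P π τ * L := by
    intro τ
    simp only [← Finset.mul_sum]
    congr 1
    exact_mod_cast sum_visits τ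
  simp only [h2, ← Finset.sum_mul, trajProb_sum hP hπ, one_mul]

lemma LayeredPath.visits_le_one {τ : Trajectory X A L} (hτ : LayeredPath S τ) (x : X) (a : A) :
    visits τ x a ≤ 1 := by
  classical
  unfold visits
  rw [Finset.card_le_one]
  intro i hi j hj
  simp only [Finset.mem_filter, Finset.mem_univ, true_and] at hi hj
  have h1 := hτ i.castSucc
  have h2 := hτ j.castSucc
  rw [hi.1] at h1
  rw [hj.1, h1] at h2
  exact Fin.ext (by simpa using h2)

lemma occ_le_one (hP : IsTransition S P) (hπ : IsPolicy π) (p : X × A) : occ S P π p ≤ 1 := by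
  obtain ⟨x, a⟩ := p
  rw [← sum_trajProb_visits hP, ← trajProb_sum hP hπ]
  refine Finset.sum_le_sum fun τ _ => ?_
  by_cases hτ : LayeredPath S τ
  · exact mul_le_of_le_one_right (trajProb_nonneg hP hπ τ)
      (by exact_mod_cast hτ.visits_le_one x a)
  · rw [trajProb_eq_zero hP π hτ]; simp

end

/-! ### Euclidean projections -/

section
variable {ι : Type*} [Fintype ι] {K : Set (ι → ℝ)} {y p z : ι → ℝ}

lemma exists_isEuclProj (hK : IsCompact K) (hne : K.Nonempty) (y : ι → ℝ) :
    ∃ p, IsEuclProj K y p := by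
  obtain ⟨p, hp, hmin⟩ := hK.exists_isMinOn hne
    (f := fun z => ∑ i, (z i - y i) ^ 2) (by fun_prop)
  exact ⟨p, hp, fun z hz => hmin hz⟩

lemma isEuclProj_euclProj (hK : IsCompact K) (hne : K.Nonempty) (y : ι → ℝ) :
    IsEuclProj K y (euclProj K y) := by
  have h := exists_isEuclProj hK hne y
  rw [euclProj, dif_pos h]
  exact h.choose_spec

lemma euclProj_mem (hK : IsCompact K) (hne : K.Nonempty) (y : ι → ℝ) : euclProj K y ∈ K :=
  (isEuclProj_euclProj hK hne y).1

/-- The variational inequality: moving from `p` towards `z` stays in `K` and cannot decrease the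
distance to `y`. -/
lemma IsEuclProj.inner_nonpos (hK : Convex ℝ K) (hp : IsEuclProj K y p) (hz : z ∈ K) :
    ∑ i, (y i - p i) * (z i - p i) ≤ 0 := by
  set a := ∑ i, (y i - p i) * (z i - p i) with ha
  set b := ∑ i, (z i - p i) ^ 2 with hb
  have hb0 : 0 ≤ b := Finset.sum_nonneg fun i _ => sq_nonneg _
  -- Minimality of `p` against the point (1 - s) p + s z, divided by `s`.
  have key : ∀ s : ℝ, 0 < s → s ≤ 1 → 2 * a ≤ s * b := by
    intro s hs hs1
    have hmem : (1 - s) • p + s • z ∈ K := hK hp.1 hz (by linarith) hs.le (by ring)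
    have h := hp.2 _ hmem
    have e : ∑ i, (((1 - s) • p + s • z) i - y i) ^ 2 =
        ∑ i, (p i - y i) ^ 2 - s * (2 * a) + s * (s * b) := by
      rw [ha, hb, Finset.mul_sum, Finset.mul_sum, Finset.mul_sum, Finset.mul_sum,
        ← Finset.sum_sub_distrib, ← Finset.sum_add_distrib]
      refine Finset.sum_congr rfl fun i _ => ?_
      simp only [Pi.add_apply, Pi.smul_apply, smul_eq_mul]
      ring
    rw [e] at h
    have : s * (2 * a) ≤ s * (s * b) := by linarith
    exact le_of_mul_le_mul_left this hs
  by_contra hcon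
  push Not at hcon
  rcases hb0.eq_or_lt with h | h
  · have := key 1 one_pos le_rfl
    rw [← h] at this; linarith
  -- This `s` makes the right side of `key` at most `a`, against a > 0.
  · have h1 := key (min 1 (a / b)) (lt_min one_pos (div_pos hcon h)) (min_le_left _ _)
    have h2 : min 1 (a / b) * b ≤ a / b * b := mul_le_mul_of_nonneg_right (min_le_right _ _) hb0
    rw [div_mul_cancel₀ _ h.ne'] at h2
    linarith

lemma IsEuclProj.sum_sq_le (hK : Convex ℝ K) (hp : IsEuclProj K y p) (hz : z ∈ K) :
    ∑ i, (p i - z i) ^ 2 ≤ ∑ i, (y i - z i) ^ 2 := by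
  have h := hp.inner_nonpos hK hz
  have e : ∑ i, (y i - z i) ^ 2 = ∑ i, (y i - p i) ^ 2 + ∑ i, (p i - z i) ^ 2 -
      2 * ∑ i, (y i - p i) * (z i - p i) := by
    rw [Finset.mul_sum, ← Finset.sum_add_distrib, ← Finset.sum_sub_distrib]
    exact Finset.sum_congr rfl fun i _ => by ring
  have : 0 ≤ ∑ i, (y i - p i) ^ 2 := Finset.sum_nonneg fun i _ => sq_nonneg _
  linarith

/-- Sum of the two variational inequalities. It makes the projection continuous, hence measurable,
although it is defined by choice. -/
lemma IsEuclProj.nonexpansive (hK : Convex ℝ K) {y' p' : ι → ℝ} (hp : IsEuclProj K y p)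
    (hp' : IsEuclProj K y' p') : ∑ i, (p i - p' i) ^ 2 ≤ ∑ i, (y i - y' i) ^ 2 := by
  have h1 := hp.inner_nonpos hK hp'.1
  have h2 := hp'.inner_nonpos hK hp.1
  have e : ∑ i, (y i - y' i) ^ 2 = ∑ i, ((y i - y' i) - (p i - p' i)) ^ 2 +
      ∑ i, (p i - p' i) ^ 2 - 2 * ∑ i, (y i - p i) * (p' i - p i) -
      2 * ∑ i, (y' i - p' i) * (p i - p' i) := by
    rw [Finset.mul_sum, Finset.mul_sum, ← Finset.sum_add_distrib, ← Finset.sum_sub_distrib,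
      ← Finset.sum_sub_distrib]
    exact Finset.sum_congr rfl fun i _ => by ring
  have : 0 ≤ ∑ i, ((y i - y' i) - (p i - p' i)) ^ 2 := Finset.sum_nonneg fun i _ => sq_nonneg _
  linarith

lemma continuous_euclProj (hK : IsCompact K) (hc : Convex ℝ K) (hne : K.Nonempty) :
    Continuous (euclProj K) := by
  rw [continuous_pi_iff]
  intro i
  rw [continuous_iff_continuousAt]
  intro y
  have hlim : Filter.Tendsto (fun y' : ι → ℝ => Real.sqrt (∑ j, (y' j - y j) ^ 2)) (nhds y)
      (nhds 0) := by
    have : Continuous (fun y' : ι → ℝ => Real.sqrt (∑ j, (y' j - y j) ^ 2)) := by fun_prop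
    simpa using this.tendsto y
  rw [ContinuousAt, tendsto_iff_dist_tendsto_zero]
  refine squeeze_zero (fun _ => dist_nonneg) (fun y' => ?_) hlim
  rw [Real.dist_eq]
  refine Real.abs_le_sqrt (le_trans ?_ ((isEuclProj_euclProj hK hne y').nonexpansive hc
    (isEuclProj_euclProj hK hne y)))
  exact Finset.single_le_sum (f := fun j => (euclProj K y' j - euclProj K y j) ^ 2)
    (fun j _ => sq_nonneg _) (Finset.mem_univ i)

/-- The empty set, where the projection is the identity by default, is included so that the iterates
are measurable on all outcomes, also where a confidence set might be empty. -/
lemma measurable_euclProj (hK : IsCompact K) (hc : Convex ℝ K) : Measurable (euclProj K) := by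
  rcases K.eq_empty_or_nonempty with rfl | hne
  · have : euclProj (∅ : Set (ι → ℝ)) = id := by
      funext y
      rw [euclProj, dif_neg]
      · rfl
      · rintro ⟨p, hp, -⟩; exact hp
    rw [this]; exact measurable_id
  · exact (continuous_euclProj hK hc hne).measurable

end

/-! ### The geometry of sets of occupancy vectors -/

section
variable {X A : Type*} [Fintype X] [Fintype A] {L : ℕ} {S : LayeredSpace X L}
  {P : X → A → X → ℝ} {π : X → A → ℝ}

/-- A closed set of transition functions which is convex row by row. -/
structure RowConvex (S : LayeredSpace X L) (K : Set (X → A → X → ℝ)) : Prop where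
  transition : ∀ P ∈ K, IsTransition S P
  mix : ∀ P₁ ∈ K, ∀ P₂ ∈ K, ∀ w : X → A → ℝ, (∀ x a, 0 ≤ w x a) → (∀ x a, w x a ≤ 1) →
    (fun x a x' => w x a * P₁ x a x' + (1 - w x a) * P₂ x a x') ∈ K
  closed : IsClosed K

lemma rowConvex_transition (S : LayeredSpace X L) :
    RowConvex S {P : X → A → X → ℝ | IsTransition S P} where
  transition P hP := hP
  mix P₁ h₁ P₂ h₂ w hw hw' :=
    { nonneg := fun x a x' => add_nonneg (mul_nonneg (hw x a) (h₁.nonneg _ _ _))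
        (mul_nonneg (by linarith [hw' x a]) (h₂.nonneg _ _ _))
      next_layer := fun x a x' h => by
        by_contra hl
        apply h
        simp only [h₁.eq_zero a hl, h₂.eq_zero a hl, mul_zero, add_zero]
      sum_eq_one := fun x a hx => by
        rw [Finset.sum_add_distrib, ← Finset.mul_sum, ← Finset.mul_sum, h₁.sum_eq_one x a hx,
          h₂.sum_eq_one x a hx]; ring }
  closed := by
    have : {P : X → A → X → ℝ | IsTransition S P} =
        (⋂ x, ⋂ a, ⋂ x', {P | 0 ≤ P x a x'}) ∩
        (⋂ x, ⋂ a, ⋂ x', {P | ¬ S.layer x' = S.layer x + 1 → P x a x' = 0}) ∩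
        (⋂ x, ⋂ a, {P | S.layer x < L → ∑ x', P x a x' = 1}) := by
      ext P
      simp only [Set.mem_ofPred_eq, Set.mem_inter_iff, Set.mem_iInter]
      constructor
      · intro h
        exact ⟨⟨h.nonneg, fun x a x' hl => h.eq_zero a hl⟩, fun x a => h.sum_eq_one x a⟩
      · rintro ⟨⟨h1, h2⟩, h3⟩
        exact ⟨h1, fun x a x' h => by
          by_contra hl
          exact h (h2 x a x' hl), h3⟩
    rw [this]
    refine ((isClosed_iInter fun x => isClosed_iInter fun a => isClosed_iInter fun x' =>
      ?_).inter (isClosed_iInter fun x => isClosed_iInter fun a => isClosed_iInter fun x' =>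
      ?_)).inter (isClosed_iInter fun x => isClosed_iInter fun a => ?_)
    · exact isClosed_le continuous_const (by fun_prop)
    · by_cases h : S.layer x' = S.layer x + 1
      · simp [h]
      · simp only [h, not_false_eq_true, true_imp_iff]
        exact isClosed_eq (by fun_prop) continuous_const
    · by_cases h : S.layer x < L
      · simp only [h, true_imp_iff]
        exact isClosed_eq (by fun_prop) continuous_const
      · simp [h]

/-- The confidence condition is a separate ℓ₁ ball for each row, so it survives mixing with weights
that differ from row to row. -/
lemma rowConvex_confSet (S : LayeredSpace X L) (T : ℕ) (δ : ℝ) (N : X → A → ℕ)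
    (M : X → A → X → ℕ) : RowConvex S (confSet S T δ N M) where
  transition P hP := hP.1
  mix P₁ h₁ P₂ h₂ w hw hw' := by
    refine ⟨(rowConvex_transition S).mix P₁ h₁.1 P₂ h₂.1 w hw hw', fun x a => ?_⟩
    have e1 := mul_le_mul_of_nonneg_left (h₁.2 x a) (hw x a)
    have e2 := mul_le_mul_of_nonneg_left (h₂.2 x a) (sub_nonneg.2 (hw' x a))
    refine le_trans ?_ ((add_le_add e1 e2).trans_eq (by ring))
    rw [Finset.mul_sum, Finset.mul_sum, ← Finset.sum_add_distrib]
    refine Finset.sum_le_sum fun x' _ => ?_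
    set c := (M x a x' : ℝ) / max 1 (N x a : ℝ)
    have : w x a * P₁ x a x' + (1 - w x a) * P₂ x a x' - c =
        w x a * (P₁ x a x' - c) + (1 - w x a) * (P₂ x a x' - c) := by ring
    rw [this]
    refine (abs_add_le _ _).trans_eq ?_
    rw [abs_mul, abs_mul, abs_of_nonneg (hw x a), abs_of_nonneg (sub_nonneg.2 (hw' x a))]
  closed := by
    have : confSet S T δ N M = {P | IsTransition S P} ∩ ⋂ x, ⋂ a,
        {P' : X → A → X → ℝ | ∑ x', |P' x a x' - (M x a x' : ℝ) / max 1 (N x a : ℝ)| ≤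
        Real.sqrt (2 * (S.layerCard (S.layer x + 1) : ℝ) *
        Real.log ((T : ℝ) * Fintype.card X * Fintype.card A / δ) / max 1 (N x a : ℝ))} := by
      ext P
      simp [confSet]
    rw [this]
    refine (rowConvex_transition S).closed.inter
      (isClosed_iInter fun x => isClosed_iInter fun a => ?_)
    exact isClosed_le (by fun_prop) continuous_const

lemma continuous_trajProb (S : LayeredSpace X L) (τ : Trajectory X A L) :
    Continuous fun Q : (X → A → X → ℝ) × (X → A → ℝ) => trajProb S Q.1 Q.2 τ := by
  unfold trajProb
  fun_prop

lemma continuous_occ (S : LayeredSpace X L) :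
    Continuous fun Q : (X → A → X → ℝ) × (X → A → ℝ) => occ S Q.1 Q.2 := by
  refine continuous_pi fun p => ?_
  unfold occ occTriple
  refine continuous_finsetSum _ fun x' _ => continuous_finsetSum _ fun τ _ => ?_
  split_ifs
  · exact continuous_trajProb S τ
  · exact continuous_const

lemma IsTransition.le_one (hP : IsTransition S P) (x : X) (a : A) (x' : X) : P x a x' ≤ 1 :=
  (Finset.single_le_sum (fun y _ => hP.nonneg x a y) (Finset.mem_univ x')).trans
    (hP.sum_le_one x a)

lemma IsPolicy.le_one (hπ : IsPolicy π) (x : X) (a : A) : π x a ≤ 1 :=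
  (Finset.single_le_sum (fun y _ => hπ.nonneg x y) (Finset.mem_univ a)).trans
    (hπ.sum_eq_one x).le

lemma RowConvex.isCompact {K : Set (X → A → X → ℝ)} (hK : RowConvex S K) : IsCompact K := by
  have h : IsCompact (Set.univ.pi fun _ : X => Set.univ.pi fun _ : A =>
      Set.univ.pi fun _ : X => Set.Icc (0 : ℝ) 1) :=
    isCompact_univ_pi fun _ => isCompact_univ_pi fun _ => isCompact_univ_pi fun _ => isCompact_Icc
  refine h.of_isClosed_subset hK.closed fun P hP => ?_
  simp only [Set.mem_pi, Set.mem_univ, true_imp_iff]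
  exact fun x a x' => ⟨(hK.transition P hP).nonneg _ _ _, (hK.transition P hP).le_one _ _ _⟩

lemma isCompact_policies : IsCompact {π : X → A → ℝ | IsPolicy π} := by
  have h : IsCompact (Set.univ.pi fun _ : X => Set.univ.pi fun _ : A => Set.Icc (0 : ℝ) 1) :=
    isCompact_univ_pi fun _ => isCompact_univ_pi fun _ => isCompact_Icc
  refine h.of_isClosed_subset ?_ fun π hπ => ?_
  · have : {π : X → A → ℝ | IsPolicy π} =
        (⋂ x, ⋂ a, {π | 0 ≤ π x a}) ∩ (⋂ x, {π | ∑ a, π x a = 1}) := by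
      ext π
      simp only [Set.mem_ofPred_eq, Set.mem_inter_iff, Set.mem_iInter]
      exact ⟨fun h => ⟨h.nonneg, h.sum_eq_one⟩, fun h => ⟨h.1, h.2⟩⟩
    rw [this]
    exact (isClosed_iInter fun x => isClosed_iInter fun a =>
      isClosed_le continuous_const (by fun_prop)).inter
      (isClosed_iInter fun x => isClosed_eq (by fun_prop) continuous_const)
  · simp only [Set.mem_pi, Set.mem_univ, true_imp_iff]
    exact fun x a => ⟨hπ.nonneg _ _, hπ.le_one _ _⟩

/-- The set is the continuous image of the compact set of pairs of a transition function and a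
policy. Compactness provides the existence of projections. -/
lemma RowConvex.isCompact_occSet {K : Set (X → A → X → ℝ)} (hK : RowConvex S K) :
    IsCompact (occSet S K) := by
  have := (hK.isCompact.prod (isCompact_policies (X := X) (A := A))).image (continuous_occ S)
  convert this using 1
  ext q
  simp only [occSet, Set.mem_ofPred_eq, Set.mem_image, Set.mem_prod, Prod.exists]
  exact ⟨fun ⟨P, hP, π, hπ, h⟩ => ⟨P, π, ⟨hP, hπ⟩, h.symm⟩,
    fun ⟨P, π, ⟨hP, hπ⟩, h⟩ => ⟨P, hP, π, hπ, h.symm⟩⟩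

/-- Occupancy is not linear in (P, π). A mixture is realized by a policy weighted by the two state
occupancies and by rows of transitions weighted by the two occupancies of (x, a). These row weights
depend on (x, a), which is the reason for `RowConvex.mix`. -/
lemma RowConvex.convex_occSet {K : Set (X → A → X → ℝ)} (hK : RowConvex S K) :
    Convex ℝ (occSet S K) := by
  classical
  rintro _ ⟨P₁, hP₁, π₁, hπ₁, rfl⟩ _ ⟨P₂, hP₂, π₂, hπ₂, rfl⟩ s s' hs hs' hss
  have T₁ := hK.transition _ hP₁
  have T₂ := hK.transition _ hP₂
  set u₁ := stateOcc S P₁ π₁ with hu₁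
  set u₂ := stateOcc S P₂ π₂ with hu₂
  have n₁ : ∀ x, 0 ≤ u₁ x := stateOcc_nonneg T₁ hπ₁
  have n₂ : ∀ x, 0 ≤ u₂ x := stateOcc_nonneg T₂ hπ₂
  set u : X → ℝ := fun x => s * u₁ x + s' * u₂ x with hu
  set v : X → A → ℝ := fun x a => s * (u₁ x * π₁ x a) + s' * (u₂ x * π₂ x a) with hv
  have m₁ : ∀ x a, 0 ≤ s * (u₁ x * π₁ x a) := fun x a =>
    mul_nonneg hs (mul_nonneg (n₁ x) (hπ₁.nonneg _ _))
  have m₂ : ∀ x a, 0 ≤ s' * (u₂ x * π₂ x a) := fun x a =>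
    mul_nonneg hs' (mul_nonneg (n₂ x) (hπ₂.nonneg _ _))
  have hvu : ∀ x, ∑ a, v x a = u x := by
    intro x
    simp only [hv, hu, Finset.sum_add_distrib, ← Finset.mul_sum, hπ₁.sum_eq_one,
      hπ₂.sum_eq_one, mul_one]
  have hv0 : ∀ x a, 0 ≤ v x a := fun x a => add_nonneg (m₁ x a) (m₂ x a)
  have hu0 : ∀ x, 0 ≤ u x := fun x => hvu x ▸ Finset.sum_nonneg fun a _ => hv0 x a
  -- Conditional action probabilities of the mixture; at unreached states any policy serves.
  set π : X → A → ℝ := fun x a => if u x = 0 then π₁ x a else v x a / u x with hπdef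
  have hπ : IsPolicy π := by
    constructor
    · intro x a
      simp only [hπdef]
      split_ifs
      · exact hπ₁.nonneg _ _
      · exact div_nonneg (hv0 x a) (hu0 x)
    · intro x
      simp only [hπdef]
      split_ifs with h
      · exact hπ₁.sum_eq_one x
      · rw [← Finset.sum_div, hvu, div_self h]
  have huπ : ∀ x a, u x * π x a = v x a := by
    intro x a
    simp only [hπdef]
    split_ifs with h
    · have h1 : v x a ≤ u x := hvu x ▸ Finset.single_le_sum (fun a _ => hv0 x a)
        (Finset.mem_univ a)
      rw [h] at h1 ⊢
      rw [zero_mul]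
      exact le_antisymm (hv0 x a) h1
    · field_simp
  -- Share of the first occupancy at (x, a). Where `v x a = 0` the quotient is 0, which is harmless
  -- since such a pair carries no flow.
  set w : X → A → ℝ := fun x a => s * (u₁ x * π₁ x a) / v x a with hw
  set P : X → A → X → ℝ := fun x a x' => w x a * P₁ x a x' + (1 - w x a) * P₂ x a x' with hPdef
  have hPK : P ∈ K := by
    refine hK.mix P₁ hP₁ P₂ hP₂ w (fun x a => div_nonneg (m₁ x a) (hv0 x a)) fun x a => ?_
    exact div_le_one_of_le₀ (le_add_of_nonneg_right (m₂ x a)) (hv0 x a)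
  have hP := hK.transition _ hPK
  have hvP : ∀ x a x', v x a * P x a x' =
      s * (u₁ x * π₁ x a * P₁ x a x') + s' * (u₂ x * π₂ x a * P₂ x a x') := by
    intro x a x'
    by_cases h : v x a = 0
    · have h1 := m₁ x a
      have h2 := m₂ x a
      have h' : s * (u₁ x * π₁ x a) + s' * (u₂ x * π₂ x a) = 0 := h
      have h3 : s * (u₁ x * π₁ x a) = 0 := by linarith
      have h4 : s' * (u₂ x * π₂ x a) = 0 := by linarith
      rw [h, zero_mul, ← mul_assoc, h3, ← mul_assoc s', h4]; ring
    · have hw1 : v x a * w x a = s * (u₁ x * π₁ x a) := by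
        simp only [hw]; field_simp
      have hw2 : v x a * (1 - w x a) = s' * (u₂ x * π₂ x a) := by
        rw [mul_sub, hw1]; simp only [hv]; ring
      simp only [hPdef]
      rw [mul_add, ← mul_assoc (v x a), hw1, ← mul_assoc (v x a), hw2]; ring
  have huq : u = stateOcc S P π := by
    refine stateOcc_unique hP ?_ ?_
    · simp only [hu, hu₁, hu₂, stateOcc_start]; linarith
    · intro x' hx'
      simp only [huπ, hvP, Finset.sum_add_distrib, ← Finset.mul_sum]
      rw [← stateOcc_flow T₁ hx', ← stateOcc_flow T₂ hx']
  refine ⟨P, hPK, π, hπ, ?_⟩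
  funext p
  obtain ⟨x, a⟩ := p
  by_cases hx : S.layer x < L
  · rw [occ_eq hP hπ a hx, ← huq, huπ]
    simp only [Pi.add_apply, Pi.smul_apply, smul_eq_mul, occ_eq T₁ hπ₁ a hx, occ_eq T₂ hπ₂ a hx]
    rfl
  · simp [occ_last hP hπ a hx, occ_last T₁ hπ₁ a hx, occ_last T₂ hπ₂ a hx]

lemma inducedPolicy_isPolicy {π₀ : X → A → ℝ} (h₀ : IsPolicy π₀) {q : X × A → ℝ}
    (hq : ∀ p, 0 ≤ q p) : IsPolicy (inducedPolicy π₀ q) := by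
  constructor
  · intro x a
    unfold inducedPolicy
    split_ifs
    · exact h₀.nonneg _ _
    · exact div_nonneg (hq _) (Finset.sum_nonneg fun b _ => hq _)
  · intro x
    unfold inducedPolicy
    split_ifs with h
    · exact h₀.sum_eq_one x
    · rw [← Finset.sum_div, div_self h]

/-- The induced policy agrees with `π` at reached states, and unreached states do not enter the flow
equations. -/
lemma occ_inducedPolicy {π₀ : X → A → ℝ} (h₀ : IsPolicy π₀) (hP : IsTransition S P)
    (hπ : IsPolicy π) : occ S P (inducedPolicy π₀ (occ S P π)) = occ S P π := by
  set π' := inducedPolicy π₀ (occ S P π) with hπ'def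
  have hπ' : IsPolicy π' := inducedPolicy_isPolicy h₀ (occ_nonneg hP hπ)
  have key : ∀ x a, S.layer x < L → stateOcc S P π x * π' x a = stateOcc S P π x * π x a := by
    intro x a hx
    have hs : ∑ b, occ S P π (x, b) = stateOcc S P π x := by
      simp only [occ_eq hP hπ _ hx, ← Finset.mul_sum, hπ.sum_eq_one, mul_one]
    simp only [hπ'def, inducedPolicy, hs]
    split_ifs with h
    · rw [h]; ring
    · rw [occ_eq hP hπ a hx]; field_simp
  have hu : stateOcc S P π = stateOcc S P π' := by
    refine stateOcc_unique hP (stateOcc_start _ _ _) fun x' hx' => ?_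
    rw [stateOcc_flow hP hx']
    refine Finset.sum_congr rfl fun x _ => Finset.sum_congr rfl fun a _ => ?_
    by_cases hx : S.layer x < L
    · rw [key x a hx]
    · simp [hP.last a x' hx]
  funext ⟨x, a⟩
  by_cases hx : S.layer x < L
  · rw [occ_eq hP hπ' a hx, occ_eq hP hπ a hx, ← hu, key x a hx]
  · rw [occ_last hP hπ' a hx, occ_last hP hπ a hx]

-- Induction over layers: the error in layer k + 1 is the error in layer k transported by `P'`, plus
-- the error of the rows leaving layer k weighted by the true occupancy. No error is amplified,
-- since the rows of `P'` sum to one.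
open Classical in
lemma sum_stateOcc_diff {P' : X → A → X → ℝ} (hP : IsTransition S P) (hP' : IsTransition S P')
    (hπ : IsPolicy π) (k : ℕ) (hk : k ≤ L) :
    ∑ x, (if S.layer x = k then |stateOcc S P' π x - stateOcc S P π x| else 0) ≤
      ∑ x, ∑ a, if S.layer x < k then
        occ S P π (x, a) * ∑ x', |P' x a x' - P x a x'| else 0 := by
  induction k with
  | zero =>
    refine (Finset.sum_eq_zero fun x _ => ?_).trans_le (by simp)
    split_ifs with h
    · rw [(S.layer_eq_zero_iff x).1 h]; simp [stateOcc_start]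
    · rfl
  | succ k ih =>
    have ih := ih (by omega)
    set u' := stateOcc S P' π with hu'
    set u := stateOcc S P π with hu
    have step : ∀ x', (if S.layer x' = k + 1 then |u' x' - u x'| else 0) ≤
        ∑ x, if S.layer x = k then ∑ a, (|u' x - u x| * π x a * P' x a x' +
          u x * π x a * |P' x a x' - P x a x'|) else 0 := by
      intro x'
      split_ifs with h
      · rw [hu', hu, stateOcc_flow hP' (by omega), stateOcc_flow hP (by omega),
          ← Finset.sum_sub_distrib]
        refine (Finset.abs_sum_le_sum_abs _ _).trans (Finset.sum_le_sum fun x _ => ?_)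
        rw [← Finset.sum_sub_distrib]
        split_ifs with hx
        · refine (Finset.abs_sum_le_sum_abs _ _).trans (Finset.sum_le_sum fun a _ => ?_)
          -- Split into an old error, moved by `P'`, and a new one, weighted by the occupancy under
          -- `P`.
          have e : u' x * π x a * P' x a x' - u x * π x a * P x a x' =
            (u' x - u x) * π x a * P' x a x' + u x * π x a * (P' x a x' - P x a x') := by ring
          refine (congrArg _ e).trans_le ((abs_add_le _ _).trans_eq ?_)
          rw [abs_mul, abs_mul, abs_mul, abs_mul, abs_of_nonneg (hπ.nonneg x a),
            abs_of_nonneg (hP'.nonneg x a x'), abs_of_nonneg (stateOcc_nonneg hP hπ x)]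
        · rw [abs_of_nonpos, neg_nonpos]
          · exact (Finset.sum_eq_zero fun a _ => by
              rw [hP.eq_zero a (by omega), hP'.eq_zero a (by omega)]; ring).ge
          · exact (Finset.sum_eq_zero fun a _ => by
              rw [hP.eq_zero a (by omega), hP'.eq_zero a (by omega)]; ring).le
      · refine Finset.sum_nonneg fun x _ => ?_
        split_ifs
        · refine Finset.sum_nonneg fun a _ => add_nonneg ?_ ?_
          · exact mul_nonneg (mul_nonneg (abs_nonneg _) (hπ.nonneg _ _)) (hP'.nonneg _ _ _)
          · exact mul_nonneg (mul_nonneg (stateOcc_nonneg hP hπ x) (hπ.nonneg _ _)) (abs_nonneg _)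
        · exact le_rfl
    refine (Finset.sum_le_sum fun x' _ => step x').trans ?_
    rw [Finset.sum_comm]
    have e : ∀ x, (∑ x', if S.layer x = k then ∑ a, (|u' x - u x| * π x a * P' x a x' +
          u x * π x a * |P' x a x' - P x a x'|) else 0) =
        (if S.layer x = k then |u' x - u x| else 0) + ∑ a, if S.layer x = k then
          occ S P π (x, a) * ∑ x', |P' x a x' - P x a x'| else 0 := by
      intro x
      split_ifs with h
      · rw [Finset.sum_comm]
        simp only [Finset.sum_add_distrib, ← Finset.mul_sum,
          hP'.sum_eq_one x _ (show S.layer x < L by omega), mul_one, hπ.sum_eq_one,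
          occ_eq hP hπ _ (show S.layer x < L by omega)]
        rfl
      · simp
    rw [Finset.sum_congr rfl fun x _ => e x, Finset.sum_add_distrib]
    refine (add_le_add_left ih _).trans_eq ?_
    simp only [← Finset.sum_add_distrib]
    refine Finset.sum_congr rfl fun x _ => Finset.sum_congr rfl fun a _ => ?_
    by_cases h1 : S.layer x < k
    · simp [h1, show S.layer x < k + 1 by omega, show S.layer x ≠ k by omega]
    · by_cases h2 : S.layer x = k
      · simp [h2]
      · simp [h1, h2, show ¬ S.layer x < k + 1 by omega]

/-- Each of the `L` layers before the last contributes at most the full accumulated row error; hence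
the factor `L`. -/
lemma sum_occ_diff {P' : X → A → X → ℝ} (hP : IsTransition S P) (hP' : IsTransition S P')
    (hπ : IsPolicy π) :
    ∑ p, |occ S P' π p - occ S P π p| ≤
      L * ∑ x, ∑ a, occ S P π (x, a) * ∑ x', |P' x a x' - P x a x'| := by
  classical
  set B := ∑ x, ∑ a, occ S P π (x, a) * ∑ x', |P' x a x' - P x a x'| with hB
  have h1 : ∀ k ∈ Finset.range L,
      ∑ x, (if S.layer x = k then |stateOcc S P' π x - stateOcc S P π x| else 0) ≤ B := by
    intro k hk
    refine (sum_stateOcc_diff hP hP' hπ k (Finset.mem_range.1 hk).le).trans ?_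
    refine Finset.sum_le_sum fun x _ => Finset.sum_le_sum fun a _ => ?_
    split_ifs
    · exact le_rfl
    · exact mul_nonneg (occ_nonneg hP hπ _) (Finset.sum_nonneg fun _ _ => abs_nonneg _)
  have h2 := Finset.sum_le_sum h1
  rw [Finset.sum_comm, Finset.sum_const, Finset.card_range, nsmul_eq_mul] at h2
  refine le_trans (le_of_eq ?_) h2
  rw [Fintype.sum_prod_type]
  refine Finset.sum_congr rfl fun x _ => ?_
  rw [Finset.sum_ite_eq]
  by_cases hx : S.layer x < L
  · simp only [Finset.mem_range, hx, if_true, occ_eq hP hπ _ hx, occ_eq hP' hπ _ hx, ← sub_mul,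
      abs_mul, abs_of_nonneg (hπ.nonneg x _), ← Finset.mul_sum, hπ.sum_eq_one, mul_one]
  · simp [hx, occ_last hP hπ _ hx, occ_last hP' hπ _ hx]

/-! ### The layers -/

open Classical in
lemma layerCard_eq (S : LayeredSpace X L) (k : ℕ) :
    S.layerCard k = (Finset.univ.filter fun x => S.layer x = k).card := by
  rw [LayeredSpace.layerCard, Nat.card_eq_fintype_card, Fintype.card_subtype]

lemma nonempty_action (S : LayeredSpace X L) {π₀ : X → A → ℝ} (h₀ : IsPolicy π₀) :
    Nonempty A := by
  by_contra h
  rw [not_nonempty_iff] at h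
  simpa using h₀.sum_eq_one S.start

lemma layerCard_pos [Nonempty A] (hP : IsTransition S P) {k : ℕ} (hk : k ≤ L) :
    0 < S.layerCard k := by
  classical
  induction k with
  | zero =>
    rw [layerCard_eq, Finset.card_pos]
    exact ⟨S.start, by simp [layer_start]⟩
  | succ k ih =>
    have := ih (by omega)
    rw [layerCard_eq, Finset.card_pos] at this ⊢
    obtain ⟨x, hx⟩ := this
    obtain ⟨a⟩ := ‹Nonempty A›
    have hx : S.layer x = k := by simpa using hx
    have h1 : ∑ x', P x a x' ≠ 0 := by
      rw [hP.sum_eq_one x a (by omega)]; exact one_ne_zero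
    obtain ⟨x', -, h2⟩ := Finset.exists_ne_zero_of_sum_ne_zero h1
    exact ⟨x', by simp [hP.next_layer _ _ _ h2, hx]⟩

lemma sum_layerCard (S : LayeredSpace X L) :
    ∑ k ∈ Finset.range (L + 1), S.layerCard k = Fintype.card X := by
  classical
  simp only [layerCard_eq]
  rw [← Finset.card_univ, Finset.card_eq_sum_card_fiberwise (f := S.layer)
    (t := Finset.range (L + 1)) (by intro x; simp [S.layer_le x])]

lemma succ_le_card [Nonempty A] (hP : IsTransition S P) : L + 1 ≤ Fintype.card X := by
  rw [← sum_layerCard S]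
  calc L + 1 = ∑ k ∈ Finset.range (L + 1), 1 := by simp
    _ ≤ _ := Finset.sum_le_sum fun k hk =>
      layerCard_pos hP (Nat.lt_succ_iff.1 (Finset.mem_range.1 hk))

/-- Uniform actions and uniform transitions to the next layer make every layer uniformly occupied.
-/
lemma initOcc_mem [Nonempty A] (hP : IsTransition S P) :
    initOcc S ∈ occSet S {P' : X → A → X → ℝ | IsTransition S P'} := by
  classical
  set c : ℕ → ℝ := fun k => (S.layerCard k : ℝ) with hc
  have hcpos : ∀ k ≤ L, 0 < c k := fun k hk => Nat.cast_pos.2 (layerCard_pos hP hk)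
  have hA : (0 : ℝ) < Fintype.card A := by exact_mod_cast Fintype.card_pos
  set P₀ : X → A → X → ℝ := fun x _ x' =>
    if S.layer x' = S.layer x + 1 then 1 / c (S.layer x + 1) else 0 with hP₀
  set π₁ : X → A → ℝ := fun _ _ => 1 / (Fintype.card A : ℝ) with hπ₁
  have hsum : ∀ k, ∀ b : ℝ, ∑ x', (if S.layer x' = k then b else 0) = c k * b := by
    intro k b
    rw [← Finset.sum_filter, Finset.sum_const, nsmul_eq_mul, hc]
    simp only
    rw [layerCard_eq]
  have hPt : IsTransition S P₀ := by
    constructor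
    · intro x a x'
      simp only [hP₀]
      split_ifs with h
      · exact (one_div_pos.2 (hcpos _ (h ▸ S.layer_le x'))).le
      · exact le_rfl
    · intro x a x' h
      by_contra hl
      simp [hP₀, hl] at h
    · intro x a hx
      simp only [hP₀, hsum]
      exact mul_one_div_cancel (hcpos _ hx).ne'
  have hπt : IsPolicy π₁ := by
    constructor
    · intro x a; simp only [hπ₁]; positivity
    · intro x; simp [hπ₁, hA.ne']
  have hu : (fun x => 1 / c (S.layer x)) = stateOcc S P₀ π₁ := by
    refine stateOcc_unique hPt ?_ ?_
    · simp only [layer_start]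
      have h0 : S.layerCard 0 = 1 := by
        rw [layerCard_eq, Finset.card_eq_one]
        exact ⟨S.start, by ext x; simp [S.layer_eq_zero_iff]⟩
      simp [hc, h0]
    · intro x' hx'
      obtain ⟨k, hk⟩ := Nat.exists_eq_succ_of_ne_zero hx'
      have e : ∀ x, ∑ a : A, 1 / c (S.layer x) * π₁ x a * P₀ x a x' =
          if S.layer x = k then 1 / c k * (1 / c (k + 1)) else 0 := by
        intro x
        simp only [hπ₁, hP₀, hk, Nat.succ_eq_add_one, add_left_inj]
        rw [Finset.sum_const, Finset.card_univ, nsmul_eq_mul]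
        by_cases h : k = S.layer x
        · simp only [← h, if_true]; field_simp
        · rw [if_neg h, if_neg (Ne.symm h)]; simp
      simp only [e, hsum, hk, Nat.succ_eq_add_one]
      have := hcpos k (by have := S.layer_le x'; omega)
      field_simp
  refine ⟨P₀, hPt, π₁, hπt, ?_⟩
  funext ⟨x, a⟩
  simp only [occ, occTriple_eq hPt hπt, ← hu]
  simp only [initOcc]
  refine Finset.sum_congr rfl fun x' _ => ?_
  simp only [hP₀, hπ₁, hc]
  split_ifs
  · rw [one_div_mul_one_div, one_div_mul_one_div]
  · ring

end

/-! ### Invariants of the algorithm -/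

section
variable {X A : Type*} [Fintype X] [Fintype A] {L m : ℕ} {S : LayeredSpace X L}
  {P : X → A → X → ℝ} {T : ℕ} {δ : ℝ} {f : ℕ → Feedback X A L m}

/-- The radius `ε(x, a)` of the confidence set after `n` visits of `(x, a)`. -/
def confRadius (A : Type*) [Fintype A] (S : LayeredSpace X L) (T : ℕ) (δ : ℝ) (x : X) (n : ℕ) :
    ℝ :=
  Real.sqrt (2 * (S.layerCard (S.layer x + 1) : ℝ) *
    Real.log ((T : ℝ) * Fintype.card X * Fintype.card A / δ) / max 1 (n : ℝ))

/-- The criterion for a new epoch after the trajectory `τ`. -/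
def NewEpoch (s : AlgState X A m) (τ : Trajectory X A L) : Prop :=
  ∃ k : Fin L, max 1 (2 * s.epochCnt (τ.1 k.castSucc) (τ.2 k)) ≤
    s.cnt (τ.1 k.castSucc) (τ.2 k) + visits τ (τ.1 k.castSucc) (τ.2 k)

lemma cnt_succ (t : ℕ) (x : X) (a : A) : (algRun S T δ f (t + 1)).cnt x a =
    (algRun S T δ f t).cnt x a + visits (f t).path x a := rfl

lemma cntNext_succ (t : ℕ) (x : X) (a : A) (x' : X) :
    (algRun S T δ f (t + 1)).cntNext x a x' =
    (algRun S T δ f t).cntNext x a x' + visitsNext (f t).path x a x' := rfl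

lemma primal_succ (t : ℕ) : (algRun S T δ f (t + 1)).primal =
    euclProj (occSet S (algRun S T δ f (t + 1)).conf) ((algRun S T δ f t).primal -
      (1 / ((algRun S T δ f (t + 1)).lossMax * constC X A L * Real.sqrt T)) •
        (algRun S T δ f t).loss (f t)) := rfl

lemma dual_succ (t : ℕ) : (algRun S T δ f (t + 1)).dual =
    euclProj (Set.Icc 0 fun _ => (T : ℝ) ^ (1 / 4 : ℝ))
      ((algRun S T δ f t).dual +
        dualRate X A m T δ • (f t).cons.transpose.mulVec (algRun S T δ f t).primal) := rfl

lemma lossMax_succ (t : ℕ) : (algRun S T δ f (t + 1)).lossMax =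
    max (algRun S T δ f t).lossMax ‖(algRun S T δ f t).loss (f t)‖ := rfl

open Classical in
lemma conf_succ (t : ℕ) : (algRun S T δ f (t + 1)).conf =
    if NewEpoch (algRun S T δ f t) (f t).path then
      confSet S T δ (algRun S T δ f (t + 1)).cnt (algRun S T δ f (t + 1)).cntNext
    else (algRun S T δ f t).conf := by
  rw [algRun]
  exact if_congr Iff.rfl rfl rfl

open Classical in
lemma epochCnt_succ (t : ℕ) : (algRun S T δ f (t + 1)).epochCnt =
    if NewEpoch (algRun S T δ f t) (f t).path then (algRun S T δ f (t + 1)).cnt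
    else (algRun S T δ f t).epochCnt := by
  rw [algRun]
  exact if_congr Iff.rfl rfl rfl

lemma cnt_eq_sum (t : ℕ) (x : X) (a : A) :
    (algRun S T δ f t).cnt x a = ∑ s ∈ Finset.range t, visits (f s).path x a := by
  induction t with
  | zero => rfl
  | succ t ih => rw [cnt_succ, Finset.sum_range_succ, ih]

lemma cntNext_eq_sum (t : ℕ) (x : X) (a : A) (x' : X) :
    (algRun S T δ f t).cntNext x a x' =
      ∑ s ∈ Finset.range t, visitsNext (f s).path x a x' := by
  induction t with
  | zero => rfl
  | succ t ih => rw [cntNext_succ, Finset.sum_range_succ, ih]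

lemma sum_cntNext (t : ℕ) (x : X) (a : A) :
    ∑ x', (algRun S T δ f t).cntNext x a x' = (algRun S T δ f t).cnt x a := by
  simp only [cntNext_eq_sum, cnt_eq_sum, ← sum_visitsNext]
  rw [Finset.sum_comm]

lemma cnt_mono (x : X) (a : A) : Monotone fun t => (algRun S T δ f t).cnt x a :=
  monotone_nat_of_le_succ fun t => by rw [cnt_succ]; omega

lemma cnt_le (hf : ∀ t < T, LayeredPath S (f t).path) {t : ℕ} (ht : t ≤ T) (x : X) (a : A) :
    (algRun S T δ f t).cnt x a ≤ t := by
  rw [cnt_eq_sum]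
  calc _ ≤ ∑ s ∈ Finset.range t, 1 := Finset.sum_le_sum fun s hs =>
        (hf s (by have := Finset.mem_range.1 hs; omega)).visits_le_one x a
    _ = t := by simp

lemma LayeredPath.visitsNext_eq_zero {τ : Trajectory X A L} (hτ : LayeredPath S τ) {x x' : X}
    (a : A) (h : S.layer x' ≠ S.layer x + 1) : visitsNext τ x a x' = 0 := by
  classical
  unfold visitsNext
  rw [Finset.card_eq_zero, Finset.filter_eq_empty_iff]
  rintro k - ⟨h1, -, h2⟩
  have e1 := hτ k.castSucc
  have e2 := hτ k.succ
  rw [h1] at e1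
  rw [h2] at e2
  apply h
  rw [e1, e2]; simp

lemma cntNext_eq_zero (hf : ∀ t < T, LayeredPath S (f t).path) {t : ℕ} (ht : t ≤ T) {x x' : X}
    (a : A) (h : S.layer x' ≠ S.layer x + 1) : (algRun S T δ f t).cntNext x a x' = 0 := by
  rw [cntNext_eq_sum]
  exact Finset.sum_eq_zero fun s hs =>
    (hf s (by have := Finset.mem_range.1 hs; omega)).visitsNext_eq_zero a h

lemma rowConvex_conf (t : ℕ) : RowConvex S (algRun S T δ f t).conf := by
  classical
  induction t with
  | zero => exact rowConvex_transition S
  | succ t ih =>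
    rw [conf_succ]
    split_ifs
    · exact rowConvex_confSet _ _ _ _ _
    · exact ih

/-- The current set and epoch counts are those of one earlier time, so a bound that holds at all
times transfers to the current epoch. -/
lemma conf_eq_or (t : ℕ) :
    ((algRun S T δ f t).conf = {P' | IsTransition S P'} ∧ (algRun S T δ f t).epochCnt = 0) ∨
    ∃ s ≤ t, (algRun S T δ f t).conf =
        confSet S T δ (algRun S T δ f s).cnt (algRun S T δ f s).cntNext ∧
      (algRun S T δ f t).epochCnt = (algRun S T δ f s).cnt := by
  classical
  induction t with
  | zero => exact Or.inl ⟨rfl, rfl⟩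
  | succ t ih =>
    rw [conf_succ, epochCnt_succ]
    split_ifs
    · exact Or.inr ⟨t + 1, le_rfl, rfl, rfl⟩
    · rcases ih with h | ⟨s, hs, h⟩
      · exact Or.inl h
      · exact Or.inr ⟨s, by omega, h⟩

lemma visits_eq_zero_or (τ : Trajectory X A L) (x : X) (a : A) :
    visits τ x a = 0 ∨ ∃ k : Fin L, τ.1 k.castSucc = x ∧ τ.2 k = a := by
  classical
  by_cases h : ∃ k : Fin L, τ.1 k.castSucc = x ∧ τ.2 k = a
  · exact Or.inr h
  · left
    unfold visits
    rw [Finset.card_eq_zero, Finset.filter_eq_empty_iff]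
    exact fun k _ hk => h ⟨k, hk⟩

/-- While no epoch starts, the counts of the visited pairs remain below the doubling threshold. The
epoch count is therefore at least about half of the current count. -/
lemma cnt_succ_le (t : ℕ) (x : X) (a : A) :
    (algRun S T δ f t).cnt x a + 1 ≤ 2 * max 1 ((algRun S T δ f t).epochCnt x a) := by
  classical
  induction t with
  | zero => simp [algRun, initState]
  | succ t ih =>
    rw [epochCnt_succ]
    split_ifs with h
    · omega
    · rw [cnt_succ]
      rcases visits_eq_zero_or (f t).path x a with h0 | ⟨k, rfl, rfl⟩
      · omega
      · unfold NewEpoch at h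
        push Not at h
        have := h k
        omega

/-- The logarithm in the confidence radius. -/
def confLog (X A : Type*) [Fintype X] [Fintype A] (T : ℕ) (δ : ℝ) : ℝ :=
  Real.log ((T : ℝ) * Fintype.card X * Fintype.card A / δ)

/-- There are at least L + 1 ≥ 2 states, and ln 2 > 1/2. -/
lemma half_le_confLog [Nonempty A] (hL : 1 ≤ L) (hP : IsTransition S P) (hT : 1 ≤ T)
    (hδ : 0 < δ) (hδ1 : δ < 1) : 1 / 2 ≤ confLog X A T δ := by
  have h1 : (2 : ℝ) ≤ Fintype.card X := by
    exact_mod_cast (show 2 ≤ L + 1 by omega).trans (succ_le_card hP)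
  have h2 : (1 : ℝ) ≤ Fintype.card A := by exact_mod_cast Fintype.card_pos
  have h3 : (1 : ℝ) ≤ T := by exact_mod_cast hT
  have h4 : (2 : ℝ) ≤ (T : ℝ) * Fintype.card X * Fintype.card A / δ := by
    rw [le_div_iff₀ hδ]
    calc 2 * δ ≤ 2 := by linarith
      _ ≤ 1 * Fintype.card X * 1 := by linarith
      _ ≤ _ := by gcongr
  have h5 := Real.log_le_log (by norm_num) h4
  have := Real.log_two_gt_d9
  unfold confLog
  linarith

lemma confRadius_eq (x : X) (n : ℕ) : confRadius A S T δ x n =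
    Real.sqrt (2 * S.layerCard (S.layer x + 1) * confLog X A T δ) / Real.sqrt (max 1 (n : ℝ)) := by
  unfold confRadius confLog
  rw [Real.sqrt_div' _ (by positivity)]

/-- At an unvisited pair the empirical row is 0 and a true row has ℓ₁ norm 1, so a radius of at
least 1 leaves such rows unconstrained. -/
lemma one_le_confRadius [Nonempty A] (hL : 1 ≤ L) (hP : IsTransition S P) (hT : 1 ≤ T)
    (hδ : 0 < δ) (hδ1 : δ < 1) {x : X} (hx : S.layer x < L) : 1 ≤ confRadius A S T δ x 0 := by
  have h := half_le_confLog (X := X) (A := A) hL hP hT hδ hδ1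
  have h1 : (1 : ℝ) ≤ S.layerCard (S.layer x + 1) := by
    exact_mod_cast layerCard_pos hP hx
  rw [confRadius_eq]
  simp only [Nat.cast_zero, zero_le_one, max_eq_left, Real.sqrt_one, div_one]
  rw [Real.one_le_sqrt]
  nlinarith

/-- No concentration is assumed: this holds along every layered history. It is what makes the
iterates nonnegative, and the played policies genuine policies, almost surely. -/
lemma conf_nonempty [Nonempty A] (hL : 1 ≤ L) (hP : IsTransition S P) (hT : 1 ≤ T)
    (hδ : 0 < δ) (hδ1 : δ < 1) (hf : ∀ t < T, LayeredPath S (f t).path) {t : ℕ} (ht : t ≤ T) :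
    (algRun S T δ f t).conf.Nonempty := by
  classical
  rcases conf_eq_or (S := S) (T := T) (δ := δ) (f := f) t with h | ⟨s, hs, h, -⟩
  · exact ⟨P, h.1 ▸ hP⟩
  rw [h]
  set N := (algRun S T δ f s).cnt with hN
  set M := (algRun S T δ f s).cntNext with hM
  -- The witness takes the empirical row at visited pairs and the true row elsewhere, where the
  -- empirical row is zero and not a probability vector.
  refine ⟨fun x a x' => if N x a = 0 then P x a x' else M x a x' / N x a, ⟨?_, ?_, ?_⟩, ?_⟩
  · intro x a x'
    split_ifs
    · exact hP.nonneg _ _ _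
    · positivity
  · intro x a x' hne
    by_contra hl
    apply hne
    rw [hP.eq_zero a hl, hM, cntNext_eq_zero hf (by omega) a hl]
    simp
  · intro x a hx
    split_ifs with h0
    · exact hP.sum_eq_one x a hx
    · rw [← Finset.sum_div, div_eq_one_iff_eq (by exact_mod_cast h0)]
      exact_mod_cast sum_cntNext s x a
  · intro x a
    by_cases h0 : N x a = 0
    · have h1 : ∀ x', M x a x' = 0 := by
        intro x'
        have : ∑ x', M x a x' = 0 := (sum_cntNext s x a).trans h0
        exact (Finset.sum_eq_zero_iff.1 this) x' (Finset.mem_univ _)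
      simp only [h0, if_true, h1, Nat.cast_zero, zero_div, sub_zero, abs_of_nonneg (hP.nonneg _ _ _)]
      by_cases hx : S.layer x < L
      · refine (hP.sum_le_one x a).trans ?_
        have := one_le_confRadius (A := A) hL hP hT hδ hδ1 hx
        simpa [confRadius] using this
      · simp only [hP.last a _ hx, Finset.sum_const_zero]
        exact Real.sqrt_nonneg _
    · have h1 : max 1 (N x a : ℝ) = N x a := by
        rw [max_eq_right]
        exact_mod_cast Nat.one_le_iff_ne_zero.2 h0
      simp only [h0, if_false, h1, sub_self, abs_zero, Finset.sum_const_zero]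
      positivity

lemma primal_mem [Nonempty A] (hL : 1 ≤ L) (hP : IsTransition S P) (hT : 1 ≤ T)
    (hδ : 0 < δ) (hδ1 : δ < 1) (hf : ∀ t < T, LayeredPath S (f t).path) {t : ℕ} (ht : t ≤ T)
    (hA : ∃ π : X → A → ℝ, IsPolicy π) :
    (algRun S T δ f t).primal ∈ occSet S (algRun S T δ f t).conf := by
  cases t with
  | zero => exact initOcc_mem hP
  | succ t =>
    rw [primal_succ]
    refine euclProj_mem (rowConvex_conf _).isCompact_occSet ?_ _
    obtain ⟨P', hP'⟩ := conf_nonempty hL hP hT hδ hδ1 hf ht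
    obtain ⟨π, hπ⟩ := hA
    exact ⟨_, P', hP', π, hπ, rfl⟩

lemma dual_mem (t : ℕ) : (algRun S T δ f t).dual ∈
    Set.Icc (0 : Fin m → ℝ) fun _ => (T : ℝ) ^ (1 / 4 : ℝ) := by
  have h0 : (0 : Fin m → ℝ) ≤ fun _ => (T : ℝ) ^ (1 / 4 : ℝ) := fun i => by
    simp only [Pi.zero_apply]; positivity
  cases t with
  | zero => exact ⟨le_rfl, h0⟩
  | succ t =>
    rw [dual_succ]
    exact euclProj_mem isCompact_Icc (Set.nonempty_Icc.2 h0) _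

lemma mem_occSet_nonneg {K : Set (X → A → X → ℝ)} (hK : RowConvex S K) {q : X × A → ℝ}
    (hq : q ∈ occSet S K) (p : X × A) : 0 ≤ q p := by
  obtain ⟨P', hP', π, hπ, rfl⟩ := hq
  exact occ_nonneg (hK.transition _ hP') hπ p

lemma mem_occSet_le_one {K : Set (X → A → X → ℝ)} (hK : RowConvex S K) {q : X × A → ℝ}
    (hq : q ∈ occSet S K) (p : X × A) : q p ≤ 1 := by
  obtain ⟨P', hP', π, hπ, rfl⟩ := hq
  exact occ_le_one (hK.transition _ hP') hπ p

lemma mem_occSet_sum {K : Set (X → A → X → ℝ)} (hK : RowConvex S K) {q : X × A → ℝ}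
    (hq : q ∈ occSet S K) : ∑ p, q p = L := by
  obtain ⟨P', hP', π, hπ, rfl⟩ := hq
  exact occ_sum (hK.transition _ hP') hπ

lemma playedPolicy_isPolicy [Nonempty A] (hL : 1 ≤ L) (hP : IsTransition S P) (hT : 1 ≤ T)
    (hδ : 0 < δ) (hδ1 : δ < 1) (hf : ∀ t < T, LayeredPath S (f t).path) {t : ℕ} (ht : t ≤ T)
    {π₀ : X → A → ℝ} (h₀ : IsPolicy π₀) : IsPolicy (playedPolicy S T δ π₀ f t) :=
  inducedPolicy_isPolicy h₀ (mem_occSet_nonneg (rowConvex_conf t)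
    (primal_mem hL hP hT hδ hδ1 hf ht ⟨π₀, h₀⟩))

/-- The played policy is read off from the iterate, so the iterate is its occupancy vector under the
model that produced it. Played and computed vectors thus differ only through the transitions. -/
lemma exists_primal_eq_occ [Nonempty A] (hL : 1 ≤ L) (hP : IsTransition S P) (hT : 1 ≤ T)
    (hδ : 0 < δ) (hδ1 : δ < 1) (hf : ∀ t < T, LayeredPath S (f t).path) {t : ℕ} (ht : t ≤ T)
    {π₀ : X → A → ℝ} (h₀ : IsPolicy π₀) :
    ∃ P' ∈ (algRun S T δ f t).conf,
      (algRun S T δ f t).primal = occ S P' (playedPolicy S T δ π₀ f t) := by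
  obtain ⟨P', hP', π, hπ, h⟩ := primal_mem hL hP hT hδ hδ1 hf ht ⟨π₀, h₀⟩
  refine ⟨P', hP', ?_⟩
  rw [playedPolicy, h, occ_inducedPolicy h₀ ((rowConvex_conf t).transition _ hP') hπ]

/-- The empirical transition probabilities are close to `P` after each of the first `T`
episodes. -/
def Concentrated (S : LayeredSpace X L) (P : X → A → X → ℝ) (T : ℕ) (δ : ℝ)
    (f : ℕ → Feedback X A L m) : Prop :=
  ∀ t ≤ T, ∀ x a, ∑ x', |P x a x' - ((algRun S T δ f t).cntNext x a x' : ℝ) /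
    max 1 ((algRun S T δ f t).cnt x a : ℝ)| ≤
      confRadius A S T δ x ((algRun S T δ f t).cnt x a)

lemma Concentrated.mem_conf (h : Concentrated S P T δ f) (hP : IsTransition S P) {t : ℕ}
    (ht : t ≤ T) : P ∈ (algRun S T δ f t).conf := by
  rcases conf_eq_or (S := S) (T := T) (δ := δ) (f := f) t with h' | ⟨s, hs, h', -⟩
  · rw [h'.1]; exact hP
  · rw [h']; exact ⟨hP, h s (by omega)⟩

/-- The bound on the error of the transition probabilities in the current epoch. -/
def confBonus (S : LayeredSpace X L) (T : ℕ) (δ : ℝ) (f : ℕ → Feedback X A L m) (t : ℕ) (x : X)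
    (a : A) : ℝ :=
  min 2 (2 * confRadius A S T δ x ((algRun S T δ f t).epochCnt x a))

lemma confBonus_nonneg (t : ℕ) (x : X) (a : A) : 0 ≤ confBonus S T δ f t x a :=
  le_min (by norm_num) (mul_nonneg (by norm_num) (Real.sqrt_nonneg _))

/-- Triangle inequality through the empirical row, with the trivial bound 2 as a cap. The cap later
gives the bounded range in the Azuma inequality. -/
lemma sum_abs_sub_le_confBonus [Nonempty A] (hL : 1 ≤ L) (hT : 1 ≤ T)
    (hδ : 0 < δ) (hδ1 : δ < 1) {P' P'' : X → A → X → ℝ} {t : ℕ}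
    (h' : P' ∈ (algRun S T δ f t).conf) (h'' : P'' ∈ (algRun S T δ f t).conf) (x : X) (a : A) :
    ∑ x', |P' x a x' - P'' x a x'| ≤ confBonus S T δ f t x a := by
  have t' := (rowConvex_conf t).transition _ h'
  have t'' := (rowConvex_conf t).transition _ h''
  by_cases hx : S.layer x < L
  swap
  · simp only [t'.last a _ hx, t''.last a _ hx, sub_self, abs_zero, Finset.sum_const_zero]
    exact confBonus_nonneg _ _ _
  have two : ∑ x', |P' x a x' - P'' x a x'| ≤ 2 := by
    calc _ ≤ ∑ x', (P' x a x' + P'' x a x') := Finset.sum_le_sum fun x' _ => by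
          have := t'.nonneg x a x'
          have := t''.nonneg x a x'
          rw [abs_le]; constructor <;> linarith
      _ = 2 := by
          rw [Finset.sum_add_distrib, t'.sum_eq_one x a hx, t''.sum_eq_one x a hx]; norm_num
  refine le_min two ?_
  rcases conf_eq_or (S := S) (T := T) (δ := δ) (f := f) t with h | ⟨s, hs, h, he⟩
  -- Before the first epoch change the epoch count is 0 and the radius is at least 1, so the trivial
  -- bound 2 suffices.
  · rw [h.2]
    have := one_le_confRadius (A := A) hL t' hT hδ hδ1 hx
    simp only [Pi.zero_apply]
    linarith
  · rw [he]
    rw [h] at h' h''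
    have e1 := h'.2 x a
    have e2 := h''.2 x a
    unfold confRadius
    rw [two_mul]
    refine le_trans ?_ (add_le_add e1 e2)
    rw [← Finset.sum_add_distrib]
    refine Finset.sum_le_sum fun x' _ => ?_
    rw [abs_sub_comm (P'' x a x')]
    exact abs_sub_le _ _ _

/-! ### The distance between the played and the computed occupancy vectors -/

lemma sum_playedOcc_sub_primal_le [Nonempty A] (hL : 1 ≤ L) (hP : IsTransition S P) (hT : 1 ≤ T)
    (hδ : 0 < δ) (hδ1 : δ < 1) (hf : ∀ t < T, LayeredPath S (f t).path)
    (hc : Concentrated S P T δ f) {t : ℕ} (ht : t ≤ T)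
    {π₀ : X → A → ℝ} (h₀ : IsPolicy π₀) :
    ∑ p, |playedOcc S P T δ π₀ f t p - (algRun S T δ f t).primal p| ≤
      L * ∑ x, ∑ a, playedOcc S P T δ π₀ f t (x, a) * confBonus S T δ f t x a := by
  obtain ⟨P', hP', h⟩ := exists_primal_eq_occ hL hP hT hδ hδ1 hf ht h₀
  have hπ := playedPolicy_isPolicy hL hP hT hδ hδ1 hf ht h₀
  rw [h]
  simp only [abs_sub_comm (playedOcc S P T δ π₀ f t _)]
  refine (sum_occ_diff hP ((rowConvex_conf t).transition _ hP') hπ).trans ?_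
  refine mul_le_mul_of_nonneg_left ?_ (Nat.cast_nonneg _)
  refine Finset.sum_le_sum fun x _ => Finset.sum_le_sum fun a _ => ?_
  exact mul_le_mul_of_nonneg_left
    (sum_abs_sub_le_confBonus hL hT hδ hδ1 hP' (hc.mem_conf hP ht) x a) (occ_nonneg hP hπ _)

/-- The discrete form of ∫ dn/√n = 2√n, written so that the sum over episodes telescopes. -/
lemma visits_div_sqrt_le {v n : ℕ} (hv : v ≤ 1) :
    (v : ℝ) / Real.sqrt (n + 1) ≤ 2 * (Real.sqrt ((n + v : ℕ) : ℝ) - Real.sqrt n) := by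
  have hv : v = 0 ∨ v = 1 := by omega
  rcases hv with rfl | rfl
  · simp
  · have h1 : 0 < Real.sqrt ((n : ℝ) + 1) := Real.sqrt_pos.2 (by positivity)
    have h2 := Real.sqrt_nonneg (n : ℝ)
    have e1 := Real.sq_sqrt (show (0 : ℝ) ≤ (n : ℝ) + 1 by positivity)
    have e2 := Real.sq_sqrt (show (0 : ℝ) ≤ n by positivity)
    push_cast
    rw [div_le_iff₀ h1]
    nlinarith [sq_nonneg (Real.sqrt ((n : ℝ) + 1) - Real.sqrt n)]

lemma sum_visits_mul_confBonus_le (hf : ∀ t < T, LayeredPath S (f t).path) {n : ℕ} (hn : n ≤ T)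
    (x : X) (a : A) :
    ∑ t ∈ Finset.range n, (visits (f t).path x a : ℝ) * confBonus S T δ f t x a ≤
      4 * Real.sqrt 2 * Real.sqrt (2 * S.layerCard (S.layer x + 1) * confLog X A T δ) *
        Real.sqrt ((algRun S T δ f n).cnt x a) := by
  induction n with
  | zero => simp only [Finset.range_zero, Finset.sum_empty]; positivity
  | succ n ih =>
    have ih := ih (by omega)
    rw [Finset.sum_range_succ, cnt_succ]
    set N := (algRun S T δ f n).cnt x a with hN
    set v := visits (f n).path x a with hv
    set c := Real.sqrt (2 * S.layerCard (S.layer x + 1) * confLog X A T δ) with hc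
    have hv1 : v ≤ 1 := (hf n (by omega)).visits_le_one x a
    have key := visits_div_sqrt_le (n := N) hv1
    -- Working with the count at the start of the epoch costs a factor √2 in the radius.
    have hE : ((N : ℝ) + 1) / 2 ≤ max 1 ((algRun S T δ f n).epochCnt x a : ℝ) := by
      have := cnt_succ_le (S := S) (T := T) (δ := δ) (f := f) n x a
      have h : ((N + 1 : ℕ) : ℝ) ≤ ((2 * max 1 ((algRun S T δ f n).epochCnt x a) : ℕ) : ℝ) := by
        exact_mod_cast this
      push_cast at h
      linarith
    have hb : confBonus S T δ f n x a ≤ 2 * Real.sqrt 2 * c / Real.sqrt (N + 1) := by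
      refine (min_le_right _ _).trans ?_
      rw [confRadius_eq]
      have h1 : Real.sqrt ((N : ℝ) + 1) / Real.sqrt 2 ≤
          Real.sqrt (max 1 ((algRun S T δ f n).epochCnt x a : ℝ)) := by
        rw [← Real.sqrt_div' _ (by norm_num)]
        exact Real.sqrt_le_sqrt hE
      have h2 : 0 < Real.sqrt ((N : ℝ) + 1) / Real.sqrt 2 := by positivity
      calc 2 * (c / Real.sqrt (max 1 ((algRun S T δ f n).epochCnt x a : ℝ)))
          ≤ 2 * (c / (Real.sqrt ((N : ℝ) + 1) / Real.sqrt 2)) := by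
            gcongr
        _ = _ := by rw [div_div_eq_mul_div]; ring
    have h3 : (v : ℝ) * confBonus S T δ f n x a ≤
        4 * Real.sqrt 2 * c * (Real.sqrt ((N + v : ℕ) : ℝ) - Real.sqrt N) := by
      calc (v : ℝ) * confBonus S T δ f n x a
          ≤ v * (2 * Real.sqrt 2 * c / Real.sqrt (N + 1)) := by gcongr
        _ = 2 * Real.sqrt 2 * c * (v / Real.sqrt (N + 1)) := by ring
        _ ≤ 2 * Real.sqrt 2 * c * (2 * (Real.sqrt ((N + v : ℕ) : ℝ) - Real.sqrt N)) := by gcongr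
        _ = _ := by ring
    linarith

open Classical in
lemma LayeredPath.sum_visits_layer_le {τ : Trajectory X A L} (hτ : LayeredPath S τ) (k : ℕ) :
    ∑ x ∈ Finset.univ.filter (fun x => S.layer x = k), ∑ a, visits τ x a ≤ 1 := by
  have h1 : ∀ x a, visits τ x a =
      ∑ j : Fin L, if τ.1 j.castSucc = x ∧ τ.2 j = a then 1 else 0 := fun x a => by
    rw [visits, Finset.card_filter]
  have h2 : ∑ x ∈ Finset.univ.filter (fun x => S.layer x = k), ∑ a, visits τ x a =
      ∑ j : Fin L, if (j : ℕ) = k then 1 else 0 := by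
    simp only [h1]
    have : ∀ x, ∑ a, ∑ j : Fin L, (if τ.1 j.castSucc = x ∧ τ.2 j = a then 1 else 0) =
        ∑ j : Fin L, if τ.1 j.castSucc = x then 1 else 0 := by
      intro x
      rw [Finset.sum_comm]
      refine Finset.sum_congr rfl fun j _ => ?_
      simp only [ite_and]
      split_ifs <;> simp
    simp only [this]
    rw [Finset.sum_comm]
    refine Finset.sum_congr rfl fun j _ => ?_
    rw [Finset.sum_ite_eq]
    have := hτ j.castSucc
    simp [this]
  rw [h2, ← Finset.card_filter, Finset.card_le_one]
  intro i hi j hj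
  simp only [Finset.mem_filter, Finset.mem_univ, true_and] at hi hj
  exact Fin.ext (hi.trans hj.symm)

open Classical in
lemma sum_cnt_layer_le (hf : ∀ t < T, LayeredPath S (f t).path) {n : ℕ} (hn : n ≤ T) (k : ℕ) :
    ∑ x ∈ Finset.univ.filter (fun x => S.layer x = k), ∑ a, (algRun S T δ f n).cnt x a ≤ n := by
  induction n with
  | zero => simp [algRun, initState]
  | succ n ih =>
    simp only [cnt_succ, Finset.sum_add_distrib]
    exact add_le_add (ih (by omega)) ((hf n (by omega)).sum_visits_layer_le k)

lemma layerCard_succ_last (S : LayeredSpace X L) : S.layerCard (L + 1) = 0 := by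
  classical
  rw [layerCard_eq, Finset.card_eq_zero, Finset.filter_eq_empty_iff]
  intro x _ h
  have := S.layer_le x
  omega

/-- Cauchy-Schwarz inside a layer, whose total count is at most T, gives √(|X_k| |X_{k+1}| |A| T).
The mean of |X_k| and |X_{k+1}| dominates their geometric mean and sums to at most |X|. -/
lemma sum_sqrt_layerCard_mul_cnt_le (hf : ∀ t < T, LayeredPath S (f t).path) :
    ∑ x, ∑ a, Real.sqrt (S.layerCard (S.layer x + 1)) *
        Real.sqrt ((algRun S T δ f T).cnt x a) ≤
      Real.sqrt (Fintype.card A * T) * Fintype.card X := by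
  classical
  rw [← Finset.sum_fiberwise_of_maps_to (s := Finset.univ) (t := Finset.range (L + 1))
    (g := S.layer) (fun x _ => Finset.mem_range.2 (Nat.lt_succ_of_le (S.layer_le x)))]
  have h1 : ∀ k ∈ Finset.range (L + 1),
      ∑ x ∈ Finset.univ.filter (fun x => S.layer x = k), ∑ a,
        Real.sqrt (S.layerCard (S.layer x + 1)) * Real.sqrt ((algRun S T δ f T).cnt x a) ≤
      Real.sqrt (Fintype.card A * T) *
        (((S.layerCard k : ℝ) + S.layerCard (k + 1)) / 2) := by
    intro k _
    set D := (Finset.univ.filter (fun x => S.layer x = k)) ×ˢ (Finset.univ : Finset A) with hD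
    have hcard : (D.card : ℝ) = S.layerCard k * Fintype.card A := by
      rw [hD, Finset.card_product, ← layerCard_eq, Finset.card_univ]; push_cast; rfl
    have e1 : ∑ x ∈ Finset.univ.filter (fun x => S.layer x = k), ∑ a,
        Real.sqrt (S.layerCard (S.layer x + 1)) * Real.sqrt ((algRun S T δ f T).cnt x a) =
        Real.sqrt (S.layerCard (k + 1)) *
          ∑ p ∈ D, Real.sqrt ((algRun S T δ f T).cnt p.1 p.2) := by
      rw [hD, Finset.sum_product, Finset.mul_sum]
      refine Finset.sum_congr rfl fun x hx => ?_
      rw [Finset.mul_sum, (Finset.mem_filter.1 hx).2]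
    have e2 : ∑ p ∈ D, Real.sqrt ((algRun S T δ f T).cnt p.1 p.2) ≤
        Real.sqrt (S.layerCard k * Fintype.card A) * Real.sqrt T := by
      rw [← Real.sqrt_mul (by positivity)]
      refine Real.le_sqrt_of_sq_le ?_
      refine (sq_sum_le_card_mul_sum_sq).trans ?_
      rw [hcard]
      refine mul_le_mul_of_nonneg_left ?_ (by positivity)
      have := sum_cnt_layer_le (δ := δ) hf le_rfl k
      calc ∑ p ∈ D, Real.sqrt ((algRun S T δ f T).cnt p.1 p.2 : ℝ) ^ 2
          = ∑ p ∈ D, ((algRun S T δ f T).cnt p.1 p.2 : ℝ) :=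
            Finset.sum_congr rfl fun p _ => Real.sq_sqrt (Nat.cast_nonneg _)
        _ ≤ T := by rw [hD, Finset.sum_product]; exact_mod_cast this
    rw [e1]
    have e3 : Real.sqrt (S.layerCard (k + 1)) * Real.sqrt (S.layerCard k) ≤
        ((S.layerCard k : ℝ) + S.layerCard (k + 1)) / 2 := by
      have a1 := Real.sq_sqrt (Nat.cast_nonneg (α := ℝ) (S.layerCard k))
      have a2 := Real.sq_sqrt (Nat.cast_nonneg (α := ℝ) (S.layerCard (k + 1)))
      nlinarith [sq_nonneg (Real.sqrt (S.layerCard k : ℝ) - Real.sqrt (S.layerCard (k + 1) : ℝ))]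
    calc _ ≤ Real.sqrt (S.layerCard (k + 1)) *
          (Real.sqrt (S.layerCard k * Fintype.card A) * Real.sqrt T) := by gcongr
      _ = Real.sqrt (Fintype.card A * T) *
          (Real.sqrt (S.layerCard (k + 1)) * Real.sqrt (S.layerCard k)) := by
          rw [Real.sqrt_mul (by positivity), Real.sqrt_mul (by positivity)]; ring
      _ ≤ _ := by gcongr
  refine (Finset.sum_le_sum h1).trans ?_
  rw [← Finset.mul_sum]
  refine mul_le_mul_of_nonneg_left ?_ (Real.sqrt_nonneg _)
  rw [← Finset.sum_div, Finset.sum_add_distrib]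
  have a1 : ∑ k ∈ Finset.range (L + 1), (S.layerCard k : ℝ) = Fintype.card X := by
    exact_mod_cast sum_layerCard S
  have a2 : ∑ k ∈ Finset.range (L + 1), (S.layerCard (k + 1) : ℝ) ≤ Fintype.card X := by
    have h := Finset.sum_range_succ' (fun k => (S.layerCard k : ℝ)) (L + 1)
    rw [Finset.sum_range_succ, a1, layerCard_succ_last] at h
    have : (0 : ℝ) ≤ S.layerCard 0 := Nat.cast_nonneg _
    simp only [Nat.cast_zero, add_zero] at h
    linarith
  linarith

/-- The difference between the expected and the observed bonuses. -/
def bonusDeviation (S : LayeredSpace X L) (P : X → A → X → ℝ) (T : ℕ) (δ : ℝ) (π₀ : X → A → ℝ)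
    (f : ℕ → Feedback X A L m) (t : ℕ) : ℝ :=
  ∑ x, ∑ a, playedOcc S P T δ π₀ f t (x, a) * confBonus S T δ f t x a -
    ∑ x, ∑ a, (visits (f t).path x a : ℝ) * confBonus S T δ f t x a

lemma sum_playedOcc_sub_primal_le_errQ [Nonempty A] (hL : 1 ≤ L) (hP : IsTransition S P)
    (hT : 1 ≤ T) (hδ : 0 < δ) (hδ1 : δ < 1) (hf : ∀ t < T, LayeredPath S (f t).path)
    (hc : Concentrated S P T δ f) {π₀ : X → A → ℝ} (h₀ : IsPolicy π₀)
    (hq : ∑ t ∈ Finset.range T, bonusDeviation S P T δ π₀ f t ≤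
      L * Real.sqrt (2 * T * Real.log (1 / δ))) :
    ∑ t ∈ Finset.range T,
        ∑ p, |playedOcc S P T δ π₀ f t p - (algRun S T δ f t).primal p| ≤ errQ X A L T δ := by
  have h1 : ∑ t ∈ Finset.range T,
        ∑ p, |playedOcc S P T δ π₀ f t p - (algRun S T δ f t).primal p| ≤
      L * (∑ t ∈ Finset.range T, bonusDeviation S P T δ π₀ f t +
        ∑ t ∈ Finset.range T, ∑ x, ∑ a, (visits (f t).path x a : ℝ) * confBonus S T δ f t x a) := by
    rw [← Finset.sum_add_distrib, Finset.mul_sum]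
    refine Finset.sum_le_sum fun t ht => ?_
    rw [bonusDeviation, sub_add_cancel]
    exact sum_playedOcc_sub_primal_le hL hP hT hδ hδ1 hf hc (Finset.mem_range.1 ht).le h₀
  have h2 : ∑ t ∈ Finset.range T, ∑ x, ∑ a, (visits (f t).path x a : ℝ) *
      confBonus S T δ f t x a ≤
      6 * Fintype.card X * Real.sqrt (2 * T * Fintype.card A * confLog X A T δ) := by
    have e : ∑ t ∈ Finset.range T, ∑ x, ∑ a, (visits (f t).path x a : ℝ) *
        confBonus S T δ f t x a = ∑ x, ∑ a, ∑ t ∈ Finset.range T, (visits (f t).path x a : ℝ) *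
        confBonus S T δ f t x a := by
      rw [Finset.sum_comm]
      exact Finset.sum_congr rfl fun x _ => Finset.sum_comm
    have hl : 0 ≤ confLog X A T δ := by
      have := half_le_confLog (X := X) (A := A) hL hP hT hδ hδ1
      linarith
    -- A factor 2 from the triangle inequality, √2 from doubling and 2 from the telescoping sum;
    -- this is the source of the 6 in `errQ`.
    have h42 : 4 * Real.sqrt 2 ≤ 6 := by
      have : Real.sqrt 2 ≤ 1.5 := by rw [Real.sqrt_le_left (by norm_num)]; norm_num
      linarith
    rw [e]
    calc _ ≤ ∑ x, ∑ a, 4 * Real.sqrt 2 *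
          Real.sqrt (2 * S.layerCard (S.layer x + 1) * confLog X A T δ) *
          Real.sqrt ((algRun S T δ f T).cnt x a) :=
        Finset.sum_le_sum fun x _ => Finset.sum_le_sum fun a _ =>
          sum_visits_mul_confBonus_le hf le_rfl x a
      _ = 4 * Real.sqrt 2 * Real.sqrt (2 * confLog X A T δ) *
          ∑ x, ∑ a, Real.sqrt (S.layerCard (S.layer x + 1)) *
            Real.sqrt ((algRun S T δ f T).cnt x a) := by
        simp only [Finset.mul_sum]
        refine Finset.sum_congr rfl fun x _ => Finset.sum_congr rfl fun a _ => ?_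
        rw [show 2 * (S.layerCard (S.layer x + 1) : ℝ) * confLog X A T δ =
          (2 * confLog X A T δ) * S.layerCard (S.layer x + 1) by ring,
          Real.sqrt_mul (by positivity)]
        ring
      _ ≤ 6 * Real.sqrt (2 * confLog X A T δ) *
          (Real.sqrt (Fintype.card A * T) * Fintype.card X) := by
        gcongr
        exact sum_sqrt_layerCard_mul_cnt_le hf
      _ = _ := by
        rw [show 2 * (T : ℝ) * Fintype.card A * confLog X A T δ =
          (2 * confLog X A T δ) * (Fintype.card A * T) by ring,
          Real.sqrt_mul (show 0 ≤ 2 * confLog X A T δ by positivity)]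
        ring
  -- The martingale term carries L², whereas `errQ` allows 4 L |X|.
  have hLX : (L : ℝ) ≤ 4 * Fintype.card X := by
    have : (L : ℝ) + 1 ≤ Fintype.card X := by exact_mod_cast succ_le_card hP
    have : (0 : ℝ) ≤ L := Nat.cast_nonneg _
    linarith
  refine h1.trans ((mul_le_mul_of_nonneg_left (add_le_add hq h2) (Nat.cast_nonneg _)).trans ?_)
  rw [errQ, mul_add]
  have e1 : (L : ℝ) * (L * Real.sqrt (2 * T * Real.log (1 / δ))) ≤
      4 * L * Fintype.card X * Real.sqrt (2 * T * Real.log (1 / δ)) := by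
    calc _ = (L : ℝ) * Real.sqrt (2 * T * Real.log (1 / δ)) * L := by ring
      _ ≤ (L : ℝ) * Real.sqrt (2 * T * Real.log (1 / δ)) * (4 * Fintype.card X) := by gcongr
      _ = _ := by ring
  refine add_le_add e1 (le_of_eq ?_)
  rw [confLog]; ring

end

/-! ### Online gradient descent -/

/-- Expand the square. Here `w` is the inverse step size; w = 0 is admitted because the step is then
1/0 = 0 and the loss vanishes. -/
lemma ogd_step {ι : Type*} [Fintype ι] {q q' l z : ι → ℝ} {w : ℝ} (hw : 0 ≤ w)
    (h0 : w = 0 → l = 0)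
    (h : ∑ i, (q' i - z i) ^ 2 ≤ ∑ i, ((q - (1 / w) • l) i - z i) ^ 2) :
    l ⬝ᵥ (q - z) ≤ w / 2 * (∑ i, (q i - z i) ^ 2 - ∑ i, (q' i - z i) ^ 2) +
      (∑ i, l i ^ 2) / (2 * w) := by
  rcases hw.eq_or_lt with hw | hw
  · rw [h0 hw.symm, ← hw]; simp
  have e : ∑ i, ((q - (1 / w) • l) i - z i) ^ 2 =
      ∑ i, (q i - z i) ^ 2 - 2 / w * (l ⬝ᵥ (q - z)) + (∑ i, l i ^ 2) / w ^ 2 := by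
    rw [dotProduct, Finset.mul_sum, Finset.sum_div, ← Finset.sum_sub_distrib,
      ← Finset.sum_add_distrib]
    refine Finset.sum_congr rfl fun i _ => ?_
    simp only [Pi.sub_apply, Pi.smul_apply, smul_eq_mul]
    field_simp
    ring
  rw [e] at h
  have h2 := mul_le_mul_of_nonneg_left h (show 0 ≤ w / 2 by positivity)
  have e2 : w / 2 * (∑ i, (q i - z i) ^ 2 - 2 / w * (l ⬝ᵥ (q - z)) + (∑ i, l i ^ 2) / w ^ 2) =
      w / 2 * ∑ i, (q i - z i) ^ 2 - l ⬝ᵥ (q - z) + (∑ i, l i ^ 2) / (2 * w) := by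
    field_simp
  rw [e2] at h2
  linarith

section
variable {X A : Type*} [Fintype X] [Fintype A] {L m : ℕ} {S : LayeredSpace X L}
  {P : X → A → X → ℝ} {T : ℕ} {δ : ℝ} {f : ℕ → Feedback X A L m}

/-- The feedback consists of layered trajectories, rewards in `[0, 1]` and constraints in
`[-1, 1]`. -/
structure RegularFeedback (S : LayeredSpace X L) (T : ℕ) (f : ℕ → Feedback X A L m) : Prop where
  path : ∀ t < T, LayeredPath S (f t).path
  reward : ∀ t < T, ∀ p, (f t).reward p ∈ Set.Icc (0 : ℝ) 1
  cons : ∀ t < T, ∀ p i, (f t).cons p i ∈ Set.Icc (-1 : ℝ) 1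

lemma RegularFeedback.abs_mulVec_dual_le (hf : RegularFeedback S T f) {t : ℕ} (ht : t < T)
    (p : X × A) : |(f t).cons.mulVec (algRun S T δ f t).dual p| ≤ m * (T : ℝ) ^ (1 / 4 : ℝ) := by
  have hd := dual_mem (S := S) (T := T) (δ := δ) (f := f) t
  calc |(f t).cons.mulVec (algRun S T δ f t).dual p|
      ≤ ∑ i, |(f t).cons p i * (algRun S T δ f t).dual i| := by
        rw [Matrix.mulVec, dotProduct]; exact Finset.abs_sum_le_sum_abs _ _
    _ ≤ ∑ i : Fin m, (T : ℝ) ^ (1 / 4 : ℝ) := by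
        refine Finset.sum_le_sum fun i _ => ?_
        have h1 : |(f t).cons p i| ≤ 1 := abs_le.2 (hf.cons t ht p i)
        have h2 : |(algRun S T δ f t).dual i| ≤ (T : ℝ) ^ (1 / 4 : ℝ) := by
          rw [abs_of_nonneg (hd.1 i)]; exact hd.2 i
        rw [abs_mul]
        calc _ ≤ 1 * (T : ℝ) ^ (1 / 4 : ℝ) := by gcongr
          _ = _ := one_mul _
    _ = _ := by simp

lemma RegularFeedback.norm_loss_le (hf : RegularFeedback S T f) {t : ℕ} (ht : t < T) :
    ‖(algRun S T δ f t).loss (f t)‖ ≤ 1 + m * (T : ℝ) ^ (1 / 4 : ℝ) := by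
  rw [pi_norm_le_iff_of_nonneg (by positivity)]
  intro p
  have h1 := abs_le.1 (hf.abs_mulVec_dual_le (δ := δ) ht p)
  have h2 := hf.reward t ht p
  rw [Real.norm_eq_abs, abs_le, AlgState.loss, Pi.sub_apply]
  constructor <;> linarith [h2.1, h2.2]

lemma RegularFeedback.lossMax_le (hf : RegularFeedback S T f) {t : ℕ} (ht : t ≤ T) :
    (algRun S T δ f t).lossMax ≤ 1 + m * (T : ℝ) ^ (1 / 4 : ℝ) := by
  induction t with
  | zero =>
    have : (algRun S T δ f 0).lossMax = 0 := rfl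
    rw [this]; positivity
  | succ t ih =>
    rw [lossMax_succ]
    exact max_le (ih (by omega)) (hf.norm_loss_le (by omega))

lemma lossMax_nonneg (t : ℕ) : 0 ≤ (algRun S T δ f t).lossMax := by
  induction t with
  | zero => exact le_rfl
  | succ t ih => rw [lossMax_succ]; exact ih.trans (le_max_left _ _)

lemma abs_dotProduct_le {ι : Type*} [Fintype ι] {u v : ι → ℝ} {c : ℝ} (hu : ∀ i, |u i| ≤ c) :
    |u ⬝ᵥ v| ≤ c * ∑ i, |v i| := by
  rw [Finset.mul_sum]
  refine (Finset.abs_sum_le_sum_abs _ _).trans (Finset.sum_le_sum fun i _ => ?_)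
  rw [abs_mul]
  exact mul_le_mul_of_nonneg_right (hu i) (abs_nonneg _)

/-- For entries in [0, 1] one has (q - q')² ≤ q + q', and the entries of an occupancy vector add up
to L. The diameter therefore does not involve |X| |A|. -/
lemma sum_sq_sub_le_of_mem_occSet {K K' : Set (X → A → X → ℝ)} (hK : RowConvex S K)
    (hK' : RowConvex S K') {q q' : X × A → ℝ} (hq : q ∈ occSet S K) (hq' : q' ∈ occSet S K') :
    ∑ p, (q p - q' p) ^ 2 ≤ 2 * L := by
  calc ∑ p, (q p - q' p) ^ 2 ≤ ∑ p, (q p + q' p) := by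
        refine Finset.sum_le_sum fun p _ => ?_
        have a1 := mem_occSet_nonneg hK hq p
        have a2 := mem_occSet_nonneg hK' hq' p
        have a3 := mem_occSet_le_one hK hq p
        have a4 := mem_occSet_le_one hK' hq' p
        nlinarith
    _ = 2 * L := by
        rw [Finset.sum_add_distrib, mem_occSet_sum hK hq, mem_occSet_sum hK' hq']; ring

lemma occSet_mono {K K' : Set (X → A → X → ℝ)} (h : K ⊆ K') : occSet S K ⊆ occSet S K' :=
  fun _ ⟨P', hP', h'⟩ => ⟨P', h hP', h'⟩

lemma primal_ogd [Nonempty A] (hL : 1 ≤ L) (hP : IsTransition S P) (hT : 1 ≤ T)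
    (hδ : 0 < δ) (hδ1 : δ < 1) (hf : RegularFeedback S T f)
    (hc : Concentrated S P T δ f) {q : X × A → ℝ} (hq : q ∈ occSet S {P}) :
    ∑ t ∈ Finset.range T, (algRun S T δ f t).loss (f t) ⬝ᵥ ((algRun S T δ f t).primal - q) ≤
      (1 + m * (T : ℝ) ^ (1 / 4 : ℝ)) * Real.sqrt T *
        (5 * (Fintype.card X * Fintype.card A) + L / 10) := by
  have hA : ∃ π : X → A → ℝ, IsPolicy π := by
    obtain ⟨P', -, π, hπ, -⟩ := hq; exact ⟨π, hπ⟩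
  have hqc : ∀ t ≤ T, q ∈ occSet S (algRun S T δ f t).conf := fun t ht =>
    occSet_mono (Set.singleton_subset_iff.2 (hc.mem_conf hP ht)) hq
  set Y : ℝ := Fintype.card X * Fintype.card A with hY
  have hYpos : 0 < Y := by
    have : (0 : ℝ) < Fintype.card A := by exact_mod_cast Fintype.card_pos
    have : (0 : ℝ) < Fintype.card X := by
      exact_mod_cast (Nat.succ_pos L).trans_le (succ_le_card hP)
    positivity
  have hL0 : (0 : ℝ) < L := by exact_mod_cast hL
  have hT0 : 0 < Real.sqrt T := Real.sqrt_pos.2 (by exact_mod_cast hT)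
  set Λ : ℝ := 1 + m * (T : ℝ) ^ (1 / 4 : ℝ) with hΛ
  have hΛ0 : 0 ≤ Λ := by positivity
  set D : ℝ := constC X A L * Real.sqrt T with hD
  have hDe : D = 5 * Y / L * Real.sqrt T := rfl
  have hD0 : 0 < D := by rw [hDe]; positivity
  set a : ℕ → ℝ := fun t => ∑ p, ((algRun S T δ f t).primal p - q p) ^ 2 with ha
  have ha2 : ∀ t ≤ T, a t ≤ 2 * L := fun t ht =>
    sum_sq_sub_le_of_mem_occSet (rowConvex_conf t) (rowConvex_conf t)
      (primal_mem hL hP hT hδ hδ1 hf.path ht hA) (hqc t ht)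
  -- The weights `lossMax` change with time. The potential contains 2L - a n ≥ 0, so replacing the
  -- weight by the next, larger one only increases the bound, and the sum telescopes.
  have key : ∀ n ≤ T, ∑ t ∈ Finset.range n,
      (algRun S T δ f t).loss (f t) ⬝ᵥ ((algRun S T δ f t).primal - q) ≤
      (algRun S T δ f n).lossMax * D / 2 * (2 * L - a n) + n * (L * Λ / (10 * Real.sqrt T)) := by
    intro n
    induction n with
    | zero =>
      intro _
      have : (algRun S T δ f 0).lossMax = 0 := rfl
      simp [this]
    | succ n ih =>
      intro hn
      have ih := ih (by omega)
      set l := (algRun S T δ f n).loss (f n) with hl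
      set M := (algRun S T δ f (n + 1)).lossMax with hM
      have hM0 : 0 ≤ M := lossMax_nonneg _
      have hMΛ : M ≤ Λ := hf.lossMax_le hn
      have hMn : (algRun S T δ f n).lossMax ≤ M := by rw [hM, lossMax_succ]; exact le_max_left _ _
      have hlM : ‖l‖ ≤ M := by rw [hM, lossMax_succ]; exact le_max_right _ _
      have hproj := (isEuclProj_euclProj (rowConvex_conf (n + 1)).isCompact_occSet
        ⟨q, hqc (n + 1) hn⟩ ((algRun S T δ f n).primal - (1 / (M * D)) • l)).sum_sq_le
          (rowConvex_conf (n + 1)).convex_occSet (hqc (n + 1) hn)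
      have hsucc : (algRun S T δ f (n + 1)).primal = euclProj (occSet S
          (algRun S T δ f (n + 1)).conf) ((algRun S T δ f n).primal - (1 / (M * D)) • l) := by
        rw [primal_succ, hD, mul_assoc]
      rw [← hsucc] at hproj
      have hstep := ogd_step (w := M * D) (by positivity) (fun h => by
        have : M = 0 := by
          rcases mul_eq_zero.1 h with h | h
          · exact h
          · exact absurd h hD0.ne'
        rw [this] at hlM
        exact norm_eq_zero.1 (le_antisymm hlM (norm_nonneg _))) hproj
      -- With C = 5 |X| |A| / L the quotient is at most |X| |A| M² / (2 M C √T) = L M / (10 √T).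
      have hsq : (∑ p, l p ^ 2) / (2 * (M * D)) ≤ L * Λ / (10 * Real.sqrt T) := by
        have h1 : ∑ p, l p ^ 2 ≤ Y * M ^ 2 := by
          calc ∑ p, l p ^ 2 ≤ ∑ p : X × A, M ^ 2 := by
                refine Finset.sum_le_sum fun p _ => ?_
                rw [← sq_abs]
                exact pow_le_pow_left₀ (abs_nonneg _) ((norm_le_pi_norm l p).trans hlM) 2
            _ = Y * M ^ 2 := by simp [hY]
        rcases hM0.eq_or_lt with h | h
        · rw [← h]; simp; positivity
        · rw [div_le_div_iff₀ (by positivity) (by positivity)]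
          calc (∑ p, l p ^ 2) * (10 * Real.sqrt T) ≤ Y * M ^ 2 * (10 * Real.sqrt T) := by gcongr
            _ = L * M * (2 * (M * D)) := by rw [hDe]; field_simp; ring
            _ ≤ L * Λ * (2 * (M * D)) := by gcongr
      rw [Finset.sum_range_succ]
      have h3 : (algRun S T δ f n).lossMax * D / 2 * (2 * L - a n) ≤
          M * D / 2 * (2 * L - a n) := by
        have := ha2 n (by omega)
        refine mul_le_mul_of_nonneg_right ?_ (by linarith)
        gcongr
      have h4 : l ⬝ᵥ ((algRun S T δ f n).primal - q) ≤
          M * D / 2 * (a n - a (n + 1)) + L * Λ / (10 * Real.sqrt T) := by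
        refine hstep.trans (add_le_add le_rfl hsq)
      push_cast
      linarith
  refine (key T le_rfl).trans ?_
  have e1 : (algRun S T δ f T).lossMax * D / 2 * (2 * L - a T) ≤ Λ * D / 2 * (2 * L) := by
    have h1 : 0 ≤ a T := Finset.sum_nonneg fun p _ => sq_nonneg _
    have h2 := hf.lossMax_le (δ := δ) le_rfl
    have h3 := ha2 T le_rfl
    have h4 := lossMax_nonneg (S := S) (T := T) (δ := δ) (f := f) T
    calc _ ≤ Λ * D / 2 * (2 * L - a T) := by
          refine mul_le_mul_of_nonneg_right ?_ (by linarith)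
          gcongr
      _ ≤ _ := by
          refine mul_le_mul_of_nonneg_left (by linarith) (by positivity)
  have e2 : Λ * D / 2 * (2 * L) = Λ * Real.sqrt T * (5 * Y) := by
    rw [hDe]; field_simp
  have e3 : (T : ℝ) * (L * Λ / (10 * Real.sqrt T)) = Λ * Real.sqrt T * (L / 10) := by
    have : (T : ℝ) = Real.sqrt T * Real.sqrt T := (Real.mul_self_sqrt (Nat.cast_nonneg _)).symm
    nth_rewrite 1 [this]
    field_simp
  rw [e3]
  rw [e2] at e1
  linarith

lemma abs_cons_mulVec_le (hf : RegularFeedback S T f) {t : ℕ} (ht : t < T)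
    {K : Set (X → A → X → ℝ)} (hK : RowConvex S K) {q : X × A → ℝ} (hq : q ∈ occSet S K)
    (i : Fin m) : |(f t).cons.transpose.mulVec q i| ≤ L := by
  have h := abs_dotProduct_le (u := fun p => (f t).cons p i) (v := q) (c := 1)
    (fun p => abs_le.2 (hf.cons t ht p i))
  simp only [abs_of_nonneg (mem_occSet_nonneg hK hq _), mem_occSet_sum hK hq, one_mul] at h
  exact h

/-- The same telescoping with a constant step; as λ starts at 0, the initial squared distance is ∑
ν_i². -/
lemma dual_ogd [Nonempty A] (hL : 1 ≤ L) (hP : IsTransition S P) (hT : 1 ≤ T)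
    (hδ : 0 < δ) (hδ1 : δ < 1) (hf : RegularFeedback S T f) {π₀ : X → A → ℝ} (h₀ : IsPolicy π₀)
    (hη : 0 < dualRate X A m T δ) {ν : Fin m → ℝ}
    (hν : ν ∈ Set.Icc (0 : Fin m → ℝ) fun _ => (T : ℝ) ^ (1 / 4 : ℝ)) :
    dualRegret S T δ f ν ≤ 1 / dualRate X A m T δ / 2 * (∑ i, ν i ^ 2) +
      T * (dualRate X A m T δ * (m * L ^ 2) / 2) := by
  set η := dualRate X A m T δ with hηdef
  set g : ℕ → Fin m → ℝ := fun t =>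
    (f t).cons.transpose.mulVec (algRun S T δ f t).primal with hg
  have hg2 : ∀ t < T, ∑ i, (-g t) i ^ 2 ≤ m * (L : ℝ) ^ 2 := by
    intro t ht
    calc ∑ i, (-g t) i ^ 2 ≤ ∑ i : Fin m, (L : ℝ) ^ 2 := by
          refine Finset.sum_le_sum fun i _ => ?_
          rw [Pi.neg_apply, neg_sq, ← sq_abs]
          exact pow_le_pow_left₀ (abs_nonneg _) (abs_cons_mulVec_le hf ht (rowConvex_conf t)
            (primal_mem hL hP hT hδ hδ1 hf.path ht.le ⟨π₀, h₀⟩) i) 2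
      _ = m * (L : ℝ) ^ 2 := by simp
  set a : ℕ → ℝ := fun t => ∑ i, ((algRun S T δ f t).dual i - ν i) ^ 2 with ha
  have key : ∀ n ≤ T, ∑ t ∈ Finset.range n, (ν - (algRun S T δ f t).dual) ⬝ᵥ g t ≤
      1 / η / 2 * (a 0 - a n) + n * (η * (m * L ^ 2) / 2) := by
    intro n
    induction n with
    | zero => simp
    | succ n ih =>
      intro hn
      have ih := ih (by omega)
      have hproj := (isEuclProj_euclProj (isCompact_Icc) ⟨ν, hν⟩
        ((algRun S T δ f n).dual + η • g n)).sum_sq_le (convex_Icc _ _) hν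
      rw [← dual_succ] at hproj
      have hstep := ogd_step (q := (algRun S T δ f n).dual) (l := -g n) (w := 1 / η)
        (q' := (algRun S T δ f (n + 1)).dual) (z := ν)
        (by positivity) (fun h => absurd h (by positivity)) (by
          rw [one_div_one_div, smul_neg, sub_neg_eq_add]; exact hproj)
      have e1 : -g n ⬝ᵥ ((algRun S T δ f n).dual - ν) =
          (ν - (algRun S T δ f n).dual) ⬝ᵥ g n := by
        rw [neg_dotProduct, dotProduct_comm, ← neg_dotProduct, neg_sub]
      have e2 : (∑ i, (-g n) i ^ 2) / (2 * (1 / η)) ≤ η * (m * L ^ 2) / 2 := by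
        have := hg2 n (by omega)
        calc _ = η * (∑ i, (-g n) i ^ 2) / 2 := by field_simp
          _ ≤ _ := by gcongr
      rw [e1] at hstep
      rw [Finset.sum_range_succ]
      push_cast
      linarith
  have ha0 : a 0 = ∑ i, ν i ^ 2 := by
    have : (algRun S T δ f 0).dual = 0 := rfl
    simp [ha, this]
  have haT : 0 ≤ a T := Finset.sum_nonneg fun i _ => sq_nonneg _
  refine (key T le_rfl).trans ?_
  rw [ha0]
  gcongr
  linarith

end

/-! ### Performance guarantees for regular feedback -/

lemma one_le_quarter {T : ℕ} (hT : 1 ≤ T) : 1 ≤ (T : ℝ) ^ (1 / 4 : ℝ) :=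
  Real.one_le_rpow (by exact_mod_cast hT) (by norm_num)

lemma quarter_sq (T : ℕ) : ((T : ℝ) ^ (1 / 4 : ℝ)) ^ 2 = Real.sqrt T := by
  rw [← Real.rpow_natCast, ← Real.rpow_mul (Nat.cast_nonneg _), Real.sqrt_eq_rpow]; norm_num

lemma quarter_cube (T : ℕ) : ((T : ℝ) ^ (1 / 4 : ℝ)) ^ 3 = (T : ℝ) ^ (3 / 4 : ℝ) := by
  rw [← Real.rpow_natCast, ← Real.rpow_mul (Nat.cast_nonneg _)]; norm_num

lemma quarter_four (T : ℕ) : ((T : ℝ) ^ (1 / 4 : ℝ)) ^ 4 = T := by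
  rw [← Real.rpow_natCast, ← Real.rpow_mul (Nat.cast_nonneg _)]; norm_num

/-- The restriction δ < 1/4 gives T²/δ ≥ 4 > e. The complementary range of δ is trivial in the
theorem. -/
lemma one_le_log {T : ℕ} (hT : 1 ≤ T) {δ : ℝ} (hδ : 0 < δ) (hδ4 : δ < 1 / 4) :
    1 ≤ Real.log ((T : ℝ) ^ 2 / δ) := by
  have h1 : (1 : ℝ) ≤ T := by exact_mod_cast hT
  have h4 : (4 : ℝ) ≤ (T : ℝ) ^ 2 / δ := by
    rw [le_div_iff₀ hδ]; nlinarith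
  have h5 := Real.log_le_log (by norm_num) h4
  have h6 : Real.log 4 = 2 * Real.log 2 := by
    rw [show (4 : ℝ) = 2 ^ 2 by norm_num, Real.log_pow]; norm_num
  have := Real.log_two_gt_d9
  linarith

lemma one_div_dualRate (X A : Type*) [Fintype X] [Fintype A] (m T : ℕ) (δ : ℝ) :
    1 / dualRate X A m T δ = 100 * m * (Fintype.card X * Fintype.card A) *
      (((T : ℝ) ^ (1 / 4 : ℝ)) ^ 2 * Real.sqrt (Real.log ((T : ℝ) ^ 2 / δ))) := by
  rw [dualRate, one_div_one_div, quarter_sq, Real.sqrt_mul (Nat.cast_nonneg _)]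
  ring

lemma errG_eq (L T : ℕ) (δ : ℝ) : errG L T δ = 2 * L * (Real.sqrt 2 *
    (((T : ℝ) ^ (1 / 4 : ℝ)) ^ 2 * Real.sqrt (Real.log ((T : ℝ) ^ 2 / δ)))) := by
  rw [errG, quarter_sq, Real.sqrt_mul (by positivity), Real.sqrt_mul (by norm_num)]
  ring

lemma sqrt_two_le : Real.sqrt 2 ≤ 1.5 := by
  rw [Real.sqrt_le_left (by norm_num)]; norm_num

/-- In these real inequalities `u` stands for T^{1/4}, `l` for √ln(T²/δ) and `Y` for |X| |A|; thus T
= u⁴, √T = u² and 1/η = 100 m Y u² l. -/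
lemma dualRate_mul_le {u l m Y η : ℝ} (hu : 1 ≤ u) (hl : 1 ≤ l) (hm : 1 ≤ m) (hY : 1 ≤ Y)
    (hη : 0 < η) (hηB : η * (100 * m * Y * (u ^ 2 * l)) = 1) : η * m ≤ 1 / u ^ 2 := by
  rw [le_div_iff₀ (by positivity), ← hηB, mul_assoc]
  refine mul_le_mul_of_nonneg_left ?_ hη.le
  have : 1 ≤ Y * l := by nlinarith
  calc m * u ^ 2 = m * u ^ 2 * 1 := by ring
    _ ≤ m * u ^ 2 * (100 * (Y * l)) :=
      mul_le_mul_of_nonneg_left (by linarith) (by positivity)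
    _ = _ := by ring

/-- Each term on the right of `h` is a multiple of Z = m Y l u⁴. The factors add up to at most 66 +
L, below the available 100 (2 + 2L). -/
lemma violation_arith {u l m L Y η V : ℝ} (hu : 1 ≤ u) (hl : 1 ≤ l) (hL : 1 ≤ L) (hm : 1 ≤ m)
    (hY : L ≤ Y) (hη : 0 < η) (hηB : η * (100 * m * Y * (u ^ 2 * l)) = 1)
    (h : u * V ≤ 100 * m * Y * (u ^ 2 * l) / 2 * u ^ 2 + u ^ 4 * (η * (m * L ^ 2) / 2) +
      (1 + m * u) * u ^ 2 * (5 * Y + L / 10) + m * u * (2 * L * (Real.sqrt 2 * (u ^ 2 * l))) +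
      u ^ 4 * L) : V ≤ (2 + 2 * L) * (100 * m * Y * (u ^ 2 * l)) * u := by
  have hu0 : 0 < u := by linarith
  have hY0 : 0 < Y := by linarith
  have hηm := dualRate_mul_le hu hl hm (hL.trans hY) hη hηB
  have d0 : u ^ 2 ≤ u ^ 4 := pow_le_pow_right₀ hu (by norm_num)
  have d1 : u ^ 3 ≤ u ^ 4 := pow_le_pow_right₀ hu (by norm_num)
  set Z := m * Y * l * u ^ 4 with hZ
  have hZ0 : 0 ≤ Z := by positivity
  have f1 : u ^ 4 * (η * (m * L ^ 2) / 2) ≤ L * Z := by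
    calc u ^ 4 * (η * (m * L ^ 2) / 2) = u ^ 4 * L ^ 2 / 2 * (η * m) := by ring
      _ ≤ u ^ 4 * L ^ 2 / 2 * (1 / u ^ 2) := by gcongr
      _ = u ^ 2 * (L ^ 2 / 2) := by field_simp
      _ ≤ u ^ 4 * (L * Y) := by
        have : L ^ 2 / 2 ≤ L * Y := by nlinarith
        gcongr
      _ = L * (1 * Y * 1 * u ^ 4) := by ring
      _ ≤ L * Z := by rw [hZ]; gcongr
  have f2 : (1 + m * u) * u ^ 2 * (5 * Y + L / 10) ≤ 12 * Z := by
    have : 1 ≤ m * u := by nlinarith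
    calc (1 + m * u) * u ^ 2 * (5 * Y + L / 10) ≤ (m * u + m * u) * u ^ 2 * (6 * Y) := by
          gcongr; linarith
      _ = 12 * (m * Y * 1 * u ^ 3) := by ring
      _ ≤ 12 * Z := by rw [hZ]; gcongr
  have f3 : m * u * (2 * L * (Real.sqrt 2 * (u ^ 2 * l))) ≤ 3 * Z := by
    have := sqrt_two_le
    calc m * u * (2 * L * (Real.sqrt 2 * (u ^ 2 * l)))
        ≤ m * u * (2 * L * (1.5 * (u ^ 2 * l))) := by gcongr
      _ = 3 * (m * L * l * u ^ 3) := by ring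
      _ ≤ 3 * Z := by rw [hZ]; gcongr
  have f4 : u ^ 4 * L ≤ Z := by
    calc u ^ 4 * L = 1 * L * 1 * u ^ 4 := by ring
      _ ≤ Z := by rw [hZ]; gcongr
  have f0 : 100 * m * Y * (u ^ 2 * l) / 2 * u ^ 2 = 50 * Z := by rw [hZ]; ring
  have f5 : u * ((2 + 2 * L) * (100 * m * Y * (u ^ 2 * l)) * u) = (2 + 2 * L) * (100 * Z) := by
    rw [hZ]; ring
  have := mul_nonneg (show 0 ≤ L by linarith) hZ0
  refine le_of_mul_le_mul_left ?_ hu0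
  rw [f5]
  linarith

/-- All five terms are of order l u³: the errors of order u² l acquire a factor u from the
multipliers or the losses, and R^D is of order u². -/
lemma regret_arith {u l m L Y C η Er EG EQ RD RP : ℝ} (hu : 1 ≤ u) (hl : 1 ≤ l) (hL : 1 ≤ L)
    (hm : 1 ≤ m) (hY : L ≤ Y) (hC : 0 ≤ C) (hη : 0 < η)
    (hηB : η * (100 * m * Y * (u ^ 2 * l)) = 1)
    (hEr : Er ≤ L * (u ^ 2 * l)) (hEG : EG = 2 * L * (Real.sqrt 2 * (u ^ 2 * l)))
    (hEQ : EQ ≤ C * (u ^ 2 * l)) (hRD : RD ≤ u ^ 4 * (η * (m * L ^ 2) / 2))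
    (hRP : RP ≤ (1 + m * u) * u ^ 2 * (5 * Y + L / 10) + (1 + m * u) * EQ) :
    Er + m * u * EG + m * u * EQ + RD + RP ≤
      (L + 3 * m * L + m * C + L ^ 2 + (1 + m) * (5 * Y + L + C)) * (l * u ^ 3) := by
  have hu0 : 0 < u := by linarith
  have hY0 : 0 < Y := by linarith
  have hηm := dualRate_mul_le hu hl hm (hL.trans hY) hη hηB
  have hlu : u ^ 2 * l ≤ l * u ^ 3 := by
    rw [mul_comm]
    exact mul_le_mul_of_nonneg_left (pow_le_pow_right₀ hu (by norm_num)) (by linarith)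
  have hu3 : u ^ 3 ≤ l * u ^ 3 := le_mul_of_one_le_left (by positivity) hl
  set W := l * u ^ 3 with hW
  have b1 : Er ≤ L * W := hEr.trans (by gcongr)
  have b2 : m * u * EG ≤ 3 * m * L * W := by
    rw [hEG]
    have := sqrt_two_le
    calc m * u * (2 * L * (Real.sqrt 2 * (u ^ 2 * l)))
        ≤ m * u * (2 * L * (1.5 * (u ^ 2 * l))) := by gcongr
      _ = _ := by rw [hW]; ring
  have b3 : m * u * EQ ≤ m * C * W := by
    calc m * u * EQ ≤ m * u * (C * (u ^ 2 * l)) := by gcongr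
      _ = _ := by rw [hW]; ring
  have b4 : RD ≤ L ^ 2 * W := by
    calc RD ≤ u ^ 4 * (η * (m * L ^ 2) / 2) := hRD
      _ = u ^ 4 * L ^ 2 / 2 * (η * m) := by ring
      _ ≤ u ^ 4 * L ^ 2 / 2 * (1 / u ^ 2) := by gcongr
      _ = L ^ 2 * (u ^ 2 / 2) := by field_simp
      _ ≤ L ^ 2 * W := by
        have : u ^ 2 ≤ u ^ 3 := pow_le_pow_right₀ hu (by norm_num)
        have : 0 ≤ u ^ 2 := by positivity
        gcongr
        linarith
  have hmu : 1 + m * u ≤ (1 + m) * u := by nlinarith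
  have b5 : (1 + m * u) * u ^ 2 * (5 * Y + L / 10) ≤ (1 + m) * (5 * Y + L) * W := by
    calc (1 + m * u) * u ^ 2 * (5 * Y + L / 10) ≤ ((1 + m) * u) * u ^ 2 * (5 * Y + L) := by
          gcongr; linarith
      _ = (1 + m) * (5 * Y + L) * u ^ 3 := by ring
      _ ≤ _ := by gcongr
  have b6 : (1 + m * u) * EQ ≤ (1 + m) * C * W := by
    calc (1 + m * u) * EQ ≤ (1 + m * u) * (C * (u ^ 2 * l)) := by gcongr
      _ ≤ ((1 + m) * u) * (C * (u ^ 2 * l)) := by gcongr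
      _ = _ := by rw [hW]; ring
  linarith

section
variable {X A : Type*} [Fintype X] [Fintype A] {L m : ℕ} {S : LayeredSpace X L}
  {P : X → A → X → ℝ} {T : ℕ} {δ : ℝ} {f : ℕ → Feedback X A L m}

/-- The deviation of the realized constraints from their means, weighted by the dual iterate. -/
def consDeviation (S : LayeredSpace X L) (T : ℕ) (δ : ℝ) (Gbar : Matrix (X × A) (Fin m) ℝ)
    (q : X × A → ℝ) (f : ℕ → Feedback X A L m) (t : ℕ) : ℝ :=
  (algRun S T δ f t).dual ⬝ᵥ ((f t).cons - Gbar).transpose.mulVec q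

lemma mulVec_dotProduct_eq {ι κ : Type*} [Fintype ι] [Fintype κ] (G : Matrix ι κ ℝ) (v : κ → ℝ)
    (q : ι → ℝ) : G.mulVec v ⬝ᵥ q = v ⬝ᵥ G.transpose.mulVec q := by
  rw [dotProduct_comm, Matrix.dotProduct_mulVec, ← Matrix.mulVec_transpose, dotProduct_comm]

lemma loss_dotProduct (t : ℕ) (q : X × A → ℝ) : (algRun S T δ f t).loss (f t) ⬝ᵥ q =
    (algRun S T δ f t).dual ⬝ᵥ (f t).cons.transpose.mulVec q - (f t).reward ⬝ᵥ q := by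
  rw [AlgState.loss, sub_dotProduct, mulVec_dotProduct_eq]

/-- The mean part λ_tᵀḠᵀq is nonpositive because λ_t ≥ 0, so only the fluctuation remains. -/
lemma dual_dotProduct_cons_le {Gbar : Matrix (X × A) (Fin m) ℝ} {q : X × A → ℝ}
    (hq : ∀ i, (Gbar.transpose.mulVec q) i ≤ 0) (t : ℕ) :
    (algRun S T δ f t).dual ⬝ᵥ (f t).cons.transpose.mulVec q ≤
      consDeviation S T δ Gbar q f t := by
  have h : (algRun S T δ f t).dual ⬝ᵥ Gbar.transpose.mulVec q ≤ 0 :=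
    Finset.sum_nonpos fun i _ => mul_nonpos_of_nonneg_of_nonpos
      ((dual_mem (S := S) (T := T) (δ := δ) (f := f) t).1 i) (hq i)
  rw [consDeviation, Matrix.transpose_sub, Matrix.sub_mulVec, dotProduct_sub]
  linarith

lemma card_mul_card_pos [Nonempty A] (hP : IsTransition S P) :
    (L : ℝ) + 1 ≤ Fintype.card X * Fintype.card A := by
  have h1 : (L : ℝ) + 1 ≤ Fintype.card X := by exact_mod_cast succ_le_card hP
  have h2 : (1 : ℝ) ≤ Fintype.card A := by exact_mod_cast Fintype.card_pos
  have h3 : (0 : ℝ) ≤ L := Nat.cast_nonneg _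
  nlinarith

lemma regret_decomposition (hf : RegularFeedback S T f)
    {π₀ : X → A → ℝ} {rbar : X × A → ℝ} {Gbar : Matrix (X × A) (Fin m) ℝ} {qstar : X × A → ℝ}
    (hq : IsOptimal S P rbar Gbar qstar)
    (hE : ∑ t ∈ Finset.range T,
        ∑ p, |playedOcc S P T δ π₀ f t p - (algRun S T δ f t).primal p| ≤ errQ X A L T δ)
    (hG : ∑ t ∈ Finset.range T, consDeviation S T δ Gbar qstar f t ≤
      m * (T : ℝ) ^ (1 / 4 : ℝ) * errG L T δ)
    {Er : ℝ} (hr : ∑ t ∈ Finset.range T, (rbar - (f t).reward) ⬝ᵥ qstar ≤ Er) :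
    cumRegret S P T δ π₀ rbar Gbar f ≤ Er + m * (T : ℝ) ^ (1 / 4 : ℝ) * errG L T δ
      + m * (T : ℝ) ^ (1 / 4 : ℝ) * errQ X A L T δ
      + dualRegret S T δ f 0 + primalRegret S P T δ π₀ f qstar := by
  have hopt : optValue S P rbar Gbar = rbar ⬝ᵥ qstar := by
    refine IsGreatest.csSup_eq ⟨⟨qstar, hq.1, rfl⟩, ?_⟩
    rintro _ ⟨q', hq', rfl⟩
    exact hq.2 q' hq'
  have hT : (T : ℝ) * (rbar ⬝ᵥ qstar) = ∑ t ∈ Finset.range T, rbar ⬝ᵥ qstar := by simp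
  -- After expanding ℓ_t this is an identity up to two slacks: the nonpositive mean part of
  -- λ_tᵀG_tᵀq*, and Hölder's inequality for λ_tᵀG_tᵀ(q_t - q̂_t).
  have e1 : ∀ t ∈ Finset.range T, rbar ⬝ᵥ qstar - (f t).reward ⬝ᵥ playedOcc S P T δ π₀ f t ≤
      (rbar - (f t).reward) ⬝ᵥ qstar + consDeviation S T δ Gbar qstar f t +
      m * (T : ℝ) ^ (1 / 4 : ℝ) *
        ∑ p, |playedOcc S P T δ π₀ f t p - (algRun S T δ f t).primal p| +
      (0 - (algRun S T δ f t).dual) ⬝ᵥ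
        ((f t).cons.transpose.mulVec (algRun S T δ f t).primal) +
      (algRun S T δ f t).loss (f t) ⬝ᵥ (playedOcc S P T δ π₀ f t - qstar) := by
    intro t ht
    have h1 := dual_dotProduct_cons_le (S := S) (T := T) (δ := δ) (f := f) hq.1.2 t
    have h2 := (abs_le.1 (abs_dotProduct_le
      (v := playedOcc S P T δ π₀ f t - (algRun S T δ f t).primal)
      (hf.abs_mulVec_dual_le (δ := δ) (Finset.mem_range.1 ht)))).1
    rw [dotProduct_sub, loss_dotProduct, loss_dotProduct, sub_dotProduct, zero_sub,
      neg_dotProduct]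
    rw [mulVec_dotProduct_eq, Matrix.mulVec_sub, dotProduct_sub] at h2
    simp only [Pi.sub_apply] at h2
    linarith
  have e2 := Finset.sum_le_sum e1
  simp only [Finset.sum_add_distrib, ← Finset.mul_sum] at e2
  have e3 : (m : ℝ) * (T : ℝ) ^ (1 / 4 : ℝ) * ∑ t ∈ Finset.range T,
      ∑ p, |playedOcc S P T δ π₀ f t p - (algRun S T δ f t).primal p| ≤
      m * (T : ℝ) ^ (1 / 4 : ℝ) * errQ X A L T δ :=
    mul_le_mul_of_nonneg_left hE (by positivity)
  rw [cumRegret, hopt, hT, ← Finset.sum_sub_distrib, dualRegret, primalRegret]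
  linarith

/-- A violated constraint would make the comparator T^{1/4} e_i earn much, so the multipliers must
earn much as well. The primal player prevents this, since q* has a small Lagrangian loss; rewards
spoil the argument by at most L per episode. -/
lemma sum_cons_primal_le [Nonempty A] (hm : 1 ≤ m) (hL : 1 ≤ L) (hP : IsTransition S P)
    (hT : 1 ≤ T) (hδ : 0 < δ) (hδ4 : δ < 1 / 4) (hf : RegularFeedback S T f)
    (hc : Concentrated S P T δ f) {π₀ : X → A → ℝ} (h₀ : IsPolicy π₀)
    {Gbar : Matrix (X × A) (Fin m) ℝ} {qstar : X × A → ℝ}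
    (hq : qstar ∈ feasibleSet S P Gbar)
    (hG : ∑ t ∈ Finset.range T, consDeviation S T δ Gbar qstar f t ≤
      m * (T : ℝ) ^ (1 / 4 : ℝ) * errG L T δ) (i : Fin m) :
    ∑ t ∈ Finset.range T, (f t).cons.transpose.mulVec (algRun S T δ f t).primal i ≤
      (2 + 2 * L) * (1 / dualRate X A m T δ) * (T : ℝ) ^ (1 / 4 : ℝ) := by
  classical
  have hlog := one_le_log hT hδ hδ4
  have hB := one_div_dualRate X A m T δ
  have hY := card_mul_card_pos hP
  have hu := one_le_quarter hT
  have hu2 := quarter_sq T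
  have hu4 := quarter_four T
  have hGe := errG_eq L T δ
  have hr : 1 ≤ Real.sqrt (Real.log ((T : ℝ) ^ 2 / δ)) := Real.one_le_sqrt.2 hlog
  set u := (T : ℝ) ^ (1 / 4 : ℝ) with hudef
  set l := Real.sqrt (Real.log ((T : ℝ) ^ 2 / δ)) with hl
  set Y : ℝ := Fintype.card X * Fintype.card A with hYdef
  have hL1 : (1 : ℝ) ≤ L := by exact_mod_cast hL
  have hm1 : (1 : ℝ) ≤ m := by exact_mod_cast hm
  have hη : 0 < dualRate X A m T δ := by
    rw [← one_div_pos, hB]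
    have : 0 < Y := by linarith
    positivity
  set η := dualRate X A m T δ with hηdef
  -- The comparator is the largest admissible multiple of the i-th unit vector.
  have hνmem : (fun j => if j = i then u else 0) ∈
      Set.Icc (0 : Fin m → ℝ) fun _ => (T : ℝ) ^ (1 / 4 : ℝ) := by
    constructor <;> intro j <;> simp only [Pi.zero_apply] <;> split_ifs <;> linarith
  have h1 := dual_ogd hL hP hT hδ (by linarith) hf h₀ hη hνmem
  have h2 := primal_ogd hL hP hT hδ (by linarith) hf hc hq.1
  have h3 : ∑ j : Fin m, (if j = i then u else 0) ^ 2 = u ^ 2 := by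
    simp [ite_pow]
  have h4 : dualRegret S T δ f (fun j => if j = i then u else 0) =
      u * ∑ t ∈ Finset.range T, (f t).cons.transpose.mulVec (algRun S T δ f t).primal i -
      ∑ t ∈ Finset.range T, (algRun S T δ f t).dual ⬝ᵥ
        (f t).cons.transpose.mulVec (algRun S T δ f t).primal := by
    rw [dualRegret, Finset.mul_sum, ← Finset.sum_sub_distrib]
    refine Finset.sum_congr rfl fun t _ => ?_
    rw [sub_dotProduct]
    congr 1
    simp [dotProduct]
  -- Write λ_tᵀG_tᵀq̂_t = ℓ_tᵀ(q̂_t - q*) + λ_tᵀG_tᵀq* + r_tᵀ(q̂_t - q*) and bound the reward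
  -- difference by L.
  have h5 : ∑ t ∈ Finset.range T, (algRun S T δ f t).dual ⬝ᵥ
        (f t).cons.transpose.mulVec (algRun S T δ f t).primal ≤
      ∑ t ∈ Finset.range T,
        (algRun S T δ f t).loss (f t) ⬝ᵥ ((algRun S T δ f t).primal - qstar) +
      ∑ t ∈ Finset.range T, consDeviation S T δ Gbar qstar f t + T * L := by
    have : (T : ℝ) * L = ∑ t ∈ Finset.range T, (L : ℝ) := by simp
    rw [this, ← Finset.sum_add_distrib, ← Finset.sum_add_distrib]
    refine Finset.sum_le_sum fun t ht => ?_
    have ht := Finset.mem_range.1 ht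
    have hp := primal_mem hL hP hT hδ (by linarith) hf.path ht.le ⟨π₀, h₀⟩
    have a1 := dual_dotProduct_cons_le (S := S) (T := T) (δ := δ) (f := f) hq.2 t
    have a2 : (f t).reward ⬝ᵥ (algRun S T δ f t).primal ≤ L := by
      rw [← mem_occSet_sum (rowConvex_conf t) hp]
      refine Finset.sum_le_sum fun p _ => ?_
      exact mul_le_of_le_one_left (mem_occSet_nonneg (rowConvex_conf t) hp p)
        (hf.reward t ht p).2
    have a3 : 0 ≤ (f t).reward ⬝ᵥ qstar := Finset.sum_nonneg fun p _ =>
      mul_nonneg (hf.reward t ht p).1 (mem_occSet_nonneg (rowConvex_conf T)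
        (occSet_mono (Set.singleton_subset_iff.2 (hc.mem_conf hP le_rfl)) hq.1) p)
    rw [dotProduct_sub, loss_dotProduct, loss_dotProduct]
    linarith
  rw [h4, h3] at h1
  set V := ∑ t ∈ Finset.range T, (f t).cons.transpose.mulVec (algRun S T δ f t).primal i with hV
  set B := 100 * (m : ℝ) * Y * (u ^ 2 * l) with hBdef
  have hB0 : 0 < B := by
    have : 0 < Y := by linarith
    positivity
  have hηB : η * B = 1 := by rw [← hB, mul_one_div_cancel hη.ne']
  rw [hB]
  refine violation_arith hu hr hL1 hm1 (by linarith) hη hηB ?_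
  rw [hB] at h1
  rw [hGe] at hG
  rw [← hu2] at h2
  rw [← hu4] at h1 h5
  linarith

lemma cumViolation_le [Nonempty A] (hm : 1 ≤ m) (hf : RegularFeedback S T f)
    {π₀ : X → A → ℝ} {B E : ℝ}
    (hE : ∑ t ∈ Finset.range T,
        ∑ p, |playedOcc S P T δ π₀ f t p - (algRun S T δ f t).primal p| ≤ E)
    (hB : ∀ i, ∑ t ∈ Finset.range T,
      (f t).cons.transpose.mulVec (algRun S T δ f t).primal i ≤ B) :
    cumViolation S P T δ π₀ f ≤ B + E := by
  have : Nonempty (Fin m) := ⟨⟨0, hm⟩⟩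
  refine ciSup_le fun i => ?_
  have key : ∀ t ∈ Finset.range T, (f t).cons.transpose.mulVec (playedOcc S P T δ π₀ f t) i ≤
      (f t).cons.transpose.mulVec (algRun S T δ f t).primal i +
      ∑ p, |playedOcc S P T δ π₀ f t p - (algRun S T δ f t).primal p| := by
    intro t ht
    have h := (abs_le.1 (abs_dotProduct_le (u := fun p => (f t).cons p i)
      (v := playedOcc S P T δ π₀ f t - (algRun S T δ f t).primal) (c := 1)
      (fun p => abs_le.2 (hf.cons t (Finset.mem_range.1 ht) p i)))).2
    rw [dotProduct_sub, one_mul] at h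
    simp only [Pi.sub_apply] at h
    have e : ∀ q : X × A → ℝ, (f t).cons.transpose.mulVec q i =
      (fun p => (f t).cons p i) ⬝ᵥ q := fun q => rfl
    rw [e, e]
    linarith
  refine (Finset.sum_le_sum key).trans ?_
  rw [Finset.sum_add_distrib]
  exact add_le_add (hB i) hE

/-- A constant for the error of the transition probabilities. -/
def errQConst (L nX nA : ℕ) : ℝ :=
  6 * L * nX + 12 * L * nX * Real.sqrt (nA * (1 + Real.log (nX * nA)))

lemma errQConst_nonneg (L nX nA : ℕ) : 0 ≤ errQConst L nX nA := by
  unfold errQConst; positivity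

lemma errQ_le [Nonempty A] (hP : IsTransition S P) (hT : 1 ≤ T) (hδ : 0 < δ)
    (hδ4 : δ < 1 / 4) : errQ X A L T δ ≤ errQConst L (Fintype.card X) (Fintype.card A) *
      (((T : ℝ) ^ (1 / 4 : ℝ)) ^ 2 * Real.sqrt (Real.log ((T : ℝ) ^ 2 / δ))) := by
  have hlog := one_le_log hT hδ hδ4
  have hT1 : (1 : ℝ) ≤ T := by exact_mod_cast hT
  have hY : 1 ≤ (Fintype.card X : ℝ) * Fintype.card A := by
    have := card_mul_card_pos hP
    have : (0 : ℝ) ≤ L := Nat.cast_nonneg _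
    linarith
  have hlY : 0 ≤ Real.log ((Fintype.card X : ℝ) * Fintype.card A) := Real.log_nonneg hY
  have hTδ : (T : ℝ) ^ 2 / δ ≥ T / δ := by gcongr; nlinarith
  have hTδ' : (T : ℝ) / δ ≥ 1 / δ := by gcongr
  have hpos : 0 < 1 / δ := by positivity
  set lg := Real.log ((T : ℝ) ^ 2 / δ) with hlg
  have h1 : Real.log (1 / δ) ≤ lg := Real.log_le_log hpos (hTδ'.le.trans hTδ)
  -- The sum of logarithms becomes a product because `lg` ≥ 1; the second factor depends on |X| and
  -- |A| only.
  have h2 : Real.log ((T : ℝ) * Fintype.card X * Fintype.card A / δ) ≤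
      lg * (1 + Real.log ((Fintype.card X : ℝ) * Fintype.card A)) := by
    have e : (T : ℝ) * Fintype.card X * Fintype.card A / δ =
      (T / δ) * ((Fintype.card X : ℝ) * Fintype.card A) := by ring
    rw [e, Real.log_mul (by positivity) (by positivity)]
    have := Real.log_le_log (by positivity) hTδ
    nlinarith
  have e : Real.sqrt T = ((T : ℝ) ^ (1 / 4 : ℝ)) ^ 2 := (quarter_sq T).symm
  rw [← e, errQ, errQConst]
  have s2 := sqrt_two_le
  have a1 : Real.sqrt (2 * T * Real.log (1 / δ)) ≤ 1.5 * (Real.sqrt T * Real.sqrt lg) := by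
    calc _ ≤ Real.sqrt (2 * T * lg) := by gcongr
      _ = Real.sqrt 2 * (Real.sqrt T * Real.sqrt lg) := by
        rw [Real.sqrt_mul (by positivity), Real.sqrt_mul (by positivity)]; ring
      _ ≤ _ := by gcongr
  have a2 : Real.sqrt (2 * T * Fintype.card A *
      Real.log ((T : ℝ) * Fintype.card X * Fintype.card A / δ)) ≤
      2 * Real.sqrt (Fintype.card A * (1 + Real.log ((Fintype.card X : ℝ) * Fintype.card A))) *
        (Real.sqrt T * Real.sqrt lg) := by
    calc _ ≤ Real.sqrt (2 * T * Fintype.card A *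
          (lg * (1 + Real.log ((Fintype.card X : ℝ) * Fintype.card A)))) := by gcongr
      _ = Real.sqrt (2 * ((Fintype.card A *
          (1 + Real.log ((Fintype.card X : ℝ) * Fintype.card A))) * (T * lg))) := by
        congr 1; ring
      _ = Real.sqrt 2 * (Real.sqrt (Fintype.card A *
          (1 + Real.log ((Fintype.card X : ℝ) * Fintype.card A))) *
            (Real.sqrt T * Real.sqrt lg)) := by
        rw [Real.sqrt_mul (by positivity), Real.sqrt_mul (by positivity),
          Real.sqrt_mul (Nat.cast_nonneg T)]
      _ ≤ 2 * (Real.sqrt (Fintype.card A *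
          (1 + Real.log ((Fintype.card X : ℝ) * Fintype.card A))) *
            (Real.sqrt T * Real.sqrt lg)) := by gcongr; linarith
      _ = _ := by ring
  calc _ ≤ 4 * L * Fintype.card X * (1.5 * (Real.sqrt T * Real.sqrt lg)) +
      6 * L * Fintype.card X * (2 * Real.sqrt (Fintype.card A *
        (1 + Real.log ((Fintype.card X : ℝ) * Fintype.card A))) *
        (Real.sqrt T * Real.sqrt lg)) := by gcongr
    _ = _ := by ring

lemma errR_le (L : ℕ) (hT : 1 ≤ T) (hδ : 0 < δ) (hδ4 : δ < 1 / 4) :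
    errR L T δ ≤ L *
      (((T : ℝ) ^ (1 / 4 : ℝ)) ^ 2 * Real.sqrt (Real.log ((T : ℝ) ^ 2 / δ))) := by
  have hT1 : (1 : ℝ) ≤ T := by exact_mod_cast hT
  rw [quarter_sq, ← Real.sqrt_mul (Nat.cast_nonneg _)]
  -- The factor 2 is absorbed by the 1/√2 in `errR`.
  have h : Real.log (2 / δ) ≤ 2 * Real.log ((T : ℝ) ^ 2 / δ) := by
    have : (2 : ℝ) * Real.log ((T : ℝ) ^ 2 / δ) = Real.log (((T : ℝ) ^ 2 / δ) ^ 2) := by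
      rw [Real.log_pow]; norm_num
    rw [this]
    refine Real.log_le_log (by positivity) ?_
    have h1 : 2 ≤ (T : ℝ) ^ 2 / δ := by rw [le_div_iff₀ hδ]; nlinarith
    have h2 : 1 / δ ≤ (T : ℝ) ^ 2 / δ := by gcongr; nlinarith
    calc 2 / δ = 2 * (1 / δ) := by ring
      _ ≤ (T : ℝ) ^ 2 / δ * ((T : ℝ) ^ 2 / δ) := by gcongr
      _ = _ := by ring
  rw [errR]
  calc _ ≤ L / Real.sqrt 2 * Real.sqrt (2 * (T * Real.log ((T : ℝ) ^ 2 / δ))) := by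
        gcongr _ * Real.sqrt ?_
        nlinarith
    _ = _ := by
        rw [Real.sqrt_mul (by norm_num)]
        have : Real.sqrt 2 ≠ 0 := by positivity
        field_simp

/-- The constant in the final bounds. -/
def perfConst (m L nX nA : ℕ) : ℝ :=
  (L + 3 * m * L + m * errQConst L nX nA + L ^ 2 +
    (1 + m) * (5 * (nX * nA) + L + errQConst L nX nA)) +
  ((2 + 2 * L) * (100 * m * (nX * nA)) + errQConst L nX nA) + 1

/-- The whole deterministic argument. The reward error `Er` is a parameter so that both reward
models are covered: it is 0 for adversarial and `errR` for stochastic rewards. -/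
lemma performance [Nonempty A] (hm : 1 ≤ m) (hL : 1 ≤ L) (hP : IsTransition S P)
    (hT : 1 ≤ T) (hδ : 0 < δ) (hδ4 : δ < 1 / 4) (hf : RegularFeedback S T f)
    (hc : Concentrated S P T δ f) {π₀ : X → A → ℝ} (h₀ : IsPolicy π₀)
    {rbar : X × A → ℝ} {Gbar : Matrix (X × A) (Fin m) ℝ} {qstar : X × A → ℝ}
    (hq : IsOptimal S P rbar Gbar qstar)
    (hb : ∑ t ∈ Finset.range T, bonusDeviation S P T δ π₀ f t ≤
      L * Real.sqrt (2 * T * Real.log (1 / δ)))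
    (hG : ∑ t ∈ Finset.range T, consDeviation S T δ Gbar qstar f t ≤
      m * (T : ℝ) ^ (1 / 4 : ℝ) * errG L T δ)
    {Er : ℝ} (hEr : Er ≤ errR L T δ)
    (hr : ∑ t ∈ Finset.range T, (rbar - (f t).reward) ⬝ᵥ qstar ≤ Er) :
    cumRegret S P T δ π₀ rbar Gbar f ≤ Er + m * (T : ℝ) ^ (1 / 4 : ℝ) * errG L T δ
      + m * (T : ℝ) ^ (1 / 4 : ℝ) * errQ X A L T δ
      + dualRegret S T δ f 0 + primalRegret S P T δ π₀ f qstar ∧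
    cumViolation S P T δ π₀ f ≤ (2 + 2 * L) * (1 / dualRate X A m T δ) * (T : ℝ) ^ (1 / 4 : ℝ)
      + errQ X A L T δ ∧
    cumRegret S P T δ π₀ rbar Gbar f ≤ perfConst m L (Fintype.card X) (Fintype.card A) *
      Real.sqrt (Real.log ((T : ℝ) ^ 2 / δ)) * (T : ℝ) ^ (3 / 4 : ℝ) ∧
    cumViolation S P T δ π₀ f ≤ perfConst m L (Fintype.card X) (Fintype.card A) *
      Real.sqrt (Real.log ((T : ℝ) ^ 2 / δ)) * (T : ℝ) ^ (3 / 4 : ℝ) := by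
  have hδ1 : δ < 1 := by linarith
  have hE := sum_playedOcc_sub_primal_le_errQ hL hP hT hδ hδ1 hf.path hc h₀ hb
  have hR := regret_decomposition hf hq hE hG hr
  have hV := cumViolation_le (π₀ := π₀) hm hf hE fun i =>
    sum_cons_primal_le hm hL hP hT hδ hδ4 hf hc h₀ hq.1 hG i
  refine ⟨hR, hV, ?_⟩
  have eQ := errQ_le (X := X) (A := A) hP hT hδ hδ4
  have eR := errR_le L hT hδ hδ4
  have eG := errG_eq L T δ
  have eC := errQConst_nonneg L (Fintype.card X) (Fintype.card A)
  have eB := one_div_dualRate X A m T δ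
  have hY := card_mul_card_pos hP
  have hu := one_le_quarter hT
  have hu2 := quarter_sq T
  have hu4 := quarter_four T
  have hlog := one_le_log hT hδ hδ4
  have hl1 : 1 ≤ Real.sqrt (Real.log ((T : ℝ) ^ 2 / δ)) := Real.one_le_sqrt.2 hlog
  have hη : 0 < dualRate X A m T δ := by
    rw [← one_div_pos, eB]
    have : (0 : ℝ) < Fintype.card X * Fintype.card A := by
      have : (0 : ℝ) ≤ L := Nat.cast_nonneg _
      linarith
    have : (0 : ℝ) < m := by exact_mod_cast hm
    positivity
  have hD := dual_ogd hL hP hT hδ hδ1 hf h₀ hη (ν := 0) ⟨le_rfl, fun i => by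
    simp only [Pi.zero_apply]; positivity⟩
  have hO := primal_ogd hL hP hT hδ hδ1 hf hc hq.1.1
  -- Gradient descent controls the regret of q̂_t; passing to q_t costs the sup-norm of the loss
  -- times the ℓ₁ distance.
  have hPR : primalRegret S P T δ π₀ f qstar ≤
      (1 + m * (T : ℝ) ^ (1 / 4 : ℝ)) * Real.sqrt T *
        (5 * (Fintype.card X * Fintype.card A) + L / 10) +
      (1 + m * (T : ℝ) ^ (1 / 4 : ℝ)) * errQ X A L T δ := by
    refine le_trans ?_ (add_le_add hO
      (mul_le_mul_of_nonneg_left hE (by positivity)))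
    rw [primalRegret, Finset.mul_sum, ← Finset.sum_add_distrib]
    refine Finset.sum_le_sum fun t ht => ?_
    have h := (abs_le.1 (abs_dotProduct_le
      (v := playedOcc S P T δ π₀ f t - (algRun S T δ f t).primal)
      (fun p => (norm_le_pi_norm _ p).trans
        (hf.norm_loss_le (δ := δ) (Finset.mem_range.1 ht))))).2
    have e : playedOcc S P T δ π₀ f t - qstar = ((algRun S T δ f t).primal - qstar) +
      (playedOcc S P T δ π₀ f t - (algRun S T δ f t).primal) := by abel
    rw [e, dotProduct_add]
    exact add_le_add le_rfl h
  rw [← quarter_cube T]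
  rw [← hu2] at hPR
  set u := (T : ℝ) ^ (1 / 4 : ℝ) with hudef
  set l := Real.sqrt (Real.log ((T : ℝ) ^ 2 / δ)) with hl
  set Y : ℝ := Fintype.card X * Fintype.card A with hYdef
  set C := errQConst L (Fintype.card X) (Fintype.card A) with hC
  have hL1 : (1 : ℝ) ≤ L := by exact_mod_cast hL
  have hm1 : (1 : ℝ) ≤ m := by exact_mod_cast hm
  have hY0 : 0 < Y := by linarith
  have hηB := mul_one_div_cancel hη.ne'
  rw [eB] at hηB
  simp only [Pi.zero_apply, ne_eq, OfNat.ofNat_ne_zero, not_false_eq_true, zero_pow,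
    Finset.sum_const_zero, mul_zero, zero_add] at hD
  rw [← hu4] at hD
  have hA := regret_arith hu hl1 hL1 hm1 (by linarith) eC hη hηB (hEr.trans eR) eG eQ hD hPR
  set C₁ : ℝ := L + 3 * m * L + m * C + L ^ 2 + (1 + m) * (5 * Y + L + C) with hC₁
  set C₂ : ℝ := (2 + 2 * L) * (100 * m * Y) + C with hC₂
  have hperf : perfConst m L (Fintype.card X) (Fintype.card A) * l * u ^ 3 =
      C₁ * (l * u ^ 3) + C₂ * (l * u ^ 3) + l * u ^ 3 := by
    rw [perfConst, ← hC, ← hYdef, ← hC₁, ← hC₂]; ring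
  have hW0 : 0 ≤ l * u ^ 3 := by positivity
  have p1 : 0 ≤ C₁ * (l * u ^ 3) := by positivity
  have p2 : 0 ≤ C₂ * (l * u ^ 3) := by positivity
  rw [hperf]
  constructor
  · linarith
  · have hQ : errQ X A L T δ ≤ C * (l * u ^ 3) := eQ.trans (by
      rw [mul_comm (u ^ 2)]
      have : u ^ 2 ≤ u ^ 3 := pow_le_pow_right₀ hu (by norm_num)
      gcongr)
    have b7 : (2 + 2 * (L : ℝ)) * (1 / dualRate X A m T δ) * u + C * (l * u ^ 3) =
        C₂ * (l * u ^ 3) := by rw [eB, hC₂]; ring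
    linarith

lemma perfConst_pos (m L nX nA : ℕ) : 0 < perfConst m L nX nA := by
  have := errQConst_nonneg L nX nA
  unfold perfConst
  positivity

end

/-! ### Measurability with respect to the history -/

/-- The confidence sets vary with ω but depend on it only through the finitely many possible path
histories. Freezing them on each piece reduces measurability to a fixed set. -/
lemma measurable_glue {Ω β γ : Type*} [Finite γ] {mΩ : MeasurableSpace Ω} [MeasurableSpace β]
    {h : Ω → γ} (hh : ∀ c, MeasurableSet (h ⁻¹' {c})) {Φ : Ω → β}
    (hΦ : ∀ ω₀, ∃ Φ' : Ω → β, Measurable Φ' ∧ ∀ ω, h ω = h ω₀ → Φ ω = Φ' ω) : Measurable Φ := by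
  intro B hB
  choose Φ' hm heq using hΦ
  have key : Φ ⁻¹' B = ⋃ c : Set.range h, h ⁻¹' {(c : γ)} ∩ Φ' c.2.choose ⁻¹' B := by
    ext ω
    simp only [Set.mem_preimage, Set.mem_iUnion, Set.mem_inter_iff, Set.mem_singleton_iff]
    constructor
    · intro hω
      have hc : h ω ∈ Set.range h := ⟨ω, rfl⟩
      refine ⟨⟨h ω, hc⟩, rfl, ?_⟩
      rw [← heq _ ω hc.choose_spec.symm]
      exact hω
    · rintro ⟨⟨c, hc⟩, h1, h2⟩
      rw [heq hc.choose ω (h1.trans hc.choose_spec.symm)]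
      exact h2
  rw [key]
  exact MeasurableSet.iUnion fun c => (hh c).inter (hm _ hB)

section
variable {X A Ω : Type*} [Fintype X] [Fintype A] [mΩ : MeasurableSpace Ω] {L m : ℕ}
  {S : LayeredSpace X L} {P : X → A → X → ℝ} {T : ℕ} {δ : ℝ} {π₀ : X → A → ℝ}
  {D : ℕ → Measure ((X × A → ℝ) × Matrix (X × A) (Fin m) ℝ)}
  {F : ℕ → Ω → Feedback X A L m} {μ : Measure Ω}

lemma historyBefore_mono (F : ℕ → Ω → Feedback X A L m) {s t : ℕ} (h : s ≤ t) :
    historyBefore F s ≤ historyBefore F t :=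
  iSup_mono fun _ => iSup_mono' fun hr => ⟨hr.trans_le h, le_rfl⟩

lemma le_historyBefore (F : ℕ → Ω → Feedback X A L m) {s t : ℕ} (h : s < t) :
    MeasurableSpace.comap (fun ω => (F s ω).path) ⊤ ⊔
    MeasurableSpace.comap (fun ω => (F s ω).reward) inferInstance ⊔
    MeasurableSpace.comap (fun ω => (F s ω).cons) inferInstance ≤ historyBefore F t :=
  le_iSup₂_of_le s h le_rfl

lemma measurableSet_path (F : ℕ → Ω → Feedback X A L m) {s t : ℕ} (h : s < t)
    (B : Set (Trajectory X A L)) :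
    MeasurableSet[historyBefore F t] ((fun ω => (F s ω).path) ⁻¹' B) :=
  le_historyBefore F h _ ((le_sup_left.trans le_sup_left :
    MeasurableSpace.comap (fun ω => (F s ω).path) ⊤ ≤ _) _ ⟨B, trivial, rfl⟩)

lemma measurable_reward (F : ℕ → Ω → Feedback X A L m) {s t : ℕ} (h : s < t) :
    Measurable[historyBefore F t] fun ω => (F s ω).reward := fun B hB =>
  le_historyBefore F h _ ((le_sup_right.trans le_sup_left :
    MeasurableSpace.comap (fun ω => (F s ω).reward) inferInstance ≤ _) _ ⟨B, hB, rfl⟩)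

lemma measurable_cons (F : ℕ → Ω → Feedback X A L m) {s t : ℕ} (h : s < t) :
    Measurable[historyBefore F t] fun ω => (F s ω).cons := fun B hB =>
  le_historyBefore F h _ ((le_sup_right :
    MeasurableSpace.comap (fun ω => (F s ω).cons) inferInstance ≤ _) _ ⟨B, hB, rfl⟩)

lemma IsInteraction.measurableSet_path (hI : IsInteraction S P T δ π₀ D F μ) {t : ℕ} (ht : t < T)
    (B : Set (Trajectory X A L)) : MeasurableSet ((fun ω => (F t ω).path) ⁻¹' B) := by
  have : (fun ω => (F t ω).path) ⁻¹' B = ⋃ τ : B, {ω | (F t ω).path = τ} := by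
    ext ω; simp
  rw [this]
  exact MeasurableSet.iUnion fun τ => hI.measurable_path t ht τ

lemma IsInteraction.historyBefore_le (hI : IsInteraction S P T δ π₀ D F μ) {t : ℕ}
    (ht : t ≤ T) : historyBefore F t ≤ mΩ := by
  refine iSup₂_le fun s hs => sup_le (sup_le ?_ ?_) ?_
  · rintro _ ⟨B, -, rfl⟩
    exact hI.measurableSet_path (hs.trans_le ht) B
  · exact (hI.measurable_reward s (hs.trans_le ht)).comap_le
  · exact (hI.measurable_cons s (hs.trans_le ht)).comap_le

/-- The trajectories of the first `t` episodes. -/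
def pathHist (f : ℕ → Feedback X A L m) (t : ℕ) : Fin t → Trajectory X A L :=
  fun s => (f s).path

lemma measurableSet_pathHist (F : ℕ → Ω → Feedback X A L m) (t : ℕ)
    (c : Fin t → Trajectory X A L) : MeasurableSet[historyBefore F t]
      ((fun ω => pathHist (fun s => F s ω) t) ⁻¹' {c}) := by
  have : (fun ω => pathHist (fun s => F s ω) t) ⁻¹' {c} =
      ⋂ s : Fin t, (fun ω => (F s ω).path) ⁻¹' {c s} := by
    ext ω
    simp [pathHist, funext_iff]
  rw [this]
  exact MeasurableSet.iInter fun s => measurableSet_path F s.2 _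

/-- Counters, epochs and confidence sets are driven by the trajectories alone; rewards and
constraints enter only the iterates. -/
lemma algRun_congr {f g : ℕ → Feedback X A L m} {t : ℕ} (h : ∀ s < t, (f s).path = (g s).path) :
    (algRun S T δ f t).cnt = (algRun S T δ g t).cnt ∧
    (algRun S T δ f t).cntNext = (algRun S T δ g t).cntNext ∧
    (algRun S T δ f t).epochCnt = (algRun S T δ g t).epochCnt ∧
    (algRun S T δ f t).conf = (algRun S T δ g t).conf := by
  classical
  induction t with
  | zero => exact ⟨rfl, rfl, rfl, rfl⟩
  | succ t ih =>
    obtain ⟨h1, h2, h3, h4⟩ := ih fun s hs => h s (by omega)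
    have hp := h t (by omega)
    have e1 : (algRun S T δ f (t + 1)).cnt = (algRun S T δ g (t + 1)).cnt := by
      funext x a; rw [cnt_succ, cnt_succ, h1, hp]
    have e2 : (algRun S T δ f (t + 1)).cntNext = (algRun S T δ g (t + 1)).cntNext := by
      funext x a x'; rw [cntNext_succ, cntNext_succ, h2, hp]
    have e3 : NewEpoch (algRun S T δ f t) (f t).path ↔ NewEpoch (algRun S T δ g t) (g t).path := by
      unfold NewEpoch; rw [h1, h3, hp]
    refine ⟨e1, e2, ?_, ?_⟩
    · rw [epochCnt_succ, epochCnt_succ, e1, h3]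
      exact if_congr e3 rfl rfl
    · rw [conf_succ, conf_succ, e1, e2, h4]
      exact if_congr e3 rfl rfl

lemma algRun_congr_pathHist {f g : ℕ → Feedback X A L m} {t : ℕ}
    (h : pathHist f t = pathHist g t) :
    (algRun S T δ f t).cnt = (algRun S T δ g t).cnt ∧
    (algRun S T δ f t).cntNext = (algRun S T δ g t).cntNext ∧
    (algRun S T δ f t).epochCnt = (algRun S T δ g t).epochCnt ∧
    (algRun S T δ f t).conf = (algRun S T δ g t).conf :=
  algRun_congr fun s hs => congrFun h ⟨s, hs⟩

lemma measurable_cnt (F : ℕ → Ω → Feedback X A L m) (t : ℕ) (x : X) (a : A) :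
    Measurable[historyBefore F t] fun ω => (algRun S T δ (fun s => F s ω) t).cnt x a :=
  @measurable_glue _ _ _ _ (historyBefore F t) _ _ (measurableSet_pathHist F t) _ fun ω₀ =>
    ⟨fun _ => (algRun S T δ (fun s => F s ω₀) t).cnt x a, @measurable_const _ _ _ (_) _,
      fun ω h => by rw [(algRun_congr_pathHist h).1]⟩

lemma measurable_confBonus (F : ℕ → Ω → Feedback X A L m) (t : ℕ) (x : X) (a : A) :
    Measurable[historyBefore F t] fun ω => confBonus S T δ (fun s => F s ω) t x a :=
  @measurable_glue _ _ _ _ (historyBefore F t) _ _ (measurableSet_pathHist F t) _ fun ω₀ =>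
    ⟨fun _ => confBonus S T δ (fun s => F s ω₀) t x a, @measurable_const _ _ _ (_) _,
      fun ω h => by unfold confBonus; rw [(algRun_congr_pathHist h).2.2.1]⟩

lemma measurable_mulVec_entries {ι κ : Type*} [Fintype ι] [Fintype κ] :
    Measurable fun p : Matrix ι κ ℝ × (κ → ℝ) => p.1.mulVec p.2 := by
  refine measurable_pi_lambda _ fun i => ?_
  refine Finset.measurable_sum _ fun j _ => ?_
  have h1 : Measurable fun p : Matrix ι κ ℝ × (κ → ℝ) => p.1 i j :=
    (measurable_pi_apply j).comp ((measurable_pi_apply i).comp measurable_fst)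
  have h2 : Measurable fun p : Matrix ι κ ℝ × (κ → ℝ) => p.2 j :=
    (measurable_pi_apply j).comp measurable_snd
  exact h1.mul h2

lemma measurable_transpose_mulVec {ι κ : Type*} [Fintype ι] [Fintype κ] :
    Measurable fun p : Matrix ι κ ℝ × (ι → ℝ) => p.1.transpose.mulVec p.2 := by
  refine measurable_pi_lambda _ fun i => ?_
  refine Finset.measurable_sum _ fun j _ => ?_
  have h1 : Measurable fun p : Matrix ι κ ℝ × (ι → ℝ) => p.1 j i :=
    (measurable_pi_apply i).comp ((measurable_pi_apply j).comp measurable_fst)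
  have h2 : Measurable fun p : Matrix ι κ ℝ × (ι → ℝ) => p.2 j :=
    (measurable_pi_apply j).comp measurable_snd
  exact h1.mul h2

lemma measurable_iterates (S : LayeredSpace X L) (T : ℕ) (δ : ℝ) (F : ℕ → Ω → Feedback X A L m)
    (t : ℕ) :
    Measurable[historyBefore F t] (fun ω => (algRun S T δ (fun s => F s ω) t).primal) ∧
    Measurable[historyBefore F t] (fun ω => (algRun S T δ (fun s => F s ω) t).dual) ∧
    Measurable[historyBefore F t] (fun ω => (algRun S T δ (fun s => F s ω) t).lossMax) := by
  induction t with
  | zero => exact ⟨@measurable_const _ _ _ (_) _, @measurable_const _ _ _ (_) _,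
      @measurable_const _ _ _ (_) _⟩
  | succ t ih =>
    obtain ⟨h1, h2, h3⟩ := ih
    have h1 := h1.mono (historyBefore_mono F t.le_succ) le_rfl
    have h2 := h2.mono (historyBefore_mono F t.le_succ) le_rfl
    have h3 := h3.mono (historyBefore_mono F t.le_succ) le_rfl
    have hr := measurable_reward F t.lt_succ_self
    have hc := measurable_cons F t.lt_succ_self
    have hloss : Measurable[historyBefore F (t + 1)]
        fun ω => (algRun S T δ (fun s => F s ω) t).loss (F t ω) :=
      (measurable_mulVec_entries.comp (hc.prodMk h2)).sub hr
    have hmax : Measurable[historyBefore F (t + 1)]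
        fun ω => (algRun S T δ (fun s => F s ω) (t + 1)).lossMax :=
      h3.max (measurable_norm.comp hloss)
    refine ⟨?_, ?_, hmax⟩
    -- On a fixed path history the projection is onto the fixed set belonging to ω₀, which is a
    -- measurable map.
    · refine @measurable_glue _ _ _ _ (historyBefore F (t + 1)) _ _
        (measurableSet_pathHist F (t + 1)) _ fun ω₀ =>
        ⟨fun ω => euclProj (occSet S (algRun S T δ (fun s => F s ω₀) (t + 1)).conf)
          ((algRun S T δ (fun s => F s ω) t).primal -
          (1 / ((algRun S T δ (fun s => F s ω) (t + 1)).lossMax * constC X A L * Real.sqrt T)) •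
            (algRun S T δ (fun s => F s ω) t).loss (F t ω)), ?_, ?_⟩
      · have hK := rowConvex_conf (S := S) (T := T) (δ := δ) (f := fun s => F s ω₀) (t + 1)
        refine (measurable_euclProj hK.isCompact_occSet hK.convex_occSet).comp (h1.sub ?_)
        have hrate : Measurable fun x : ℝ => 1 / (x * constC X A L * Real.sqrt T) := by fun_prop
        exact (hrate.comp hmax).smul hloss
      · intro ω h
        rw [primal_succ, (algRun_congr_pathHist h).2.2.2]
    · have hbox := measurable_euclProj (K := Set.Icc (0 : Fin m → ℝ)
        fun _ => (T : ℝ) ^ (1 / 4 : ℝ)) isCompact_Icc (convex_Icc _ _)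
      have hg := measurable_transpose_mulVec.comp (hc.prodMk h1)
      exact hbox.comp (h2.add (hg.const_smul (dualRate X A m T δ)))

lemma measurable_inducedPolicy (π₀ : X → A → ℝ) : Measurable (inducedPolicy π₀) := by
  refine measurable_pi_lambda _ fun x => measurable_pi_lambda _ fun a => ?_
  unfold inducedPolicy
  refine Measurable.ite (measurableSet_eq_fun (by fun_prop) (by fun_prop)) (by fun_prop) ?_
  fun_prop

lemma measurable_playedPolicy (S : LayeredSpace X L) (T : ℕ) (δ : ℝ) (π₀ : X → A → ℝ)
    (F : ℕ → Ω → Feedback X A L m) (t : ℕ) :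
    Measurable[historyBefore F t] fun ω => playedPolicy S T δ π₀ (fun s => F s ω) t :=
  (measurable_inducedPolicy π₀).comp (measurable_iterates S T δ F t).1

lemma measurable_trajProb (S : LayeredSpace X L) (P : X → A → X → ℝ) (T : ℕ) (δ : ℝ)
    (π₀ : X → A → ℝ) (F : ℕ → Ω → Feedback X A L m) (t : ℕ) (τ : Trajectory X A L) :
    Measurable[historyBefore F t]
      fun ω => trajProb S P (playedPolicy S T δ π₀ (fun s => F s ω) t) τ := by
  have h : Measurable fun π : X → A → ℝ => trajProb S P π τ :=
    ((continuous_trajProb S τ).comp (by fun_prop : Continuous fun π : X → A → ℝ =>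
      (P, π))).measurable
  exact h.comp (measurable_playedPolicy S T δ π₀ F t)

lemma measurable_playedOcc (S : LayeredSpace X L) (P : X → A → X → ℝ) (T : ℕ) (δ : ℝ)
    (π₀ : X → A → ℝ) (F : ℕ → Ω → Feedback X A L m) (t : ℕ) :
    Measurable[historyBefore F t] fun ω => playedOcc S P T δ π₀ (fun s => F s ω) t := by
  have h : Measurable fun π : X → A → ℝ => occ S P π :=
    ((continuous_occ S).comp (by fun_prop : Continuous fun π : X → A → ℝ => (P, π))).measurable
  exact h.comp (measurable_playedPolicy S T δ π₀ F t)

lemma measurable_of_path (F : ℕ → Ω → Feedback X A L m) {β : Type*} [MeasurableSpace β] (t : ℕ)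
    {φ : Ω → Trajectory X A L → β} (hφ : ∀ τ, Measurable[historyBefore F t] fun ω => φ ω τ) :
    Measurable[historyBefore F (t + 1)] fun ω => φ ω (F t ω).path :=
  @measurable_glue _ _ _ _ (historyBefore F (t + 1)) _ _
    (fun c => measurableSet_path F t.lt_succ_self {c}) _ fun ω₀ =>
    ⟨fun ω => φ ω (F t ω₀).path, (hφ _).mono (historyBefore_mono F t.le_succ) le_rfl,
      fun ω h => by rw [h]⟩

end

/-! ### Consequences of the law of the interaction -/

section
variable {X A Ω : Type*} [Fintype X] [Fintype A] [mΩ : MeasurableSpace Ω] {L m : ℕ}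
  {S : LayeredSpace X L} {P : X → A → X → ℝ} {T : ℕ} {δ : ℝ} {π₀ : X → A → ℝ}
  {D : ℕ → Measure ((X × A → ℝ) × Matrix (X × A) (Fin m) ℝ)}
  {F : ℕ → Ω → Feedback X A L m} {μ : Measure Ω}

/-- The law is given for events of the history. Read as an equality of two measures on the history
σ-algebra, it extends to all history-measurable integrands. -/
lemma IsInteraction.setLIntegral_path [IsFiniteMeasure μ] (hI : IsInteraction S P T δ π₀ D F μ)
    (hD : ∀ t < T, IsProbabilityMeasure (D t)) {t : ℕ} (ht : t < T) (τ : Trajectory X A L)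
    {Z : Ω → ENNReal} (hZ : Measurable[historyBefore F t] Z) :
    ∫⁻ ω in {ω | (F t ω).path = τ}, Z ω ∂μ =
      ∫⁻ ω, ENNReal.ofReal (trajProb S P (playedPolicy S T δ π₀ (fun s => F s ω) t) τ) * Z ω
        ∂μ := by
  have hle := hI.historyBefore_le ht.le
  have hp := (measurable_trajProb S P T δ π₀ F t τ).ennreal_ofReal
  have := hD t ht
  have key : (μ.restrict {ω | (F t ω).path = τ}).trim hle =
      (μ.withDensity fun ω => ENNReal.ofReal
        (trajProb S P (playedPolicy S T δ π₀ (fun s => F s ω) t) τ)).trim hle := by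
    refine @Measure.ext _ (historyBefore F t) _ _ fun H hH => ?_
    rw [trim_measurableSet_eq hle hH, trim_measurableSet_eq hle hH,
      Measure.restrict_apply (hle _ hH), withDensity_apply _ (hle _ hH)]
    have := hI.law t ht H hH Set.univ MeasurableSet.univ τ
    simpa using this
  rw [← lintegral_trim hle hZ, key, lintegral_trim hle hZ,
    lintegral_withDensity_eq_lintegral_mul _ (hp.mono hle le_rfl) (hZ.mono hle le_rfl)]
  rfl

/-- Paths that break the layers have weight 0 whatever is played. It is therefore available before
the played policies are known to be policies, a fact that itself relies on it. -/
lemma IsInteraction.ae_layeredPath [IsFiniteMeasure μ] (hI : IsInteraction S P T δ π₀ D F μ)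
    (hD : ∀ t < T, IsProbabilityMeasure (D t)) (hP : IsTransition S P) :
    ∀ᵐ ω ∂μ, ∀ t < T, LayeredPath S (F t ω).path := by
  rw [ae_all_iff]
  intro t
  by_cases ht : t < T
  swap
  · exact Filter.Eventually.of_forall fun ω h => absurd h ht
  have h1 : ∀ᵐ ω ∂μ, ∀ τ : Trajectory X A L, ¬ LayeredPath S τ → (F t ω).path ≠ τ := by
    rw [ae_all_iff]
    intro τ
    by_cases hτ : LayeredPath S τ
    · exact Filter.Eventually.of_forall fun ω h => absurd hτ h
    · have h := hI.setLIntegral_path hD ht τ (Z := 1) (@measurable_const _ _ _ (_) _)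
      simp only [trajProb_eq_zero hP _ hτ, Pi.one_apply, ENNReal.ofReal_zero, zero_mul,
        lintegral_zero, setLIntegral_one] at h
      have h' : ∀ᵐ ω ∂μ, (F t ω).path ≠ τ := by
        rw [ae_iff]; simpa using h
      filter_upwards [h'] with ω hω _ using hω
  filter_upwards [h1] with ω hω _
  by_contra hcon
  exact hω _ hcon rfl

/-- The reward vector and the constraint matrix of an episode. -/
def feedbackPair (F : ℕ → Ω → Feedback X A L m) (t : ℕ) (ω : Ω) :
    (X × A → ℝ) × Matrix (X × A) (Fin m) ℝ := ((F t ω).reward, (F t ω).cons)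

lemma IsInteraction.measurable_feedbackPair (hI : IsInteraction S P T δ π₀ D F μ) {t : ℕ}
    (ht : t < T) : Measurable (feedbackPair F t) :=
  (hI.measurable_reward t ht).prodMk (hI.measurable_cons t ht)

/-- Sum the law over all trajectories; their probabilities add up to one. This is the independence
of the pair from the history. -/
lemma IsInteraction.measure_inter_feedbackPair
    (hI : IsInteraction S P T δ π₀ D F μ) (hP : IsTransition S P)
    {t : ℕ} (ht : t < T)
    (hπ : ∀ᵐ ω ∂μ, IsPolicy (playedPolicy S T δ π₀ (fun s => F s ω) t)) {H : Set Ω}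
    (hH : MeasurableSet[historyBefore F t] H)
    {B : Set ((X × A → ℝ) × Matrix (X × A) (Fin m) ℝ)} (hB : MeasurableSet B) :
    μ (H ∩ feedbackPair F t ⁻¹' B) = μ H * D t B := by
  classical
  have hle := hI.historyBefore_le ht.le
  have hHB : MeasurableSet (H ∩ feedbackPair F t ⁻¹' B) :=
    (hle _ hH).inter (hI.measurable_feedbackPair ht hB)
  have h1 : H ∩ feedbackPair F t ⁻¹' B = ⋃ τ ∈ (Finset.univ : Finset (Trajectory X A L)),
      (H ∩ {ω | ((F t ω).reward, (F t ω).cons) ∈ B ∧ (F t ω).path = τ}) := by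
    ext ω
    simp [feedbackPair]
  have h2 : ∀ τ : Trajectory X A L,
      μ (H ∩ {ω | ((F t ω).reward, (F t ω).cons) ∈ B ∧ (F t ω).path = τ}) =
      D t B * ∫⁻ ω in H, ENNReal.ofReal
        (trajProb S P (playedPolicy S T δ π₀ (fun s => F s ω) t) τ) ∂μ := by
    intro τ
    rw [hI.law t ht H hH B hB τ, lintegral_const_mul _
      ((measurable_trajProb S P T δ π₀ F t τ).ennreal_ofReal.mono hle le_rfl)]
  rw [h1, measure_biUnion_finset]
  · simp only [h2]
    rw [← Finset.mul_sum, ← lintegral_finsetSum _ fun τ _ =>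
      ((measurable_trajProb S P T δ π₀ F t τ).ennreal_ofReal.mono hle le_rfl), mul_comm]
    congr 1
    rw [← setLIntegral_one]
    refine lintegral_congr_ae (ae_restrict_of_ae ?_)
    filter_upwards [hπ] with ω hω
    rw [← ENNReal.ofReal_sum_of_nonneg fun τ _ => trajProb_nonneg hP hω τ, trajProb_sum hP hω,
      ENNReal.ofReal_one]
  · intro τ _ τ' _ hne
    refine Set.disjoint_left.2 fun ω h h' => hne ?_
    exact h.2.2.symm.trans h'.2.2
  · intro τ _
    have : H ∩ {ω | ((F t ω).reward, (F t ω).cons) ∈ B ∧ (F t ω).path = τ} =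
        (H ∩ feedbackPair F t ⁻¹' B) ∩ {ω | (F t ω).path = τ} := by
      ext ω; simp [feedbackPair, and_assoc]
    rw [this]
    exact hHB.inter (hI.measurable_path t ht τ)

lemma IsInteraction.map_feedbackPair [IsProbabilityMeasure μ]
    (hI : IsInteraction S P T δ π₀ D F μ) (hP : IsTransition S P)
    {t : ℕ} (ht : t < T)
    (hπ : ∀ᵐ ω ∂μ, IsPolicy (playedPolicy S T δ π₀ (fun s => F s ω) t)) :
    μ.map (feedbackPair F t) = D t := by
  refine Measure.ext fun B hB => ?_
  rw [Measure.map_apply (hI.measurable_feedbackPair ht) hB]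
  have := hI.measure_inter_feedbackPair hP ht hπ (@MeasurableSet.univ _ (_)) hB
  simpa using this

/-! ### Exponential supermartingales -/

/-- `D` is the increment in episode `t` of the logarithm of a supermartingale. -/
def SuperStep (μ : Measure Ω) (F : ℕ → Ω → Feedback X A L m) (t : ℕ) (d : Ω → ℝ) : Prop :=
  Measurable[historyBefore F (t + 1)] d ∧
  ∀ Z : Ω → ENNReal, Measurable[historyBefore F t] Z →
    ∫⁻ ω, Z ω * ENNReal.ofReal (Real.exp (d ω)) ∂μ ≤ ∫⁻ ω, Z ω ∂μ

/-- By induction, with the exponential of the past as `Z`, the exponential of the sum has mean at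
most 1; Markov's inequality does the rest. -/
lemma IsInteraction.measure_le_exp [IsProbabilityMeasure μ] (hI : IsInteraction S P T δ π₀ D F μ)
    {d : ℕ → Ω → ℝ} (hd : ∀ t < T, SuperStep μ F t (d t)) (a : ℝ) :
    μ {ω | a ≤ ∑ t ∈ Finset.range T, d t ω} ≤ ENNReal.ofReal (Real.exp (-a)) := by
  have key : ∀ n ≤ T, Measurable[historyBefore F n] (fun ω => ∑ t ∈ Finset.range n, d t ω) ∧
      ∫⁻ ω, ENNReal.ofReal (Real.exp (∑ t ∈ Finset.range n, d t ω)) ∂μ ≤ 1 := by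
    intro n
    induction n with
    | zero =>
      intro _
      simp only [Finset.range_zero, Finset.sum_empty, Real.exp_zero, ENNReal.ofReal_one,
        lintegral_one, measure_univ, le_refl, and_true]
      exact @measurable_const _ _ _ (_) _
    | succ n ih =>
      intro hn
      obtain ⟨h1, h2⟩ := ih (by omega)
      obtain ⟨g1, g2⟩ := hd n (by omega)
      simp only [Finset.sum_range_succ]
      refine ⟨(h1.mono (historyBefore_mono F n.le_succ) le_rfl).add g1, le_trans ?_ h2⟩
      refine le_trans (le_of_eq ?_) (g2 _ (h1.exp.ennreal_ofReal))
      refine lintegral_congr fun ω => ?_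
      rw [Real.exp_add, ENNReal.ofReal_mul (Real.exp_pos _).le]
  obtain ⟨h1, h2⟩ := key T le_rfl
  have hm : Measurable fun ω => ENNReal.ofReal (Real.exp (∑ t ∈ Finset.range T, d t ω)) :=
    (h1.mono (hI.historyBefore_le le_rfl) le_rfl).exp.ennreal_ofReal
  have h3 := (mul_meas_ge_le_lintegral hm (ENNReal.ofReal (Real.exp a))).trans h2
  have hpos : ENNReal.ofReal (Real.exp a) ≠ 0 := by
    rw [Ne, ENNReal.ofReal_eq_zero, not_le]; exact Real.exp_pos _
  have h4 : {ω | a ≤ ∑ t ∈ Finset.range T, d t ω} =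
      {ω | ENNReal.ofReal (Real.exp a) ≤
        ENNReal.ofReal (Real.exp (∑ t ∈ Finset.range T, d t ω))} := by
    ext ω
    rw [Set.mem_ofPred_eq, Set.mem_ofPred_eq, ENNReal.ofReal_le_ofReal_iff (Real.exp_pos _).le,
      Real.exp_le_exp]
  rw [h4, Real.exp_neg, ENNReal.ofReal_inv_of_pos (Real.exp_pos _)]
  rw [ENNReal.le_inv_iff_mul_le, mul_comm]
  exact h3

/-- Decompose by the realized trajectory and replace each indicator by its conditional probability;
`hle` then applies pointwise. -/
lemma IsInteraction.superStep_path [IsProbabilityMeasure μ]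
    (hI : IsInteraction S P T δ π₀ D F μ)
    (hD : ∀ t < T, IsProbabilityMeasure (D t)) (hP : IsTransition S P) {t : ℕ} (ht : t < T)
    (hπ : ∀ᵐ ω ∂μ, IsPolicy (playedPolicy S T δ π₀ (fun s => F s ω) t))
    {φ : Ω → Trajectory X A L → ℝ} (hφ : ∀ τ, Measurable[historyBefore F t] fun ω => φ ω τ)
    (hle : ∀ᵐ ω ∂μ, ∑ τ, trajProb S P (playedPolicy S T δ π₀ (fun s => F s ω) t) τ *
      Real.exp (φ ω τ) ≤ 1) :
    SuperStep μ F t fun ω => φ ω (F t ω).path := by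
  classical
  refine ⟨measurable_of_path F t hφ, fun Z hZ => ?_⟩
  have hh := hI.historyBefore_le ht.le
  have hG : ∀ τ, Measurable[historyBefore F t]
      fun ω => Z ω * ENNReal.ofReal (Real.exp (φ ω τ)) := fun τ =>
    hZ.mul (hφ τ).exp.ennreal_ofReal
  have h1 : ∀ ω, Z ω * ENNReal.ofReal (Real.exp (φ ω (F t ω).path)) =
      ∑ τ, Set.indicator {ω | (F t ω).path = τ}
        (fun ω => Z ω * ENNReal.ofReal (Real.exp (φ ω τ))) ω := by
    intro ω
    rw [Finset.sum_eq_single (F t ω).path]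
    · simp [Set.indicator]
    · intro τ _ hτ
      simp [Set.indicator, hτ.symm]
    · simp
  simp only [h1]
  rw [lintegral_finsetSum _ fun τ _ => ((hG τ).mono hh le_rfl).indicator
    (hI.measurable_path t ht τ)]
  have h2 : ∀ τ, ∫⁻ ω, Set.indicator {ω | (F t ω).path = τ}
        (fun ω => Z ω * ENNReal.ofReal (Real.exp (φ ω τ))) ω ∂μ =
      ∫⁻ ω, ENNReal.ofReal (trajProb S P (playedPolicy S T δ π₀ (fun s => F s ω) t) τ) *
        (Z ω * ENNReal.ofReal (Real.exp (φ ω τ))) ∂μ := fun τ => by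
    rw [lintegral_indicator (hI.measurable_path t ht τ), hI.setLIntegral_path hD ht τ (hG τ)]
  simp only [h2]
  have hW : ∀ τ, Measurable[historyBefore F t] fun ω =>
      ENNReal.ofReal (trajProb S P (playedPolicy S T δ π₀ (fun s => F s ω) t) τ) *
        (Z ω * ENNReal.ofReal (Real.exp (φ ω τ))) := fun τ =>
    (measurable_trajProb S P T δ π₀ F t τ).ennreal_ofReal.mul (hG τ)
  rw [← lintegral_finsetSum _ fun τ _ => (hW τ).mono hh le_rfl]
  refine lintegral_mono_ae ?_
  filter_upwards [hπ, hle] with ω hω h3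
  calc _ = Z ω * ∑ τ, ENNReal.ofReal
        (trajProb S P (playedPolicy S T δ π₀ (fun s => F s ω) t) τ * Real.exp (φ ω τ)) := by
        rw [Finset.mul_sum]
        refine Finset.sum_congr rfl fun τ _ => ?_
        rw [ENNReal.ofReal_mul (trajProb_nonneg hP hω τ)]
        ring
    _ = Z ω * ENNReal.ofReal (∑ τ,
        trajProb S P (playedPolicy S T δ π₀ (fun s => F s ω) t) τ * Real.exp (φ ω τ)) := by
        rw [ENNReal.ofReal_sum_of_nonneg fun τ _ =>
          mul_nonneg (trajProb_nonneg hP hω τ) (Real.exp_pos _).le]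
    _ ≤ Z ω * 1 := by
        gcongr
        rw [← ENNReal.ofReal_one]
        exact ENNReal.ofReal_le_ofReal h3
    _ = Z ω := mul_one _

/-- `lam` carries what the increment uses of the history, such as λ_t. Together with `Z` it is
independent of the pair, so Tonelli's theorem reduces the claim to `hle` for frozen `lam`. -/
lemma IsInteraction.superStep_pair [IsProbabilityMeasure μ]
    (hI : IsInteraction S P T δ π₀ D F μ)
    (hD : ∀ t < T, IsProbabilityMeasure (D t)) (hP : IsTransition S P) {t : ℕ} (ht : t < T)
    (hπ : ∀ᵐ ω ∂μ, IsPolicy (playedPolicy S T δ π₀ (fun s => F s ω) t))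
    {E : Type*} [MeasurableSpace E] {lam : Ω → E} (hlam : Measurable[historyBefore F t] lam)
    {ψ : E → (X × A → ℝ) × Matrix (X × A) (Fin m) ℝ → ℝ}
    (hψ : Measurable fun p : E × ((X × A → ℝ) × Matrix (X × A) (Fin m) ℝ) => ψ p.1 p.2)
    (hle : ∀ ω, ∫⁻ y, ENNReal.ofReal (Real.exp (ψ (lam ω) y)) ∂(D t) ≤ 1) :
    SuperStep μ F t fun ω => ψ (lam ω) (feedbackPair F t ω) := by
  have hpair' : Measurable[historyBefore F (t + 1)] (feedbackPair F t) :=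
    (_root_.measurable_reward F t.lt_succ_self).prodMk (_root_.measurable_cons F t.lt_succ_self)
  refine ⟨hψ.comp ((hlam.mono (historyBefore_mono F t.le_succ) le_rfl).prodMk hpair'),
    fun Z hZ => ?_⟩
  have hh := hI.historyBefore_le ht.le
  have := hD t ht
  have hZl : Measurable[historyBefore F t] fun ω => (Z ω, lam ω) := hZ.prodMk hlam
  have hZl' : Measurable fun ω => (Z ω, lam ω) := hZl.mono hh le_rfl
  have hpair := hI.measurable_feedbackPair ht
  have hmap := hI.map_feedbackPair hP ht hπ
  have hind : ProbabilityTheory.IndepFun (fun ω => (Z ω, lam ω)) (feedbackPair F t) μ := by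
    rw [ProbabilityTheory.indepFun_iff_measure_inter_preimage_eq_mul]
    intro s B hs hB
    rw [hI.measure_inter_feedbackPair hP ht hπ (hZl hs) hB, ← hmap,
      Measure.map_apply hpair hB]
  have hprod := (ProbabilityTheory.indepFun_iff_map_prod_eq_prod_map_map hZl'.aemeasurable
    hpair.aemeasurable).1 hind
  have hΨ : Measurable fun p : (ENNReal × E) × ((X × A → ℝ) × Matrix (X × A) (Fin m) ℝ) =>
      p.1.1 * ENNReal.ofReal (Real.exp (ψ p.1.2 p.2)) := by
    refine (measurable_fst.comp measurable_fst).mul ?_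
    exact (hψ.comp ((measurable_snd.comp measurable_fst).prodMk
      measurable_snd)).exp.ennreal_ofReal
  calc ∫⁻ ω, Z ω * ENNReal.ofReal (Real.exp (ψ (lam ω) (feedbackPair F t ω))) ∂μ
      = ∫⁻ p, p.1.1 * ENNReal.ofReal (Real.exp (ψ p.1.2 p.2))
          ∂(μ.map fun ω => ((Z ω, lam ω), feedbackPair F t ω)) := by
        rw [lintegral_map hΨ (hZl'.prodMk hpair)]
    _ = ∫⁻ z, ∫⁻ y, z.1 * ENNReal.ofReal (Real.exp (ψ z.2 y)) ∂(D t)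
          ∂(μ.map fun ω => (Z ω, lam ω)) := by
        rw [hprod, hmap, lintegral_prod _ hΨ.aemeasurable]
    _ = ∫⁻ ω, ∫⁻ y, Z ω * ENNReal.ofReal (Real.exp (ψ (lam ω) y)) ∂(D t) ∂μ := by
        rw [lintegral_map hΨ.lintegral_prod_right' hZl']
    _ ≤ ∫⁻ ω, Z ω ∂μ := by
        refine lintegral_mono fun ω => ?_
        have hψω : Measurable fun y => ψ (lam ω) y :=
          hψ.comp (measurable_const.prodMk measurable_id)
        rw [lintegral_const_mul _ hψω.exp.ennreal_ofReal]
        calc _ ≤ Z ω * 1 := by gcongr; exact hle ω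
          _ = Z ω := mul_one _

end

/-! ### Hoeffding's lemma -/

lemma lintegral_exp_centered_le {E : Type*} [MeasurableSpace E] {ν : Measure E}
    [IsProbabilityMeasure ν] {f : E → ℝ} (hf : AEMeasurable f ν) {a b : ℝ}
    (hab : ∀ᵐ y ∂ν, f y ∈ Set.Icc a b) (s : ℝ) :
    ∫⁻ y, ENNReal.ofReal (Real.exp (s * (f y - ∫ z, f z ∂ν) - s ^ 2 * (b - a) ^ 2 / 8)) ∂ν
      ≤ 1 := by
  have h := ProbabilityTheory.hasSubgaussianMGF_of_mem_Icc hf hab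
  have h1 := h.mgf_le s
  have h2 := h.integrable_exp_mul s
  have e : ∀ y, Real.exp (s * (f y - ∫ z, f z ∂ν) - s ^ 2 * (b - a) ^ 2 / 8) =
      Real.exp (s * (f y - ∫ z, f z ∂ν)) * Real.exp (-(s ^ 2 * (b - a) ^ 2 / 8)) := fun y => by
    rw [← Real.exp_add]; congr 1
  simp only [e]
  rw [← ofReal_integral_eq_lintegral_ofReal (h2.mul_const _)
    (Filter.Eventually.of_forall fun y => by positivity), integral_mul_const]
  rw [← ENNReal.ofReal_one]
  refine ENNReal.ofReal_le_ofReal ?_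
  rw [Real.exp_neg, ← div_eq_mul_inv, div_le_one (Real.exp_pos _)]
  refine h1.trans (Real.exp_le_exp.2 (le_of_eq ?_))
  push_cast
  rw [Real.norm_eq_abs, div_pow, sq_abs]
  ring

/-- Hoeffding's lemma for the finitely supported measure ∑ p_i δ_i. -/
lemma sum_mul_exp_centered_le {ι : Type*} [Fintype ι] {p f : ι → ℝ} (hp : ∀ i, 0 ≤ p i)
    (hp1 : ∑ i, p i = 1) {a b : ℝ} (hab : ∀ i, f i ∈ Set.Icc a b) (s : ℝ) :
    ∑ i, p i * Real.exp (s * (f i - ∑ j, p j * f j) - s ^ 2 * (b - a) ^ 2 / 8) ≤ 1 := by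
  let _ : MeasurableSpace ι := ⊤
  set ν : Measure ι := ∑ i, ENNReal.ofReal (p i) • Measure.dirac i with hν
  have hint : ∀ g : ι → ℝ, ∫ i, g i ∂ν = ∑ i, p i * g i := by
    intro g
    rw [hν, integral_finsetSum_measure fun i _ =>
      (integrable_dirac (by simp)).smul_measure ENNReal.ofReal_ne_top]
    refine Finset.sum_congr rfl fun i _ => ?_
    rw [integral_smul_measure, integral_dirac, ENNReal.toReal_ofReal (hp i), smul_eq_mul]
  have hlint : ∀ g : ι → ENNReal, ∫⁻ i, g i ∂ν = ∑ i, ENNReal.ofReal (p i) * g i := by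
    intro g
    rw [hν, lintegral_finsetSum_measure]
    refine Finset.sum_congr rfl fun i _ => ?_
    rw [lintegral_smul_measure, lintegral_dirac, smul_eq_mul]
  have : IsProbabilityMeasure ν := ⟨by
    rw [← lintegral_one, hlint]
    simp only [mul_one]
    rw [← ENNReal.ofReal_sum_of_nonneg fun i _ => hp i, hp1, ENNReal.ofReal_one]⟩
  have h := lintegral_exp_centered_le (ν := ν) (f := f) (measurable_from_top.aemeasurable)
    (Filter.Eventually.of_forall hab) s
  rw [hlint, hint] at h
  rw [← ENNReal.ofReal_le_ofReal_iff zero_le_one, ENNReal.ofReal_one,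
    ENNReal.ofReal_sum_of_nonneg fun i _ => mul_nonneg (hp i) (Real.exp_pos _).le]
  simpa only [ENNReal.ofReal_mul (hp _)] using h

/-! ### The good events -/

section
variable {X A Ω : Type*} [Fintype X] [Fintype A] [mΩ : MeasurableSpace Ω] {L m : ℕ}
  {S : LayeredSpace X L} {P : X → A → X → ℝ} {π : X → A → ℝ} {T : ℕ} {δ : ℝ} {π₀ : X → A → ℝ}
  {D : ℕ → Measure ((X × A → ℝ) × Matrix (X × A) (Fin m) ℝ)}
  {F : ℕ → Ω → Feedback X A L m} {μ : Measure Ω}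

/-- The Azuma-Hoeffding inequality. -/
lemma IsInteraction.azuma [IsProbabilityMeasure μ] (hI : IsInteraction S P T δ π₀ D F μ)
    (hT : 1 ≤ T) {Y : ℕ → Ω → ℝ} {c : ℝ} (hc : 0 < c)
    (hY : ∀ s : ℝ, ∀ t < T, SuperStep μ F t fun ω => s * Y t ω - s ^ 2 * c ^ 2 / 8)
    {ε : ℝ} (hε : 0 < ε) :
    μ {ω | ε ≤ ∑ t ∈ Finset.range T, Y t ω} ≤
      ENNReal.ofReal (Real.exp (-(2 * ε ^ 2 / (T * c ^ 2)))) := by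
  have hT0 : (0 : ℝ) < T := by exact_mod_cast hT
  -- The maximizer of s ε - T s² c² / 8.
  set s : ℝ := 4 * ε / (T * c ^ 2) with hs
  refine le_trans (measure_mono fun ω hω => ?_)
    (hI.measure_le_exp (hY s) (2 * ε ^ 2 / (T * c ^ 2)))
  simp only [Set.mem_ofPred_eq] at hω ⊢
  rw [Finset.sum_sub_distrib, ← Finset.mul_sum, Finset.sum_const, Finset.card_range,
    nsmul_eq_mul]
  have h1 : s * ε ≤ s * ∑ t ∈ Finset.range T, Y t ω :=
    mul_le_mul_of_nonneg_left hω (by positivity)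
  have h2 : 2 * ε ^ 2 / (T * c ^ 2) = s * ε - T * (s ^ 2 * c ^ 2 / 8) := by
    rw [hs]; field_simp; ring
  linarith

/-- There are L visits with weights in [0, 2]. The sign is negative because `bonusDeviation`
subtracts the observed sum from its mean. -/
lemma sum_visits_mul_confBonus_mem (f : ℕ → Feedback X A L m) (t : ℕ) (τ : Trajectory X A L) :
    -∑ x, ∑ a, (visits τ x a : ℝ) * confBonus S T δ f t x a ∈ Set.Icc (-(2 * L : ℝ)) 0 := by
  constructor
  · rw [neg_le_neg_iff]
    calc _ ≤ ∑ x, ∑ a, (visits τ x a : ℝ) * 2 :=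
          Finset.sum_le_sum fun x _ => Finset.sum_le_sum fun a _ =>
            mul_le_mul_of_nonneg_left (min_le_left _ _) (Nat.cast_nonneg _)
      _ = 2 * L := by
          simp only [← Finset.sum_mul]
          rw [mul_comm]
          congr 1
          exact_mod_cast sum_visits τ
  · rw [neg_nonpos]
    exact Finset.sum_nonneg fun x _ => Finset.sum_nonneg fun a _ =>
      mul_nonneg (Nat.cast_nonneg _) (confBonus_nonneg _ _ _)

lemma sum_trajProb_mul_sum_visits (hP : IsTransition S P) (b : X → A → ℝ) :
    ∑ τ : Trajectory X A L, trajProb S P π τ * ∑ x, ∑ a, (visits τ x a : ℝ) * b x a =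
      ∑ x, ∑ a, occ S P π (x, a) * b x a := by
  simp only [← sum_trajProb_visits hP, Finset.mul_sum, Finset.sum_mul]
  rw [Finset.sum_comm]
  refine Finset.sum_congr rfl fun x _ => ?_
  rw [Finset.sum_comm]
  exact Finset.sum_congr rfl fun a _ => Finset.sum_congr rfl fun τ _ => by ring

lemma IsInteraction.measure_bonusDeviation_le [IsProbabilityMeasure μ]
    (hI : IsInteraction S P T δ π₀ D F μ) (hD : ∀ t < T, IsProbabilityMeasure (D t))
    (hP : IsTransition S P) (hL : 1 ≤ L) (hT : 1 ≤ T) (hδ : 0 < δ) (hδ1 : δ < 1)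
    (hπ : ∀ᵐ ω ∂μ, ∀ t < T, IsPolicy (playedPolicy S T δ π₀ (fun s => F s ω) t)) :
    μ {ω | L * Real.sqrt (2 * T * Real.log (1 / δ)) ≤
      ∑ t ∈ Finset.range T, bonusDeviation S P T δ π₀ (fun s => F s ω) t} ≤
      ENNReal.ofReal δ := by
  have hT0 : (0 : ℝ) < T := by exact_mod_cast hT
  have hL0 : (0 : ℝ) < L := by exact_mod_cast hL
  have hlog : 0 < Real.log (1 / δ) := Real.log_pos (by rw [lt_div_iff₀ hδ]; linarith)
  refine (hI.azuma hT (c := 2 * L) (by positivity) (fun s t ht => ?_)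
    (by positivity)).trans (le_of_eq ?_)
  · have hπt : ∀ᵐ ω ∂μ, IsPolicy (playedPolicy S T δ π₀ (fun s => F s ω) t) := by
      filter_upwards [hπ] with ω hω using hω t ht
    have hocc := measurable_playedOcc S P T δ π₀ F t
    have hb := fun x a => measurable_confBonus (S := S) (T := T) (δ := δ) F t x a
    refine hI.superStep_path hD hP ht hπt (φ := fun ω τ => s *
      (∑ x, ∑ a, playedOcc S P T δ π₀ (fun s => F s ω) t (x, a) *
        confBonus S T δ (fun s => F s ω) t x a -
      ∑ x, ∑ a, (visits τ x a : ℝ) * confBonus S T δ (fun s => F s ω) t x a) -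
        s ^ 2 * (2 * L) ^ 2 / 8) (fun τ => ?_) ?_
    · refine Measurable.sub (Measurable.const_mul (Measurable.sub ?_ ?_) _)
        (@measurable_const _ _ _ (_) _)
      · exact Finset.measurable_sum _ fun x _ => Finset.measurable_sum _ fun a _ =>
          ((measurable_pi_apply (x, a)).comp hocc).mul (hb x a)
      · exact Finset.measurable_sum _ fun x _ => Finset.measurable_sum _ fun a _ =>
          (hb x a).const_mul _
    · filter_upwards [hπt] with ω hω
      have h := sum_mul_exp_centered_le (trajProb_nonneg hP hω) (trajProb_sum hP hω)
        (sum_visits_mul_confBonus_mem (S := S) (T := T) (δ := δ) (fun s => F s ω) t) s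
      simp only [mul_neg, Finset.sum_neg_distrib, sum_trajProb_mul_sum_visits hP] at h
      refine le_trans (le_of_eq ?_) h
      refine Finset.sum_congr rfl fun τ _ => ?_
      congr 2
      rw [playedOcc]
      ring
  · have : 2 * ((L : ℝ) * Real.sqrt (2 * T * Real.log (1 / δ))) ^ 2 / (T * (2 * L) ^ 2) =
        Real.log (1 / δ) := by
      rw [mul_pow, Real.sq_sqrt (by positivity)]
      field_simp
    rw [this, one_div, Real.log_inv, neg_neg, Real.exp_log hδ]

/-! ### Concentration of the empirical transition probabilities -/

/-- With at most one visit, the exponential is affine in the visit counts, so its mean is determined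
by the occupancies alone. -/
lemma LayeredPath.exp_visits_eq {τ : Trajectory X A L} (hτ : LayeredPath S τ) (x : X) (a : A)
    (σ : X → ℝ) (M e : ℝ) :
    Real.exp (e * (∑ x', σ x' * visitsNext τ x a x' - visits τ x a * M) - e ^ 2 / 2 * visits τ x a) =
      1 + ∑ x', (visitsNext τ x a x' : ℝ) *
        (Real.exp (e * (σ x' - M) - e ^ 2 / 2) - 1) := by
  have hs := sum_visitsNext τ x a
  have hv := hτ.visits_le_one x a
  have hv : visits τ x a = 0 ∨ visits τ x a = 1 := by omega
  rcases hv with hv | hv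
  · rw [hv] at hs ⊢
    have h0 : ∀ x', visitsNext τ x a x' = 0 := fun x' =>
      (Finset.sum_eq_zero_iff.1 hs) x' (Finset.mem_univ _)
    simp [h0]
  · rw [hv] at hs ⊢
    have hne : ∑ x', visitsNext τ x a x' ≠ 0 := by omega
    obtain ⟨y, -, hy⟩ := Finset.exists_ne_zero_of_sum_ne_zero hne
    have hle : visitsNext τ x a y ≤ 1 := by
      rw [← hs]
      exact Finset.single_le_sum (fun _ _ => Nat.zero_le _) (Finset.mem_univ y)
    have hy1 : visitsNext τ x a y = 1 := by omega
    have h0 : ∀ x', x' ≠ y → visitsNext τ x a x' = 0 := by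
      classical
      intro x' hx'
      have h2 := Finset.add_le_sum (f := fun x' => visitsNext τ x a x')
        (fun _ _ => Nat.zero_le _) (Finset.mem_univ x') (Finset.mem_univ y) hx'
      omega
    rw [Finset.sum_eq_single y (fun x' _ hx' => by rw [h0 x' hx']; simp) (by simp),
      Finset.sum_eq_single y (fun x' _ hx' => by rw [h0 x' hx']; simp) (by simp), hy1]
    simp

/-- Given a visit of (x, a), the next state has law P(· | x, a), and Hoeffding's lemma for a range
of length 2 gives the compensator e²/2. Both drift and compensator are charged only on visits. -/
lemma sum_trajProb_exp_visits_le (hP : IsTransition S P) (hπ : IsPolicy π) {x : X} (a : A)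
    (hx : S.layer x < L) {σ : X → ℝ} (hσ : ∀ x', σ x' ∈ Set.Icc (-1 : ℝ) 1) (e : ℝ) :
    ∑ τ : Trajectory X A L, trajProb S P π τ *
      Real.exp (e * (∑ x', σ x' * visitsNext τ x a x' - visits τ x a * ∑ x', P x a x' * σ x') -
        e ^ 2 / 2 * visits τ x a) ≤ 1 := by
  set M := ∑ x', P x a x' * σ x' with hM
  set E : X → ℝ := fun x' => Real.exp (e * (σ x' - M) - e ^ 2 / 2) with hE
  have h1 : ∀ τ : Trajectory X A L, trajProb S P π τ *
      Real.exp (e * (∑ x', σ x' * visitsNext τ x a x' - visits τ x a * M) -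
        e ^ 2 / 2 * visits τ x a) = trajProb S P π τ +
      ∑ x', trajProb S P π τ * visitsNext τ x a x' * (E x' - 1) := by
    intro τ
    by_cases hτ : LayeredPath S τ
    · rw [hτ.exp_visits_eq, mul_add, mul_one, Finset.mul_sum]
      congr 1
      exact Finset.sum_congr rfl fun x' _ => by rw [hE]; ring
    · rw [trajProb_eq_zero hP π hτ]; simp
  simp only [h1, Finset.sum_add_distrib, trajProb_sum hP hπ]
  rw [Finset.sum_comm]
  simp only [← Finset.sum_mul, sum_trajProb_visitsNext hP, occTriple_eq_occ_mul hP hπ]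
  have h2 := sum_mul_exp_centered_le (hP.nonneg x a) (hP.sum_eq_one x a hx) hσ e
  have h3 : ∑ x', P x a x' * E x' ≤ 1 := by
    refine le_trans (le_of_eq ?_) h2
    refine Finset.sum_congr rfl fun x' _ => ?_
    simp only [hE]
    congr 2
    ring
  have h4 : ∑ x', occ S P π (x, a) * P x a x' * (E x' - 1) =
      occ S P π (x, a) * (∑ x', P x a x' * E x' - 1) := by
    simp only [mul_sub, mul_one, Finset.sum_sub_distrib, mul_assoc, ← Finset.mul_sum,
      hP.sum_eq_one x a hx]
  rw [h4]
  have := mul_nonpos_of_nonneg_of_nonpos (occ_nonneg hP hπ (x, a)) (sub_nonpos.2 h3)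
  linarith

open Classical in
/-- The signs that are `1` on `B` and `-1` elsewhere. -/
def signOf (B : Finset X) (x : X) : ℝ := if x ∈ B then 1 else -1

lemma signOf_mem (B : Finset X) (x : X) : signOf B x ∈ Set.Icc (-1 : ℝ) 1 := by
  unfold signOf
  split_ifs <;> constructor <;> norm_num

open Classical in
/-- The increment in episode `t` of the exponent that controls the empirical transition
probabilities after `n` visits of `(x, a)`. -/
def concIncrement (S : LayeredSpace X L) (P : X → A → X → ℝ) (T : ℕ) (δ : ℝ) (x : X) (a : A)
    (n : ℕ) (B : Finset X) (f : ℕ → Feedback X A L m) (t : ℕ) (τ : Trajectory X A L) : ℝ :=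
  if (algRun S T δ f t).cnt x a < n then
    confRadius A S T δ x n * (∑ x', signOf B x' * visitsNext τ x a x' -
      visits τ x a * ∑ x', P x a x' * signOf B x') - confRadius A S T δ x n ^ 2 / 2 * visits τ x a
  else 0

/-- The stopping condition depends on the history only, so each step is either a step of the
previous lemma or zero. -/
lemma IsInteraction.superStep_concIncrement [IsProbabilityMeasure μ]
    (hI : IsInteraction S P T δ π₀ D F μ) (hD : ∀ t < T, IsProbabilityMeasure (D t))
    (hP : IsTransition S P) {t : ℕ} (ht : t < T)
    (hπ : ∀ᵐ ω ∂μ, IsPolicy (playedPolicy S T δ π₀ (fun s => F s ω) t))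
    {x : X} (a : A) (hx : S.layer x < L) (n : ℕ) (B : Finset X) :
    SuperStep μ F t fun ω => concIncrement S P T δ x a n B (fun s => F s ω) t (F t ω).path := by
  refine hI.superStep_path hD hP ht hπ
    (φ := fun ω τ => concIncrement S P T δ x a n B (fun s => F s ω) t τ) (fun τ => ?_) ?_
  · have h : Measurable fun k : ℕ => if k < n then
      confRadius A S T δ x n * (∑ x', signOf B x' * visitsNext τ x a x' -
        visits τ x a * ∑ x', P x a x' * signOf B x') -
          confRadius A S T δ x n ^ 2 / 2 * visits τ x a else 0 := measurable_from_top
    exact h.comp (measurable_cnt F t x a)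
  · filter_upwards [hπ] with ω hω
    unfold concIncrement
    split_ifs
    · exact sum_trajProb_exp_visits_le hP hω a hx (signOf_mem B) _
    · simp [trajProb_sum hP hω]

lemma visitsNext_eq_zero_of_visits (τ : Trajectory X A L) {x : X} {a : A} (h : visits τ x a = 0)
    (x' : X) : visitsNext τ x a x' = 0 := by
  rw [← sum_visitsNext] at h
  exact (Finset.sum_eq_zero_iff.1 h) x' (Finset.mem_univ _)

/-- If `n` is the count at time t, the increments vanish from t on, and before t a vanishing
increment means that no visit took place. The union over n thus replaces a union over times. -/
lemma sum_concIncrement (f : ℕ → Feedback X A L m) {t : ℕ} (ht : t ≤ T) (x : X) (a : A)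
    (B : Finset X) :
    ∑ r ∈ Finset.range T, concIncrement S P T δ x a ((algRun S T δ f t).cnt x a) B f r (f r).path =
      confRadius A S T δ x ((algRun S T δ f t).cnt x a) *
        (∑ x', signOf B x' * (algRun S T δ f t).cntNext x a x' -
          (algRun S T δ f t).cnt x a * ∑ x', P x a x' * signOf B x') -
      confRadius A S T δ x ((algRun S T δ f t).cnt x a) ^ 2 / 2 * (algRun S T δ f t).cnt x a := by
  set n := (algRun S T δ f t).cnt x a with hn
  set e := confRadius A S T δ x n with he
  have h1 : ∑ r ∈ Finset.range T, concIncrement S P T δ x a n B f r (f r).path =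
      ∑ r ∈ Finset.range t, concIncrement S P T δ x a n B f r (f r).path := by
    symm
    refine Finset.sum_subset (Finset.range_mono ht) fun r _ hr => ?_
    rw [concIncrement, if_neg]
    rw [not_lt]
    exact cnt_mono x a (not_lt.1 fun h => hr (Finset.mem_range.2 h))
  have h2 : ∀ r ∈ Finset.range t, concIncrement S P T δ x a n B f r (f r).path =
      e * (∑ x', signOf B x' * visitsNext (f r).path x a x' -
        visits (f r).path x a * ∑ x', P x a x' * signOf B x') -
        e ^ 2 / 2 * visits (f r).path x a := by
    intro r hr
    unfold concIncrement
    split_ifs with h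
    · rfl
    · have h3 : (algRun S T δ f (r + 1)).cnt x a ≤ n := cnt_mono x a (Finset.mem_range.1 hr)
      rw [cnt_succ] at h3
      have h0 : visits (f r).path x a = 0 := by omega
      simp [h0, visitsNext_eq_zero_of_visits _ h0]
  rw [h1, Finset.sum_congr rfl h2, Finset.sum_sub_distrib, ← Finset.mul_sum, ← Finset.mul_sum,
    Finset.sum_sub_distrib, ← Finset.sum_mul, hn, cnt_eq_sum, Finset.sum_comm]
  simp only [← Finset.mul_sum, cntNext_eq_sum]
  push_cast
  rfl

lemma confRadius_sq_mul (hl : 0 ≤ confLog X A T δ) {n : ℕ} (hn : 1 ≤ n) (x : X) :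
    n * confRadius A S T δ x n ^ 2 / 2 = S.layerCard (S.layer x + 1) * confLog X A T δ := by
  have hn1 : (1 : ℝ) ≤ n := by exact_mod_cast hn
  rw [confRadius_eq, max_eq_right hn1, div_pow, Real.sq_sqrt (by positivity),
    Real.sq_sqrt (by positivity)]
  field_simp

-- The ℓ₁ error is the signed error for the best sign vector. If it exceeds the radius ε after n
-- visits, the exponent is at least n ε² - n ε²/2 = n ε²/2, which is |X_{k+1}| times the logarithm.
open Classical in
lemma exists_le_sum_concIncrement [Nonempty A] (hL : 1 ≤ L) (hP : IsTransition S P) (hT : 1 ≤ T)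
    (hδ : 0 < δ) (hδ1 : δ < 1) {f : ℕ → Feedback X A L m}
    (hf : ∀ t < T, LayeredPath S (f t).path) (hc : ¬ Concentrated S P T δ f) :
    ∃ x a, S.layer x < L ∧ ∃ n ∈ Finset.Icc 1 T,
      ∃ B ∈ (Finset.univ.filter fun x' => S.layer x' = S.layer x + 1).powerset,
      S.layerCard (S.layer x + 1) * confLog X A T δ ≤
        ∑ t ∈ Finset.range T, concIncrement S P T δ x a n B f t (f t).path := by
  unfold Concentrated at hc
  push Not at hc
  obtain ⟨t, ht, x, a, h⟩ := hc
  have hl := half_le_confLog (X := X) (A := A) hL hP hT hδ hδ1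
  set n := (algRun S T δ f t).cnt x a with hn
  set M := (algRun S T δ f t).cntNext x a with hM
  have hr0 : 0 ≤ confRadius A S T δ x n := Real.sqrt_nonneg _
  have hx : S.layer x < L := by
    by_contra hx
    have h1 : ∀ x', (M x' : ℝ) = 0 := fun x' => by
      rw [hM, cntNext_eq_zero hf ht a (by have := S.layer_le x'; omega), Nat.cast_zero]
    simp only [hP.last a _ hx, h1, zero_div, sub_self, abs_zero, Finset.sum_const_zero] at h
    linarith
  -- A failure requires at least one visit, as the radius at count 0 is at least 1.
  have hn1 : 1 ≤ n := by
    by_contra hn0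
    have hn0 : n = 0 := by omega
    have h1 : ∀ x', (M x' : ℝ) = 0 := fun x' => by
      have : ∑ x', M x' = 0 := (sum_cntNext t x a).trans hn0
      rw [(Finset.sum_eq_zero_iff.1 this) x' (Finset.mem_univ _), Nat.cast_zero]
    simp only [h1, zero_div, sub_zero, abs_of_nonneg (hP.nonneg _ _ _), hn0,
      hP.sum_eq_one x a hx] at h
    have := one_le_confRadius (A := A) hL hP hT hδ hδ1 hx
    linarith
  have hnT : n ≤ T := (cnt_le hf ht x a).trans ht
  have hn0 : (0 : ℝ) < n := by exact_mod_cast hn1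
  -- The states of the next layer whose empirical frequency is at least the true probability.
  -- Outside the next layer both vanish, so only subsets of that layer are needed.
  set B := (Finset.univ.filter fun x' => S.layer x' = S.layer x + 1).filter
    fun x' => n * P x a x' ≤ M x' with hB
  refine ⟨x, a, hx, n, Finset.mem_Icc.2 ⟨hn1, hnT⟩, B,
    Finset.mem_powerset.2 (Finset.filter_subset _ _), ?_⟩
  have hsum := sum_concIncrement (P := P) (S := S) (δ := δ) f ht x a B
  rw [hsum, ← hn, ← confRadius_sq_mul (by linarith) hn1 x]
  have habs : ∀ x', |P x a x' - M x' / max 1 (n : ℝ)| =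
      (signOf B x' * M x' - n * (P x a x' * signOf B x')) / n := by
    intro x'
    rw [max_eq_right (show (1 : ℝ) ≤ n by exact_mod_cast hn1)]
    by_cases hl : S.layer x' = S.layer x + 1
    · by_cases hle : n * P x a x' ≤ M x'
      · have : x' ∈ B := by simp [hB, hl, hle]
        rw [signOf, if_pos this, abs_of_nonpos, neg_sub]
        · field_simp
        · rw [sub_nonpos, le_div_iff₀ hn0]; linarith
      · have : x' ∉ B := by simp [hB, hle]
        rw [signOf, if_neg this, abs_of_nonneg]
        · field_simp; ring
        · rw [sub_nonneg, div_le_iff₀ hn0]; linarith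
    · rw [hP.eq_zero a hl, hM, cntNext_eq_zero hf ht a hl]
      simp
  simp only [habs] at h
  rw [← Finset.sum_div, Finset.sum_sub_distrib, ← Finset.mul_sum, lt_div_iff₀ hn0] at h
  have h5 := mul_le_mul_of_nonneg_left h.le hr0
  change n * confRadius A S T δ x n ^ 2 / 2 ≤ confRadius A S T δ x n *
    (∑ x', signOf B x' * (M x' : ℝ) - n * ∑ x', P x a x' * signOf B x') -
      confRadius A S T δ x n ^ 2 / 2 * n
  nlinarith

/-- With d = |X_{k+1}| and Y = T |X| |A|, the 2^d sign vectors fail with probability (δ/Y)^d each,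
in total (2δ/Y)^d ≤ 2δ/Y. There are at most Y choices of (x, a) and n. -/
lemma IsInteraction.measure_not_concentrated_le [Nonempty A] [IsProbabilityMeasure μ]
    (hI : IsInteraction S P T δ π₀ D F μ) (hD : ∀ t < T, IsProbabilityMeasure (D t))
    (hP : IsTransition S P) (hL : 1 ≤ L) (hT : 1 ≤ T) (hδ : 0 < δ) (hδ1 : δ < 1)
    (hπ : ∀ᵐ ω ∂μ, ∀ t < T, IsPolicy (playedPolicy S T δ π₀ (fun s => F s ω) t)) :
    μ {ω | (∀ t < T, LayeredPath S (F t ω).path) ∧ ¬ Concentrated S P T δ fun s => F s ω} ≤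
      ENNReal.ofReal (2 * δ) := by
  classical
  set V : X → Finset X := fun x => Finset.univ.filter fun x' => S.layer x' = S.layer x + 1 with hV
  set bad : X → A → ℕ → Finset X → Set Ω := fun x a n B => {ω | S.layer x < L ∧
    S.layerCard (S.layer x + 1) * confLog X A T δ ≤
      ∑ t ∈ Finset.range T,
        concIncrement S P T δ x a n B (fun s => F s ω) t (F t ω).path} with hbad
  have hsub : {ω | (∀ t < T, LayeredPath S (F t ω).path) ∧
      ¬ Concentrated S P T δ fun s => F s ω} ⊆
      ⋃ p ∈ (Finset.univ : Finset (X × A)), ⋃ n ∈ Finset.Icc 1 T, ⋃ B ∈ (V p.1).powerset,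
        bad p.1 p.2 n B := by
    rintro ω ⟨h1, h2⟩
    obtain ⟨x, a, hx, n, hn, B, hB, h⟩ := exists_le_sum_concIncrement hL hP hT hδ hδ1 h1 h2
    simp only [Set.mem_iUnion]
    exact ⟨(x, a), Finset.mem_univ _, n, hn, B, hB, hx, h⟩
  set Y : ℝ := (T : ℝ) * Fintype.card X * Fintype.card A with hY
  have hX2 : (2 : ℝ) ≤ Fintype.card X := by
    exact_mod_cast (show 2 ≤ L + 1 by omega).trans (succ_le_card hP)
  have hA1 : (1 : ℝ) ≤ Fintype.card A := by exact_mod_cast Fintype.card_pos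
  have hT1 : (1 : ℝ) ≤ T := by exact_mod_cast hT
  have hY2 : 2 ≤ Y := by
    calc (2 : ℝ) ≤ 1 * Fintype.card X * 1 := by linarith
      _ ≤ _ := by rw [hY]; gcongr
  have hsingle : ∀ x a n B, S.layer x < L → μ (bad x a n B) ≤
      ENNReal.ofReal ((δ / Y) ^ S.layerCard (S.layer x + 1)) := by
    intro x a n B hx
    refine (measure_mono fun ω hω => hω.2).trans ((hI.measure_le_exp
      (fun t ht => hI.superStep_concIncrement hD hP ht (by
        filter_upwards [hπ] with ω hω using hω t ht) a hx n B) _).trans (le_of_eq ?_))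
    congr 1
    rw [← mul_neg, Real.exp_nat_mul, confLog, ← Real.log_inv, inv_div,
      Real.exp_log (by positivity)]
  have hpair : ∀ x a n, μ (⋃ B ∈ (V x).powerset, bad x a n B) ≤ ENNReal.ofReal (2 * δ / Y) := by
    intro x a n
    by_cases hx : S.layer x < L
    · refine (measure_biUnion_finset_le _ _).trans
        ((Finset.sum_le_sum fun B _ => hsingle x a n B hx).trans ?_)
      rw [Finset.sum_const, Finset.card_powerset, hV, ← layerCard_eq, nsmul_eq_mul,
        ← ENNReal.ofReal_natCast, ← ENNReal.ofReal_mul (Nat.cast_nonneg _)]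
      refine ENNReal.ofReal_le_ofReal ?_
      push_cast
      rw [← mul_pow, mul_div_assoc]
      -- Here 2δ/Y ≤ 1, because Y ≥ 2, and the exponent is positive.
      refine pow_le_of_le_one (by positivity) ?_ (layerCard_pos hP hx).ne'
      rw [← mul_div_assoc, div_le_one (by linarith)]
      linarith
    · have : ⋃ B ∈ (V x).powerset, bad x a n B = ∅ := by
        simp [hbad, hx]
      rw [this]; simp
  refine (measure_mono hsub).trans ((measure_biUnion_finset_le _ _).trans
    ((Finset.sum_le_sum fun p _ => (measure_biUnion_finset_le _ _).trans
      (Finset.sum_le_sum fun n _ => hpair p.1 p.2 n)).trans (le_of_eq ?_)))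
  simp only [Finset.sum_const, Nat.card_Icc, Finset.card_univ, Fintype.card_prod, nsmul_eq_mul,
    add_tsub_cancel_right]
  rw [← ENNReal.ofReal_natCast, ← ENNReal.ofReal_natCast,
    ← ENNReal.ofReal_mul (Nat.cast_nonneg _), ← ENNReal.ofReal_mul (Nat.cast_nonneg _)]
  congr 1
  push_cast
  rw [hY]
  field_simp

end

/-! ### Deviations of constraints and rewards -/

section
variable {X A Ω : Type*} [Fintype X] [Fintype A] [mΩ : MeasurableSpace Ω] {L m : ℕ}
  {S : LayeredSpace X L} {P : X → A → X → ℝ} {T : ℕ} {δ : ℝ} {π₀ : X → A → ℝ}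
  {D : ℕ → Measure ((X × A → ℝ) × Matrix (X × A) (Fin m) ℝ)}
  {F : ℕ → Ω → Feedback X A L m} {μ : Measure Ω}

lemma measurable_cons_entry (p : X × A) (i : Fin m) :
    Measurable fun y : (X × A → ℝ) × Matrix (X × A) (Fin m) ℝ => y.2 p i :=
  (measurable_pi_apply i).comp ((measurable_pi_apply p).comp measurable_snd)

lemma measurable_dual_dotProduct (q : X × A → ℝ) :
    Measurable fun z : (Fin m → ℝ) × ((X × A → ℝ) × Matrix (X × A) (Fin m) ℝ) =>
      z.1 ⬝ᵥ z.2.2.transpose.mulVec q := by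
  have h : Measurable fun z : (Fin m → ℝ) × ((X × A → ℝ) × Matrix (X × A) (Fin m) ℝ) =>
      z.2.2.transpose.mulVec q :=
    measurable_transpose_mulVec.comp
      ((measurable_snd.comp measurable_snd).prodMk measurable_const)
  refine Finset.measurable_sum _ fun i _ => ?_
  exact ((measurable_pi_apply i).comp measurable_fst).mul ((measurable_pi_apply i).comp h)

lemma integral_dual_dotProduct {ν : Measure ((X × A → ℝ) × Matrix (X × A) (Fin m) ℝ)}
    [IsProbabilityMeasure ν] {𝒢 : Measure (Matrix (X × A) (Fin m) ℝ)}
    (hν : ν.map Prod.snd = 𝒢) (hb : ∀ᵐ y ∂ν, ∀ p i, y.2 p i ∈ Set.Icc (-1 : ℝ) 1)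
    (lam : Fin m → ℝ) (q : X × A → ℝ) :
    ∫ y, lam ⬝ᵥ y.2.transpose.mulVec q ∂ν = lam ⬝ᵥ (meanCons 𝒢).transpose.mulVec q := by
  have hint : ∀ p i, Integrable (fun y : (X × A → ℝ) × Matrix (X × A) (Fin m) ℝ => y.2 p i) ν := by
    intro p i
    refine Integrable.of_bound (measurable_cons_entry p i).aestronglyMeasurable 1 ?_
    filter_upwards [hb] with y hy
    exact abs_le.2 (hy p i)
  have hmean : ∀ p i, ∫ y, y.2 p i ∂ν = meanCons 𝒢 p i := by
    intro p i
    have hm : Measurable fun G : Matrix (X × A) (Fin m) ℝ => G p i :=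
      (measurable_pi_apply i).comp (measurable_pi_apply p)
    rw [meanCons, ← hν, integral_map measurable_snd.aemeasurable hm.aestronglyMeasurable]
  simp only [dotProduct, Matrix.mulVec, Matrix.transpose_apply]
  rw [integral_finsetSum _ fun i _ =>
    (integrable_finsetSum _ fun p _ => (hint p i).mul_const _).const_mul _]
  refine Finset.sum_congr rfl fun i _ => ?_
  rw [integral_const_mul, integral_finsetSum _ fun p _ => (hint p i).mul_const _]
  congr 1
  refine Finset.sum_congr rfl fun p _ => ?_
  rw [integral_mul_const, hmean]

/-- Since q is fixed and λ_t is determined by the history, λ_tᵀ(G_t - Ḡ)ᵀq is a martingale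
difference; the uncentered term lies in an interval of length 2 m T^{1/4} L. -/
lemma IsInteraction.measure_consDeviation_le [IsProbabilityMeasure μ]
    (hI : IsInteraction S P T δ π₀ D F μ) (hD : ∀ t < T, IsProbabilityMeasure (D t))
    (hP : IsTransition S P) (hm : 1 ≤ m) (hL : 1 ≤ L) (hT : 1 ≤ T) (hδ : 0 < δ)
    (hδ4 : δ < 1 / 4)
    (hπ : ∀ᵐ ω ∂μ, ∀ t < T, IsPolicy (playedPolicy S T δ π₀ (fun s => F s ω) t))
    {𝒢 : Measure (Matrix (X × A) (Fin m) ℝ)} (hDG : ∀ t < T, (D t).map Prod.snd = 𝒢)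
    (hb : ∀ t < T, ∀ᵐ y ∂(D t), ∀ p i, y.2 p i ∈ Set.Icc (-1 : ℝ) 1)
    {q : X × A → ℝ} (hq : q ∈ occSet S {P}) :
    μ {ω | m * (T : ℝ) ^ (1 / 4 : ℝ) * errG L T δ ≤
      ∑ t ∈ Finset.range T, consDeviation S T δ (meanCons 𝒢) q (fun s => F s ω) t} ≤
      ENNReal.ofReal δ := by
  have hT0 : (0 : ℝ) < T := by exact_mod_cast hT
  have hL0 : (0 : ℝ) < L := by exact_mod_cast hL
  have hm0 : (0 : ℝ) < m := by exact_mod_cast hm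
  have hlog := one_le_log hT hδ hδ4
  have hq' := occSet_mono (Set.singleton_subset_iff.2 hP :
    {P} ⊆ {P' : X → A → X → ℝ | IsTransition S P'}) hq
  set u := (T : ℝ) ^ (1 / 4 : ℝ) with hu
  have hu0 : 0 < u := by positivity
  have hG0 : 0 < errG L T δ := by
    unfold errG; positivity
  refine (hI.azuma hT (c := m * u * L - -(m * u * L))
    (by rw [sub_neg_eq_add]; positivity) (fun s t ht => ?_)
    (by positivity)).trans (ENNReal.ofReal_le_ofReal ?_)
  · have hπt : ∀ᵐ ω ∂μ, IsPolicy (playedPolicy S T δ π₀ (fun s => F s ω) t) := by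
      filter_upwards [hπ] with ω hω using hω t ht
    have := hD t ht
    refine hI.superStep_pair hD hP ht hπt
      (lam := fun ω => (algRun S T δ (fun s => F s ω) t).dual) (measurable_iterates S T δ F t).2.1
      (ψ := fun lam y => s * (lam ⬝ᵥ (y.2 - meanCons 𝒢).transpose.mulVec q) -
        s ^ 2 * (m * u * L - -(m * u * L)) ^ 2 / 8) ?_ ?_
    · simp only [Matrix.transpose_sub, Matrix.sub_mulVec, dotProduct_sub]
      have h2 : Measurable fun z : (Fin m → ℝ) × ((X × A → ℝ) × Matrix (X × A) (Fin m) ℝ) =>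
          z.1 ⬝ᵥ (meanCons 𝒢).transpose.mulVec q := by
        unfold dotProduct; fun_prop
      exact (((measurable_dual_dotProduct q).sub h2).const_mul _).sub_const _
    · intro ω
      have hd := dual_mem (S := S) (T := T) (δ := δ) (f := fun s => F s ω) t
      set lam := (algRun S T δ (fun s => F s ω) t).dual with hlam
      have hlsum : ∑ i, |lam i| ≤ m * u := by
        calc ∑ i, |lam i| ≤ ∑ i : Fin m, u := Finset.sum_le_sum fun i _ => by
              rw [abs_of_nonneg (hd.1 i)]; exact hd.2 i
          _ = m * u := by simp
      have hf : Measurable fun y : (X × A → ℝ) × Matrix (X × A) (Fin m) ℝ =>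
          lam ⬝ᵥ y.2.transpose.mulVec q :=
        (measurable_dual_dotProduct q).comp (measurable_const.prodMk measurable_id)
      have hrange : ∀ᵐ y ∂(D t), lam ⬝ᵥ y.2.transpose.mulVec q ∈
          Set.Icc (-(m * u * L)) (m * u * L) := by
        filter_upwards [hb t ht] with y hy
        have h1 : ∀ i, |y.2.transpose.mulVec q i| ≤ L := by
          intro i
          have h := abs_dotProduct_le (u := fun p => y.2 p i) (v := q) (c := 1)
            (fun p => abs_le.2 (hy p i))
          simp only [abs_of_nonneg (mem_occSet_nonneg (rowConvex_transition S) hq' _),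
            mem_occSet_sum (rowConvex_transition S) hq', one_mul] at h
          exact h
        have h2 := abs_dotProduct_le (v := lam) h1
        rw [dotProduct_comm] at h2
        refine abs_le.1 (h2.trans ?_)
        calc L * ∑ i, |lam i| ≤ L * (m * u) := by gcongr
          _ = _ := by ring
      have h := lintegral_exp_centered_le hf.aemeasurable hrange s
      rw [integral_dual_dotProduct (hDG t ht) (hb t ht)] at h
      simpa only [Matrix.transpose_sub, Matrix.sub_mulVec, dotProduct_sub] using h
  -- The exponent is four times what is required, so the crude bound by ln(1/δ) is enough.
  · have e : 2 * (m * u * errG L T δ) ^ 2 / (T * (m * u * L - -(m * u * L)) ^ 2) =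
        4 * Real.log ((T : ℝ) ^ 2 / δ) := by
      rw [sub_neg_eq_add, ← two_mul, errG, mul_pow, mul_pow (2 * (L : ℝ)),
        Real.sq_sqrt (by positivity)]
      field_simp
      ring
    rw [e]
    have h1 : Real.log (1 / δ) ≤ Real.log ((T : ℝ) ^ 2 / δ) := by
      refine Real.log_le_log (by positivity) ?_
      have : (1 : ℝ) ≤ T := by exact_mod_cast hT
      gcongr
      nlinarith
    calc Real.exp (-(4 * Real.log ((T : ℝ) ^ 2 / δ))) ≤ Real.exp (-Real.log (1 / δ)) := by
          refine Real.exp_le_exp.2 ?_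
          linarith
      _ = δ := by rw [one_div, Real.log_inv, neg_neg, Real.exp_log hδ]

lemma IsInteraction.measure_rewardDeviation_le [IsProbabilityMeasure μ]
    (hI : IsInteraction S P T δ π₀ D F μ) (hD : ∀ t < T, IsProbabilityMeasure (D t))
    (hP : IsTransition S P) (hL : 1 ≤ L) (hT : 1 ≤ T) (hδ : 0 < δ) (hδ4 : δ < 1 / 4)
    (hπ : ∀ᵐ ω ∂μ, ∀ t < T, IsPolicy (playedPolicy S T δ π₀ (fun s => F s ω) t))
    {ℛ : Measure (X × A → ℝ)} (hDR : ∀ t < T, (D t).map Prod.fst = ℛ)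
    (hb : ∀ t < T, ∀ᵐ y ∂(D t), ∀ p, y.1 p ∈ Set.Icc (0 : ℝ) 1)
    {q : X × A → ℝ} (hq : q ∈ occSet S {P}) :
    μ {ω | errR L T δ ≤
      ∑ t ∈ Finset.range T, (meanReward ℛ - (F t ω).reward) ⬝ᵥ q} ≤ ENNReal.ofReal δ := by
  have hT0 : (0 : ℝ) < T := by exact_mod_cast hT
  have hL0 : (0 : ℝ) < L := by exact_mod_cast hL
  have hlog : 0 < Real.log (2 / δ) := Real.log_pos (by rw [lt_div_iff₀ hδ]; linarith)
  have hq' := occSet_mono (Set.singleton_subset_iff.2 hP :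
    {P} ⊆ {P' : X → A → X → ℝ | IsTransition S P'}) hq
  have hq0 := mem_occSet_nonneg (rowConvex_transition S) hq'
  have hR0 : 0 < errR L T δ := by unfold errR; positivity
  refine (hI.azuma hT (c := 0 - -(L : ℝ)) (by simpa using hL0) (fun s t ht => ?_)
    hR0).trans (ENNReal.ofReal_le_ofReal ?_)
  · have hπt : ∀ᵐ ω ∂μ, IsPolicy (playedPolicy S T δ π₀ (fun s => F s ω) t) := by
      filter_upwards [hπ] with ω hω using hω t ht
    have := hD t ht
    have hf : Measurable fun y : (X × A → ℝ) × Matrix (X × A) (Fin m) ℝ => -(y.1 ⬝ᵥ q) := by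
      unfold dotProduct; fun_prop
    refine hI.superStep_pair hD hP ht hπt (lam := fun _ => ()) (@measurable_const _ _ _ (_) _)
      (ψ := fun _ y => s * ((meanReward ℛ - y.1) ⬝ᵥ q) - s ^ 2 * (0 - -(L : ℝ)) ^ 2 / 8) ?_ ?_
    · simp only [sub_dotProduct]
      have h2 : Measurable fun y : (X × A → ℝ) × Matrix (X × A) (Fin m) ℝ =>
          s * (meanReward ℛ ⬝ᵥ q - y.1 ⬝ᵥ q) - s ^ 2 * (0 - -(L : ℝ)) ^ 2 / 8 := by
        unfold dotProduct; fun_prop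
      exact h2.comp (@measurable_snd Unit _ _ _)
    · intro ω
      have hrange : ∀ᵐ y ∂(D t), -(y.1 ⬝ᵥ q) ∈ Set.Icc (-(L : ℝ)) 0 := by
        filter_upwards [hb t ht] with y hy
        constructor
        · rw [neg_le_neg_iff, ← mem_occSet_sum (rowConvex_transition S) hq']
          exact Finset.sum_le_sum fun p _ => mul_le_of_le_one_left (hq0 p) (hy p).2
        · rw [neg_nonpos]
          exact Finset.sum_nonneg fun p _ => mul_nonneg (hy p).1 (hq0 p)
      have h := lintegral_exp_centered_le hf.aemeasurable hrange s
      have hint : ∀ p, Integrable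
          (fun y : (X × A → ℝ) × Matrix (X × A) (Fin m) ℝ => y.1 p) (D t) := by
        intro p
        refine Integrable.of_bound
          ((measurable_pi_apply p).comp measurable_fst).aestronglyMeasurable 1 ?_
        filter_upwards [hb t ht] with y hy
        exact abs_le.2 ⟨by linarith [(hy p).1], (hy p).2⟩
      have hmean : ∫ y, -(y.1 ⬝ᵥ q) ∂(D t) = -(meanReward ℛ ⬝ᵥ q) := by
        rw [integral_neg]
        congr 1
        simp only [dotProduct]
        rw [integral_finsetSum _ fun p _ => (hint p).mul_const _]
        refine Finset.sum_congr rfl fun p _ => ?_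
        have hm : Measurable fun r : X × A → ℝ => r p := measurable_pi_apply p
        rw [integral_mul_const, meanReward, ← hDR t ht,
          integral_map measurable_fst.aemeasurable hm.aestronglyMeasurable]
      rw [hmean] at h
      refine le_trans (le_of_eq ?_) h
      refine lintegral_congr fun y => ?_
      rw [sub_dotProduct]
      congr 3
      ring
  -- The bound obtained is δ/2, since only one of the two tails is needed.
  · have e : 2 * errR L T δ ^ 2 / (T * (0 - -(L : ℝ)) ^ 2) = Real.log (2 / δ) := by
      rw [zero_sub, neg_neg, errR, mul_pow, div_pow, Real.sq_sqrt (by norm_num),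
        Real.sq_sqrt (by positivity)]
      field_simp
    rw [e, ← Real.log_inv, inv_div, Real.exp_log (by positivity)]
    linarith

/-! ### The probability of the good event -/

/-- Subadditivity suffices, so the event `G` need not be measurable. -/
lemma one_sub_le_measureReal [IsProbabilityMeasure μ] {G : Set Ω} {c : ℝ} (hc : 0 ≤ c)
    (h : μ Gᶜ ≤ ENNReal.ofReal c) : 1 - c ≤ μ.real G := by
  have h1 : μ.real Gᶜ ≤ c := ENNReal.toReal_le_of_le_ofReal hc h
  have h2 := measureReal_union_le (μ := μ) G Gᶜ
  rw [Set.union_compl_self, probReal_univ] at h2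
  linarith

lemma IsInteraction.ae_isPolicy [Nonempty A] [IsProbabilityMeasure μ]
    (hI : IsInteraction S P T δ π₀ D F μ) (hD : ∀ t < T, IsProbabilityMeasure (D t))
    (hP : IsTransition S P) (h₀ : IsPolicy π₀) (hL : 1 ≤ L) (hT : 1 ≤ T) (hδ : 0 < δ)
    (hδ1 : δ < 1) :
    ∀ᵐ ω ∂μ, ∀ t < T, IsPolicy (playedPolicy S T δ π₀ (fun s => F s ω) t) := by
  filter_upwards [hI.ae_layeredPath hD hP] with ω hω t ht
  exact playedPolicy_isPolicy hL hP hT hδ hδ1 hω ht.le h₀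

lemma IsInteraction.ae_feedbackPair [Nonempty A] [IsProbabilityMeasure μ]
    (hI : IsInteraction S P T δ π₀ D F μ) (hD : ∀ t < T, IsProbabilityMeasure (D t))
    (hP : IsTransition S P) (h₀ : IsPolicy π₀) (hL : 1 ≤ L) (hT : 1 ≤ T) (hδ : 0 < δ)
    (hδ1 : δ < 1) {p : ℕ → (X × A → ℝ) × Matrix (X × A) (Fin m) ℝ → Prop}
    (hp : ∀ t < T, ∀ᵐ y ∂(D t), p t y) : ∀ᵐ ω ∂μ, ∀ t < T, p t (feedbackPair F t ω) := by
  rw [ae_all_iff]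
  intro t
  by_cases ht : t < T
  · have hπ : ∀ᵐ ω ∂μ, IsPolicy (playedPolicy S T δ π₀ (fun s => F s ω) t) := by
      filter_upwards [hI.ae_isPolicy hD hP h₀ hL hT hδ hδ1] with ω hω using hω t ht
    have h := hp t ht
    rw [← hI.map_feedbackPair hP ht hπ] at h
    filter_upwards [ae_of_ae_map (hI.measurable_feedbackPair ht).aemeasurable h] with ω hω _
    exact hω
  · exact Filter.Eventually.of_forall fun ω h => absurd h ht

/-- The event on which the performance guarantees hold for expected rewards. -/
def GoodEvent (S : LayeredSpace X L) (P : X → A → X → ℝ) (T : ℕ) (δ : ℝ) (π₀ : X → A → ℝ)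
    (Gbar : Matrix (X × A) (Fin m) ℝ) (q : X × A → ℝ) (f : ℕ → Feedback X A L m) : Prop :=
  RegularFeedback S T f ∧ Concentrated S P T δ f ∧
  ∑ t ∈ Finset.range T, bonusDeviation S P T δ π₀ f t ≤
    L * Real.sqrt (2 * T * Real.log (1 / δ)) ∧
  ∑ t ∈ Finset.range T, consDeviation S T δ Gbar q f t ≤ m * (T : ℝ) ^ (1 / 4 : ℝ) * errG L T δ

/-- Regularity fails with probability 0, and the three deviations contribute 2δ + δ + δ. -/
lemma IsInteraction.measure_not_goodEvent_le [Nonempty A] [IsProbabilityMeasure μ]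
    (hI : IsInteraction S P T δ π₀ D F μ) (hD : ∀ t < T, IsProbabilityMeasure (D t))
    (hP : IsTransition S P) (h₀ : IsPolicy π₀) (hm : 1 ≤ m) (hL : 1 ≤ L) (hT : 1 ≤ T)
    (hδ : 0 < δ) (hδ4 : δ < 1 / 4)
    {𝒢 : Measure (Matrix (X × A) (Fin m) ℝ)} (hDG : ∀ t < T, (D t).map Prod.snd = 𝒢)
    (hb : ∀ t < T, ∀ᵐ y ∂(D t), ∀ p i, y.2 p i ∈ Set.Icc (-1 : ℝ) 1)
    (hb' : ∀ t < T, ∀ᵐ y ∂(D t), ∀ p, y.1 p ∈ Set.Icc (0 : ℝ) 1)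
    {q : X × A → ℝ} (hq : q ∈ occSet S {P}) :
    μ {ω | ¬ GoodEvent S P T δ π₀ (meanCons 𝒢) q fun s => F s ω} ≤ ENNReal.ofReal (4 * δ) := by
  have hδ1 : δ < 1 := by linarith
  have hπ := hI.ae_isPolicy hD hP h₀ hL hT hδ hδ1
  have hreg : ∀ᵐ ω ∂μ, RegularFeedback S T fun s => F s ω := by
    filter_upwards [hI.ae_layeredPath hD hP, hI.ae_feedbackPair hD hP h₀ hL hT hδ hδ1 hb,
      hI.ae_feedbackPair hD hP h₀ hL hT hδ hδ1 hb'] with ω h1 h2 h3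
    exact ⟨h1, h3, h2⟩
  have e1 := hI.measure_not_concentrated_le hD hP hL hT hδ hδ1 hπ
  have e2 := hI.measure_bonusDeviation_le hD hP hL hT hδ hδ1 hπ
  have e3 := hI.measure_consDeviation_le hD hP hm hL hT hδ hδ4 hπ hDG hb hq
  have e0 : μ {ω | ¬ RegularFeedback S T fun s => F s ω} = 0 := ae_iff.1 hreg
  have hsub : {ω | ¬ GoodEvent S P T δ π₀ (meanCons 𝒢) q fun s => F s ω} ⊆
      {ω | ¬ RegularFeedback S T fun s => F s ω} ∪
      ({ω | (∀ t < T, LayeredPath S (F t ω).path) ∧ ¬ Concentrated S P T δ fun s => F s ω} ∪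
      ({ω | L * Real.sqrt (2 * T * Real.log (1 / δ)) ≤
        ∑ t ∈ Finset.range T, bonusDeviation S P T δ π₀ (fun s => F s ω) t} ∪
      {ω | m * (T : ℝ) ^ (1 / 4 : ℝ) * errG L T δ ≤
        ∑ t ∈ Finset.range T, consDeviation S T δ (meanCons 𝒢) q (fun s => F s ω) t})) := by
    intro ω hω
    by_contra hcon
    simp only [Set.mem_union, Set.mem_ofPred_eq, not_or, not_not, not_and, not_le] at hcon
    obtain ⟨c0, c1, c2, c3⟩ := hcon
    exact hω ⟨c0, c1 c0.path, c2.le, c3.le⟩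
  refine (measure_mono hsub).trans ((measure_union_le _ _).trans ?_)
  rw [e0, zero_add]
  refine (measure_union_le _ _).trans ((add_le_add e1 ((measure_union_le _ _).trans
    (add_le_add e2 e3))).trans (le_of_eq ?_))
  rw [← ENNReal.ofReal_add hδ.le hδ.le, ← ENNReal.ofReal_add (by positivity) (by positivity)]
  congr 1
  ring

end

end

/-! ### The main theorem for both reward models. -/

theorem mainTheorem3 (m L nX nA : ℕ) (hm : 1 ≤ m) (hL : 1 ≤ L) :
    ∃ c : ℝ, 0 < c ∧
      ∀ (X A : Type*) [Fintype X] [Fintype A], Fintype.card X = nX → Fintype.card A = nA →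
      ∀ (S : LayeredSpace X L) (P : X → A → X → ℝ), IsTransition S P →
      ∀ (π₀ : X → A → ℝ), IsPolicy π₀ →
      ∀ (T : ℕ), 1 ≤ T → ∀ (δ : ℝ), 0 < δ → δ < 1 →
      -- stochastic constraints: the law of the constraint matrices
      ∀ (𝒢 : Measure (Matrix (X × A) (Fin m) ℝ)) [IsProbabilityMeasure 𝒢],
      (∀ᵐ G ∂𝒢, ∀ p i, G p i ∈ Set.Icc (-1 : ℝ) 1) →
      -- the offline problem is feasible, and the lower bound on the feasibility parameter fails
      0 ≤ feasParam S P (meanCons 𝒢) →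
      feasParam S P (meanCons 𝒢) < (T : ℝ) ^ (-(1 / 8) : ℝ) * L * Real.sqrt (20 * m) →
      -- the law of the pair (reward vector, constraint matrix) of each episode
      ∀ (D : ℕ → Measure ((X × A → ℝ) × Matrix (X × A) (Fin m) ℝ)),
      (∀ t < T, (D t).map Prod.snd = 𝒢) →
      ∀ (Ω : Type*) [MeasurableSpace Ω] (μ : Measure Ω) [IsProbabilityMeasure μ]
        (F : ℕ → Ω → Feedback X A L m), IsInteraction S P T δ π₀ D F μ →
      -- adversarial rewards
      (∀ r : ℕ → X × A → ℝ, (∀ t < T, ∀ p, r t p ∈ Set.Icc (0 : ℝ) 1) →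
        (∀ t < T, (D t).map Prod.fst = Measure.dirac (r t)) →
        ∀ qstar : X × A → ℝ, IsOptimal S P (averageReward T r) (meanCons 𝒢) qstar →
        1 - 4 * δ ≤ μ.real {ω |
          (let f : ℕ → Feedback X A L m := fun t => F t ω
           let R_T : ℝ := cumRegret S P T δ π₀ (averageReward T r) (meanCons 𝒢) f
           let V_T : ℝ := cumViolation S P T δ π₀ f
           R_T ≤ m * (T : ℝ) ^ (1 / 4 : ℝ) * errG L T δ
                + m * (T : ℝ) ^ (1 / 4 : ℝ) * errQ X A L T δ
                + dualRegret S T δ f 0 + primalRegret S P T δ π₀ f qstar ∧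
           V_T ≤ (2 + 2 * L) * (1 / dualRate X A m T δ) * (T : ℝ) ^ (1 / 4 : ℝ)
                + errQ X A L T δ ∧
           R_T ≤ c * Real.sqrt (Real.log ((T : ℝ) ^ 2 / δ)) * (T : ℝ) ^ (3 / 4 : ℝ) ∧
           V_T ≤ c * Real.sqrt (Real.log ((T : ℝ) ^ 2 / δ)) * (T : ℝ) ^ (3 / 4 : ℝ))}) ∧
      -- stochastic rewards
      (∀ (ℛ : Measure (X × A → ℝ)) [IsProbabilityMeasure ℛ],
        (∀ᵐ r ∂ℛ, ∀ p, r p ∈ Set.Icc (0 : ℝ) 1) →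
        (∀ t < T, (D t).map Prod.fst = ℛ) →
        ∀ qstar : X × A → ℝ, IsOptimal S P (meanReward ℛ) (meanCons 𝒢) qstar →
        1 - 5 * δ ≤ μ.real {ω |
          (let f : ℕ → Feedback X A L m := fun t => F t ω
           let R_T : ℝ := cumRegret S P T δ π₀ (meanReward ℛ) (meanCons 𝒢) f
           let V_T : ℝ := cumViolation S P T δ π₀ f
           R_T ≤ errR L T δ + m * (T : ℝ) ^ (1 / 4 : ℝ) * errG L T δ
                + m * (T : ℝ) ^ (1 / 4 : ℝ) * errQ X A L T δ
                + dualRegret S T δ f 0 + primalRegret S P T δ π₀ f qstar ∧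
           V_T ≤ (2 + 2 * L) * (1 / dualRate X A m T δ) * (T : ℝ) ^ (1 / 4 : ℝ)
                + errQ X A L T δ ∧
           R_T ≤ c * Real.sqrt (Real.log ((T : ℝ) ^ 2 / δ)) * (T : ℝ) ^ (3 / 4 : ℝ) ∧
           V_T ≤ c * Real.sqrt (Real.log ((T : ℝ) ^ 2 / δ)) * (T : ℝ) ^ (3 / 4 : ℝ))}) := by
  refine ⟨perfConst m L nX nA, perfConst_pos m L nX nA, ?_⟩
  intro X A _ _ hX hA S P hP π₀ h₀ T hT δ hδ _ 𝒢 _ hG _ _ D hDG Ω _ μ _ F hI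
  subst hX hA
  have : Nonempty A := nonempty_action S h₀
  have hD : ∀ t < T, IsProbabilityMeasure (D t) := fun t ht => by
    have h := hDG t ht
    constructor
    rw [← Set.preimage_univ (f := Prod.snd), ← Measure.map_apply measurable_snd MeasurableSet.univ,
      h, measure_univ]
  have hb : ∀ t < T, ∀ᵐ y ∂(D t), ∀ p i, y.2 p i ∈ Set.Icc (-1 : ℝ) 1 := fun t ht => by
    rw [← hDG t ht] at hG
    exact ae_of_ae_map measurable_snd.aemeasurable hG
  constructor
  · intro r hr hDr qstar hq
    -- For δ ≥ 1/4 the claimed probability is not positive.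
    rcases le_or_gt (1 / 4) δ with hδ4 | hδ4
    · exact (by linarith : 1 - 4 * δ ≤ 0).trans measureReal_nonneg
    have hfst : ∀ t < T, ∀ᵐ y ∂(D t), y.1 = r t := fun t ht => by
      have h : ∀ᵐ z ∂(Measure.dirac (r t)), z = r t := by simp [ae_dirac_eq]
      rw [← hDr t ht] at h
      exact ae_of_ae_map measurable_fst.aemeasurable h
    have hb' : ∀ t < T, ∀ᵐ y ∂(D t), ∀ p, y.1 p ∈ Set.Icc (0 : ℝ) 1 := fun t ht => by
      filter_upwards [hfst t ht] with y hy p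
      rw [hy]
      exact hr t ht p
    have hae := hI.ae_feedbackPair hD hP h₀ hL hT hδ (by linarith) hfst
    have hbad := hI.measure_not_goodEvent_le hD hP h₀ hm hL hT hδ hδ4 hDG hb hb' hq.1.1
    refine one_sub_le_measureReal (by linarith) (le_trans ?_ hbad)
    -- Rewards equal the prescribed sequence only almost surely, so the inclusion of the bad events
    -- holds up to a null set.
    refine measure_mono_ae ?_
    filter_upwards [hae] with ω hω hbadω hgood
    refine hbadω ?_
    obtain ⟨g1, g2, g3, g4⟩ := hgood
    have hT0 : (T : ℝ) ≠ 0 := by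
      have : (1 : ℝ) ≤ T := by exact_mod_cast hT
      linarith
    -- For adversarial rewards the deviations from the average cancel exactly; no reward error and
    -- no further δ are needed.
    have hsum : ∑ t ∈ Finset.range T, (averageReward T r - (F t ω).reward) ⬝ᵥ qstar ≤ 0 := by
      rw [← sum_dotProduct]
      have : ∑ t ∈ Finset.range T, (averageReward T r - (F t ω).reward) = 0 := by
        have hF : ∑ t ∈ Finset.range T, (F t ω).reward = ∑ t ∈ Finset.range T, r t :=
          Finset.sum_congr rfl fun t ht => hω t (Finset.mem_range.1 ht)
        rw [Finset.sum_sub_distrib, Finset.sum_const, Finset.card_range, hF]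
        funext p
        simp [averageReward, hT0]
      rw [this, zero_dotProduct]
    have hER : 0 ≤ errR L T δ := by unfold errR; positivity
    have h := performance hm hL hP hT hδ hδ4 g1 g2 h₀ hq g3 g4 hER hsum
    rw [zero_add] at h
    exact h
  · intro ℛ _ hℛ hDR qstar hq
    rcases le_or_gt (1 / 4) δ with hδ4 | hδ4
    · exact (by linarith : 1 - 5 * δ ≤ 0).trans measureReal_nonneg
    have hb' : ∀ t < T, ∀ᵐ y ∂(D t), ∀ p, y.1 p ∈ Set.Icc (0 : ℝ) 1 := fun t ht => by
      rw [← hDR t ht] at hℛ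
      exact ae_of_ae_map measurable_fst.aemeasurable hℛ
    have hπ := hI.ae_isPolicy hD hP h₀ hL hT hδ (by linarith)
    have hbad := hI.measure_not_goodEvent_le hD hP h₀ hm hL hT hδ hδ4 hDG hb hb' hq.1.1
    have hrew := hI.measure_rewardDeviation_le hD hP hL hT hδ hδ4 hπ hDR hb' hq.1.1
    refine one_sub_le_measureReal (by linarith) (le_trans (measure_mono ?_)
      ((measure_union_le _ _).trans ((add_le_add hbad hrew).trans (le_of_eq ?_))))
    · intro ω hω
      by_contra hcon
      simp only [Set.mem_union, Set.mem_ofPred_eq, not_or, not_not, not_le] at hcon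
      obtain ⟨⟨g1, g2, g3, g4⟩, g5⟩ := hcon
      exact hω (performance hm hL hP hT hδ hδ4 g1 g2 h₀ hq g3 g4 le_rfl g5.le)
    · rw [← ENNReal.ofReal_add (by positivity) (by positivity)]
      congr 1
      ring
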